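/- Let $n,l\ge 0$ be integers and let $J^1(\mathbb R\times\mathbb R^n,\mathbb R)=\mathbb R^{2n+3}$ have coordinates $(t,q,z,s,p)=(t,q_1,\dots,q_n,z,s,p_1,\dots,p_n)$ and canonical $1$-form $\Theta=dz-\sum_{i=1}^n p_i\,dq_i-s\,dt$. Let $U$ be an open subset of $J^1(\mathbb R\times\mathbb R^n,\mathbb R)$ (for example an open neighbourhood of $0$). Let $C^\Theta_T(U,J^1(\mathbb R\times\mathbb R^n,\mathbb R))$ be the set of $\Theta$-preserving $\mathcal P$-contact embeddings of $U$, that is, of the $C^\infty$ contact embeddings $C:U\to J^1(\mathbb R\times\mathbb R^n,\mathbb R)$ of the form $$C(t,q,z,s,p)=(t,\,q_C(t,q,z,p),\,z_C(t,q,z,p),\,h_C(t,q,z,s,p),\,p_C(t,q,z,p))$$ such that $C^*\Theta=\Theta$. Equip it with the $C^\infty$-topology, i.e. the topology of uniform convergence of the derivatives of every order on compact subsets of $U$. Let $J^l_{C^\Theta_T}(U,J^1(\mathbb R\times\mathbb R^n,\mathbb R))$ be the set of all $l$-jets $j^lC(w_0)$, where $w_0\in U$ and $C$ is the germ at $w_0$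 of a $\Theta$-preserving $\mathcal P$-contact embedding of an open neighbourhood of $w_0$ in $U$. **Theorem ($\mathcal P$-contact transversality theorem).** Let $Q_1,Q_2,\dots$ be (embedded, $C^\infty$) submanifolds of $J^l_{C^\Theta_T}(U,J^1(\mathbb R\times\mathbb R^n,\mathbb R))$. Then the set $$T=\{C\in C^\Theta_T(U,J^1(\mathbb R\times\mathbb R^n,\mathbb R)) : j^lC:U\to J^l_{C^\Theta_T}(U,J^1(\mathbb R\times\mathbb R^n,\mathbb R))\text{ is transversal to } Q_i\text{ for all } i\}$$ is residual in $C^\Theta_T(U,J^1(\mathbb R\times\mathbb R^n,\mathbb R))$, i.e. it contains a countable intersection of open dense subsets. -/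

import Mathlib

open Set Topology
open scoped ContDiff

/-- The big `1`-jet bundle `J¹(ℝ × ℝⁿ, ℝ)`, identified with `ℝ²ⁿ⁺³` through its canonical
coordinates `(t, q, z, s, p)`, in this order. -/
abbrev BigJet (n : ℕ) : Type := ℝ × (Fin n → ℝ) × ℝ × ℝ × (Fin n → ℝ)

namespace BigJet

/-- The coordinate `t`. -/
abbrev t {n : ℕ} (w : BigJet n) : ℝ := w.1

/-- The coordinates `q = (q₁, …, qₙ)`. -/
abbrev q {n : ℕ} (w : BigJet n) : Fin n → ℝ := w.2.1

/-- The coordinate `z`. -/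
abbrev z {n : ℕ} (w : BigJet n) : ℝ := w.2.2.1

/-- The coordinate `s`, dual to `t`. -/
abbrev s {n : ℕ} (w : BigJet n) : ℝ := w.2.2.2.1

/-- The coordinates `p = (p₁, …, pₙ)`, dual to `q`. -/
abbrev p {n : ℕ} (w : BigJet n) : Fin n → ℝ := w.2.2.2.2

end BigJet

/-- The canonical `1`-form `Θ = dz - ∑ pᵢ dqᵢ - s dt`, at the point `w` and on the tangent
vector `v`. -/
def canonicalForm {n : ℕ} (w v : BigJet n) : ℝ :=
  v.z - ∑ i, w.p i * v.q i - w.s * v.t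

/-- `C` restricts to a smooth embedding of the open set `U` into `J¹(ℝ × ℝⁿ, ℝ)`. -/
structure IsSmoothEmbeddingOn {n : ℕ} (U : Set (BigJet n)) (C : BigJet n → BigJet n) : Prop where
  contDiffOn : ContDiffOn ℝ ∞ C U
  injective_fderiv : ∀ w ∈ U, Function.Injective (fderiv ℝ C w)
  isEmbedding : IsEmbedding (U.domRestrict C)

/-- `C` restricts to a contact embedding of the open set `U`: a smooth embedding which respects
the field of contact hyperplanes `ker Θ`. -/
structure IsContactEmbeddingOn {n : ℕ} (U : Set (BigJet n)) (C : BigJet n → BigJet n) : Prop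
    extends IsSmoothEmbeddingOn U C where
  contact : ∀ w ∈ U, ∀ v,
    canonicalForm (C w) (fderiv ℝ C w v) = 0 ↔ canonicalForm w v = 0

/-- On `U`, the map `C` is of the form
`C(t,q,z,s,p) = (t, q_C(t,q,z,p), z_C(t,q,z,p), h_C(t,q,z,s,p), p_C(t,q,z,p))`. -/
def HasPForm {n : ℕ} (U : Set (BigJet n)) (C : BigJet n → BigJet n) : Prop :=
  ∃ (qC : ℝ → (Fin n → ℝ) → ℝ → (Fin n → ℝ) → (Fin n → ℝ))
    (zC : ℝ → (Fin n → ℝ) → ℝ → (Fin n → ℝ) → ℝ)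
    (hC : ℝ → (Fin n → ℝ) → ℝ → ℝ → (Fin n → ℝ) → ℝ)
    (pC : ℝ → (Fin n → ℝ) → ℝ → (Fin n → ℝ) → (Fin n → ℝ)),
    ∀ t q z s p, (t, q, z, s, p) ∈ U →
      C (t, q, z, s, p) = (t, qC t q z p, zC t q z p, hC t q z s p, pC t q z p)

/-- `C` restricts to a `P`-contact embedding of the open set `U` with `C^*Θ = Θ`. -/
structure IsThetaPContactEmbeddingOn {n : ℕ} (U : Set (BigJet n)) (C : BigJet n → BigJet n) : Prop
    extends IsContactEmbeddingOn U C where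
  hasPForm : HasPForm U C
  preserves : ∀ w ∈ U, ∀ v, canonicalForm (C w) (fderiv ℝ C w v) = canonicalForm w v

/-- The set of `P`-contact embeddings `U → J¹(ℝ × ℝⁿ, ℝ)` preserving `Θ`, for an open set `U`.
A map on `U` is represented by its extension by zero, so that two elements are equal exactly when
they agree on `U`. -/
structure ThetaPContactEmbedding {n : ℕ} (U : Set (BigJet n)) where
  toFun : BigJet n → BigJet n
  eq_zero : ∀ w, w ∉ U → toFun w = 0
  isThetaPContactEmbeddingOn : IsThetaPContactEmbeddingOn U toFun

/-- The `C^∞`-topology: the coarsest one for which, for every `k`, the derivative of order `k`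
depends continuously on the map, for uniform convergence on the compact subsets of `U`. -/
noncomputable instance ThetaPContactEmbedding.instTopologicalSpace {n : ℕ} (U : Set (BigJet n)) :
    TopologicalSpace (ThetaPContactEmbedding U) :=
  ⨅ k : ℕ, TopologicalSpace.induced
    (fun C : ThetaPContactEmbedding U =>
      UniformOnFun.ofFun {K : Set (BigJet n) | IsCompact K ∧ K ⊆ U}
        (iteratedFDeriv ℝ k C.toFun))
    inferInstance

/-- The finite-dimensional vector space in which `l`-jets live: a jet is recorded by its source
point together with its derivatives of orders `0, …, l` there. The order `0` entry is the target
point. -/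
abbrev JetSpace (n l : ℕ) : Type :=
  BigJet n × ((k : Fin (l + 1)) →
    ContinuousMultilinearMap ℝ (fun _ : Fin (k : ℕ) => BigJet n) (BigJet n))

/-- The `l`-jet `j^l C (w)`. -/
noncomputable def jet {n : ℕ} (l : ℕ) (C : BigJet n → BigJet n) (w : BigJet n) : JetSpace n l :=
  (w, fun k => iteratedFDeriv ℝ (k : ℕ) C w)

/-- The space of `l`-jets, at the points `w` of `U`, of germs `(U, w) → J¹(ℝ × ℝⁿ, ℝ)` of
`P`-contact embeddings preserving `Θ`. -/
def thetaPContactJets {n : ℕ} (l : ℕ) (U : Set (BigJet n)) : Set (JetSpace n l) :=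
  {j | ∃ w ∈ U, ∃ V : Set (BigJet n), IsOpen V ∧ w ∈ V ∧ V ⊆ U ∧
    ∃ C : BigJet n → BigJet n, IsThetaPContactEmbeddingOn V C ∧ j = jet l C w}

/-- `S` is an (embedded) smooth submanifold of the finite-dimensional space `F`: around each of its
points, some local diffeomorphism of `F` straightens it to a linear subspace. -/
def IsSmoothSubmanifold {F : Type*} [NormedAddCommGroup F] [NormedSpace ℝ F] (S : Set F) : Prop :=
  ∀ x ∈ S, ∃ (φ : OpenPartialHomeomorph F F) (L : Submodule ℝ F), x ∈ φ.source ∧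
    ContDiffOn ℝ ∞ φ φ.source ∧ ContDiffOn ℝ ∞ φ.symm φ.target ∧
    ∀ y ∈ φ.source, y ∈ S ↔ φ y ∈ L

/-- The vectors tangent to `S` at `x`: the velocities at `x` of the smooth curves in `S`. For a
submanifold, this is its tangent space. -/
def tangentVectors {F : Type*} [NormedAddCommGroup F] [NormedSpace ℝ F] (S : Set F) (x : F) :
    Set F :=
  {v | ∃ (ε : ℝ) (γ : ℝ → F), 0 < ε ∧ ContDiffOn ℝ ∞ γ (Ioo (-ε) ε) ∧
    (∀ τ ∈ Ioo (-ε) ε, γ τ ∈ S) ∧ γ 0 = x ∧ HasDerivAt γ v 0}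

/-- The jet extension `j^l C : U → J` is transversal to the submanifold `Q` of
`J = thetaPContactJets l U`: wherever it meets `Q`, every vector tangent to `J` is the sum of a
vector tangent to `Q` and of a vector in the image of the differential of `j^l C`. -/
def JetTransversal {n : ℕ} (l : ℕ) (U : Set (BigJet n)) (C : BigJet n → BigJet n)
    (Q : Set (JetSpace n l)) : Prop :=
  ∀ w ∈ U, jet l C w ∈ Q →
    ∀ v ∈ tangentVectors (thetaPContactJets l U) (jet l C w),
      ∃ u ∈ tangentVectors Q (jet l C w), ∃ x : BigJet n, v = u + fderiv ℝ (jet l C) w x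

/-! Fix one submanifold `Q`. Cover `Q` by countably many closed balls `B`, each inside a chart that
straightens `Q`, and `U` by countably many compact balls `K`. The embeddings that are transversal to
`Q` at the points of `K` whose jets lie in `B` form an open dense set
(`IsGenerating.isOpen_transversalOn`, `IsGenerating.dense_transversalOn`), and countable
intersections of such sets are residual.

Openness: transversality at a point is a lower bound on the rank of a linear map built from finitely
many derivatives of `C` (`IsGenerating.jetTransversalAt_iff`), hence stable under small
perturbations.

Density: write `ω = -dΘ`. A vector field `X` with `L_X Θ = 0` is determined by `h = Θ(X)`, through
`dh = ω(X, ·)`. Then `∂h/∂z = 0`, and `dt(X) = 0` means `∂h/∂s = 0`, so `h` is a function of `(t, q,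
p)`. As `X` involves `dh`, the `l`-jets of such fields only see polynomials `h` of degree `≤ l + 1`.
These are spanned by powers `m ^ (l + 1)` of affine functions, whose flows are explicit polynomial
maps (`shear`); no cut-off and no integration of vector fields is needed. Composing the flows of a
basis of powers gives a finite-dimensional family of diffeomorphisms `D_a` with `D_0 = id`, and
`Ψ(a, w) = j^l(D_a ∘ C)(w)` is an immersion along `a = 0`.

The heart of the matter is that the range of `dΨ` contains every tangent vector of the space of
jets, which is only given as a set with velocities of curves (`exists_of_mem_tangentVectors`). The
germs realising a curve of jets need not vary smoothly, but their Taylor polynomials do. The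
velocity of this polynomial family solves the linearised equations to finite order, and a Poincaré
lemma for jets makes it Hamiltonian to that order (`exists_hamiltonian`,
`exists_hamField_of_linearized`).

Parametric transversality concludes: a local left inverse of `Ψ`, followed by the projection to the
parameters and restricted to `Q`, has almost every `a` as a regular value by Sard's theorem
(`measure_image_critical`), and for such small `a` the deformation `D_a ∘ C` is transversal to `Q`
locally. -/

/-! ### Calculus of orders of vanishing -/

section Vanishing

open Filter

/-- `f` vanishes to order `m` at `y`: all derivatives of order `< m` vanish at `y`. -/
def VanishesTo {E F : Type} [NormedAddCommGroup E] [NormedSpace ℝ E] [NormedAddCommGroup F]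
    [NormedSpace ℝ F] (m : ℕ) (f : E → F) (y : E) : Prop :=
  ∀ k < m, iteratedFDeriv ℝ k f y = 0

variable {E F G H : Type} [NormedAddCommGroup E] [NormedSpace ℝ E] [NormedAddCommGroup F]
  [NormedSpace ℝ F] [NormedAddCommGroup G] [NormedSpace ℝ G] [NormedAddCommGroup H]
  [NormedSpace ℝ H]

theorem ContDiffAt.fderiv_infty {f : E → F} {y : E} (h : ContDiffAt ℝ ∞ f y) :
    ContDiffAt ℝ ∞ (fderiv ℝ f) y :=
  h.fderiv_right (m := ∞) (by norm_cast)

theorem ContDiffAt.iteratedFDeriv_infty {f : E → F} {y : E} (h : ContDiffAt ℝ ∞ f y) (k : ℕ) :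
    ContDiffAt ℝ ∞ (iteratedFDeriv ℝ k f) y :=
  h.iteratedFDeriv_right (m := ∞) (by norm_cast)

theorem ContDiffAt.eventually_differentiableAt {f : E → F} {y : E} (h : ContDiffAt ℝ ∞ f y) :
    ∀ᶠ x in 𝓝 y, DifferentiableAt ℝ f x :=
  ((h.of_le (m := 1) (by norm_cast)).eventually (by decide)).mono
    fun _ hx => hx.differentiableAt (by norm_num)

theorem vanishesTo_zero (f : E → F) (y : E) : VanishesTo 0 f y := fun _ h => absurd h (by simp)

theorem iteratedFDeriv_succ_eq_zero_iff {k : ℕ} {f : E → F} {y : E} :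
    iteratedFDeriv ℝ (k + 1) f y = 0 ↔ iteratedFDeriv ℝ k (fderiv ℝ f) y = 0 := by
  rw [← norm_eq_zero, ← norm_iteratedFDeriv_fderiv, norm_eq_zero]

theorem iteratedFDeriv_zero_eq_zero_iff {f : E → F} {y : E} :
    iteratedFDeriv ℝ 0 f y = 0 ↔ f y = 0 := by
  rw [← norm_eq_zero, norm_iteratedFDeriv_zero, norm_eq_zero]

theorem vanishesTo_succ_iff {m : ℕ} {f : E → F} {y : E} :
    VanishesTo (m + 1) f y ↔ f y = 0 ∧ VanishesTo m (fderiv ℝ f) y := by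
  refine ⟨fun h => ⟨iteratedFDeriv_zero_eq_zero_iff.1 (h 0 (by omega)), fun k hk =>
    iteratedFDeriv_succ_eq_zero_iff.1 (h (k + 1) (by omega))⟩, fun h k hk => ?_⟩
  cases k with
  | zero => exact iteratedFDeriv_zero_eq_zero_iff.2 h.1
  | succ k => exact iteratedFDeriv_succ_eq_zero_iff.2 (h.2 k (by omega))

namespace VanishesTo

variable {m : ℕ} {f g : E → F} {y : E}

theorem eq_zero (h : VanishesTo (m + 1) f y) : f y = 0 := (vanishesTo_succ_iff.1 h).1

theorem fderiv (h : VanishesTo (m + 1) f y) : VanishesTo m (fderiv ℝ f) y :=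
  (vanishesTo_succ_iff.1 h).2

theorem mono {k : ℕ} (h : VanishesTo m f y) (hk : k ≤ m) : VanishesTo k f y :=
  fun j hj => h j (by omega)

theorem congr (h : VanishesTo m f y) (hfg : f =ᶠ[𝓝 y] g) : VanishesTo m g y :=
  fun k hk => (hfg.symm.iteratedFDeriv ℝ k).eq_of_nhds.trans (h k hk)

theorem of_eventually_eq_zero (h : ∀ᶠ x in 𝓝 y, f x = 0) : VanishesTo m f y := by
  refine VanishesTo.congr (f := fun _ => 0) (fun k _ => ?_) ?_
  · simp
  · filter_upwards [h] with x hx using hx.symm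

theorem _root_.ContDiffAt.nat_of_infty {f : E → F} {y : E} (h : ContDiffAt ℝ ∞ f y) (k : ℕ) :
    ContDiffAt ℝ k f y := h.of_le (by exact_mod_cast le_top)

theorem add (hf : VanishesTo m f y) (hg : VanishesTo m g y) (cf : ContDiffAt ℝ ∞ f y)
    (cg : ContDiffAt ℝ ∞ g y) : VanishesTo m (fun x => f x + g x) y := fun k hk => by
  have := iteratedFDeriv_add_apply (cf.nat_of_infty k) (cg.nat_of_infty k)
  rw [hf k hk, hg k hk, add_zero] at this
  exact this

theorem clm_comp (L : F →L[ℝ] G) (hf : VanishesTo m f y) (cf : ContDiffAt ℝ ∞ f y) :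
    VanishesTo m (fun x => L (f x)) y := fun k hk => by
  have := L.iteratedFDeriv_comp_left (cf.nat_of_infty k) (i := k) le_rfl
  rw [hf k hk] at this
  refine Eq.trans this ?_
  ext; simp

theorem neg (hf : VanishesTo m f y) (cf : ContDiffAt ℝ ∞ f y) :
    VanishesTo m (fun x => - f x) y := by
  simpa using hf.clm_comp (-ContinuousLinearMap.id ℝ F) cf

theorem sub (hf : VanishesTo m f y) (hg : VanishesTo m g y) (cf : ContDiffAt ℝ ∞ f y)
    (cg : ContDiffAt ℝ ∞ g y) : VanishesTo m (fun x => f x - g x) y := by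
  simpa [sub_eq_add_neg] using hf.add (hg.neg cg) cf cg.neg

/-- Leibniz rule and induction on the order. The target spaces have to vary in the induction, since
differentiating replaces `B` by bilinear maps with values in spaces of linear maps. -/
theorem bilin (B : F →L[ℝ] G →L[ℝ] H) {f : E → F} {g : E → G} (hf : VanishesTo m f y)
    (cf : ContDiffAt ℝ ∞ f y) (cg : ContDiffAt ℝ ∞ g y) :
    VanishesTo m (fun x => B (f x) (g x)) y := by
  induction m generalizing F G H with
  | zero => exact vanishesTo_zero _ _
  | succ m ih =>
    refine vanishesTo_succ_iff.2 ⟨by simp [hf.eq_zero], ?_⟩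
    have key : (fun x => (B.precompR E (f x) (_root_.fderiv ℝ g x) +
        B.precompL E (_root_.fderiv ℝ f x) (g x))) =ᶠ[𝓝 y]
        _root_.fderiv ℝ (fun x => B (f x) (g x)) := by
      filter_upwards [cf.eventually_differentiableAt, cg.eventually_differentiableAt] with x h1 h2
      exact (B.hasFDerivAt_of_bilinear h1.hasFDerivAt h2.hasFDerivAt).fderiv.symm
    refine VanishesTo.congr (VanishesTo.add ?_ ?_ ?_ ?_) key
    · exact ih (B.precompR E) (hf.mono (by omega)) cf cg.fderiv_infty
    · exact ih (B.precompL E) hf.fderiv cf.fderiv_infty cg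
    · exact ((B.precompR E).contDiff.contDiffAt.comp y cf).clm_apply cg.fderiv_infty
    · exact ((B.precompL E).contDiff.contDiffAt.comp y cf.fderiv_infty).clm_apply cg

theorem clm_apply {f : E → F →L[ℝ] G} {g : E → F} (hf : VanishesTo m f y)
    (cf : ContDiffAt ℝ ∞ f y) (cg : ContDiffAt ℝ ∞ g y) :
    VanishesTo m (fun x => f x (g x)) y :=
  hf.bilin (ContinuousLinearMap.id ℝ (F →L[ℝ] G)) cf cg

theorem clm_apply_right {f : E → F →L[ℝ] G} {g : E → F} (hg : VanishesTo m g y)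
    (cf : ContDiffAt ℝ ∞ f y) (cg : ContDiffAt ℝ ∞ g y) :
    VanishesTo m (fun x => f x (g x)) y :=
  hg.bilin (ContinuousLinearMap.id ℝ (F →L[ℝ] G)).flip cg cf

theorem clm_apply_const {f : E → F →L[ℝ] G} (hf : VanishesTo m f y)
    (cf : ContDiffAt ℝ ∞ f y) (v : F) : VanishesTo m (fun x => f x v) y :=
  hf.clm_apply cf contDiffAt_const

theorem mul {f g : E → ℝ} (hf : VanishesTo m f y)
    (cf : ContDiffAt ℝ ∞ f y) (cg : ContDiffAt ℝ ∞ g y) :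
    VanishesTo m (fun x => f x * g x) y := by
  simpa using hf.bilin (ContinuousLinearMap.mul ℝ ℝ) cf cg

theorem comp {f : F → G} {c : E → F} (hf : VanishesTo m f (c y)) (cf : ContDiffAt ℝ ∞ f (c y))
    (cc : ContDiffAt ℝ ∞ c y) : VanishesTo m (fun x => f (c x)) y := by
  induction m generalizing G with
  | zero => exact vanishesTo_zero _ _
  | succ m ih =>
    refine vanishesTo_succ_iff.2 ⟨hf.eq_zero, ?_⟩
    have key : (fun x => ContinuousLinearMap.compL ℝ E F G (_root_.fderiv ℝ f (c x))
        (_root_.fderiv ℝ c x)) =ᶠ[𝓝 y] _root_.fderiv ℝ (fun x => f (c x)) := by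
      filter_upwards [cc.continuousAt.eventually cf.eventually_differentiableAt,
        cc.eventually_differentiableAt] with x h1 h2
      exact (fderiv_comp x h1 h2).symm
    exact ((ih hf.fderiv cf.fderiv_infty).bilin _ (cf.fderiv_infty.comp y cc)
      cc.fderiv_infty).congr key

/-- It suffices to evaluate on each vector: a family of linear maps vanishes to order `m`
as soon as all its evaluations do. -/
theorem of_forall_apply [FiniteDimensional ℝ F] {f : E → F →L[ℝ] G} (cf : ContDiffAt ℝ ∞ f y)
    (h : ∀ v, VanishesTo m (fun x => f x v) y) : VanishesTo m f y := by
  intro k hk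
  ext u v
  have h1 := h v k hk
  have h2 := (ContinuousLinearMap.apply ℝ G v).iteratedFDeriv_comp_left (cf.nat_of_infty k)
    (i := k) le_rfl
  have h3 : iteratedFDeriv ℝ k (⇑(ContinuousLinearMap.apply ℝ G v) ∘ f) y = 0 := h1
  rw [h3] at h2
  simpa using (congrArg (fun M => M u) h2).symm

end VanishesTo

theorem eventuallyEq_fderiv_slice {f : ℝ × E → F} {w : E} (cf : ContDiffAt ℝ ∞ f (0, w)) :
    ∀ᶠ p in 𝓝 ((0 : ℝ), w), _root_.fderiv ℝ (fun x => f (p.1, x)) p.2 =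
      (_root_.fderiv ℝ f p).comp (ContinuousLinearMap.inr ℝ ℝ E) := by
  filter_upwards [cf.eventually_differentiableAt] with p hp
  have h1 : HasFDerivAt (fun x : E => (p.1, x)) (ContinuousLinearMap.inr ℝ ℝ E) p.2 :=
    hasFDerivAt_prodMk_right _ _
  exact (HasFDerivAt.comp p.2 (g := f) hp.hasFDerivAt h1).fderiv

/-- Symmetry of second derivatives: the derivative in the parameter and the derivative in the space
variable commute. -/
theorem ContDiffAt.fderiv_slice_comm {f : ℝ × E → F} {w : E} (cf : ContDiffAt ℝ ∞ f (0, w)) :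
    (fun x => fderiv ℝ (fun p => (fderiv ℝ f p).comp (ContinuousLinearMap.inr ℝ ℝ E))
      ((0 : ℝ), x) (1, 0)) =ᶠ[𝓝 w]
    fderiv ℝ (fun x => fderiv ℝ f ((0 : ℝ), x) (1, 0)) := by
  have hc : ContinuousAt (fun x : E => ((0 : ℝ), x)) w := by fun_prop
  have h2 := (cf.nat_of_infty 2).eventually (by decide)
  filter_upwards [hc.eventually h2, hc.eventually cf.fderiv_infty.eventually_differentiableAt]
    with x hx hd
  ext v
  have hs : IsSymmSndFDerivAt ℝ f ((0 : ℝ), x) :=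
    hx.isSymmSndFDerivAt (by simp)
  have e1 : HasFDerivAt (fun p => (fderiv ℝ f p).comp (ContinuousLinearMap.inr ℝ ℝ E))
      (((ContinuousLinearMap.compL ℝ E (ℝ × E) F).flip (ContinuousLinearMap.inr ℝ ℝ E)).comp
        (fderiv ℝ (fderiv ℝ f) ((0 : ℝ), x))) ((0 : ℝ), x) :=
    (((ContinuousLinearMap.compL ℝ E (ℝ × E) F).flip
      (ContinuousLinearMap.inr ℝ ℝ E)).hasFDerivAt).comp _ hd.hasFDerivAt
  have h1 : HasFDerivAt (fun x : E => ((0 : ℝ), x)) (ContinuousLinearMap.inr ℝ ℝ E) x :=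
    hasFDerivAt_prodMk_right _ _
  have e2 : HasFDerivAt (fun x => fderiv ℝ f ((0 : ℝ), x) (1, 0))
      ((ContinuousLinearMap.apply ℝ F ((1 : ℝ), (0 : E))).comp
        ((fderiv ℝ (fderiv ℝ f) ((0 : ℝ), x)).comp (ContinuousLinearMap.inr ℝ ℝ E))) x :=
    (ContinuousLinearMap.apply ℝ F ((1 : ℝ), (0 : E))).hasFDerivAt.comp x
      (HasFDerivAt.comp x (g := fderiv ℝ f) hd.hasFDerivAt h1)
  rw [e1.fderiv, e2.fderiv]
  simpa using hs (1, 0) (0, v)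

/-- If `f (τ, ·)` vanishes to order `m` at `c τ` for all small `τ`, and `f (0, ·) = 0`, then the
derivative of the family at `τ = 0` vanishes to order `m` at `c 0`. -/
theorem VanishesTo.family_deriv {m : ℕ} {f : ℝ × E → F} {c : ℝ → E}
    (cf : ContDiffAt ℝ ∞ f (0, c 0)) (hc : DifferentiableAt ℝ c 0)
    (h0 : ∀ᶠ x in 𝓝 (c 0), f (0, x) = 0)
    (h : ∀ᶠ τ in 𝓝 (0 : ℝ), VanishesTo m (fun x => f (τ, x)) (c τ)) :
    VanishesTo m (fun x => _root_.fderiv ℝ f ((0 : ℝ), x) (1, 0)) (c 0) := by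
  induction m generalizing F with
  | zero => exact vanishesTo_zero _ _
  | succ m ih =>
    have hd : DifferentiableAt ℝ f (0, c 0) := cf.differentiableAt (by simp)
    have hslice := eventuallyEq_fderiv_slice cf
    have hcc : Tendsto (fun τ => (τ, c τ)) (𝓝 0) (𝓝 ((0 : ℝ), c 0)) :=
      (continuousAt_id.prodMk hc.continuousAt)
    have hx0 : Tendsto (fun x : E => ((0 : ℝ), x)) (𝓝 (c 0)) (𝓝 ((0 : ℝ), c 0)) := by
      have : ContinuousAt (fun x : E => ((0 : ℝ), x)) (c 0) := by fun_prop
      exact this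
    have hzero : ∀ᶠ x in 𝓝 (c 0),
        (_root_.fderiv ℝ f (0, x)).comp (ContinuousLinearMap.inr ℝ ℝ E) = 0 := by
      filter_upwards [hx0.eventually hslice, h0.eventually_nhds] with x hx h0x
      rw [← hx]
      have : (fun x => f (0, x)) =ᶠ[𝓝 x] fun _ => 0 := h0x
      rw [this.fderiv_eq]; simp
    refine vanishesTo_succ_iff.2 ⟨?_, ?_⟩
    -- Differentiate `f (τ, c τ) = 0` at `τ = 0`. The contribution of the motion of `c` is a
    -- derivative of `f (0, ·) = 0`, so only the derivative in `τ` remains.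
    · have e1 : HasFDerivAt (fun τ : ℝ => f (τ, c τ)) ((_root_.fderiv ℝ f (0, c 0)).comp
          ((ContinuousLinearMap.id ℝ ℝ).prod (_root_.fderiv ℝ c 0))) 0 :=
        HasFDerivAt.comp (0 : ℝ) (g := f) hd.hasFDerivAt
          ((hasFDerivAt_id (0 : ℝ)).prodMk hc.hasFDerivAt)
      have e2 : (fun τ : ℝ => f (τ, c τ)) =ᶠ[𝓝 0] fun _ => 0 := h.mono fun τ hτ => hτ.eq_zero
      have e3 := e1.fderiv
      rw [e2.fderiv_eq, fderiv_fun_const] at e3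
      have e4 := congrArg (fun L => L (1 : ℝ)) e3
      have e5 := congrArg (fun L => L (_root_.fderiv ℝ c 0 1)) hzero.self_of_nhds
      simp only [ContinuousLinearMap.comp_apply, ContinuousLinearMap.prod_apply,
        ContinuousLinearMap.inr_apply, ContinuousLinearMap.id_apply,
        zero_apply, Pi.zero_apply] at e4 e5
      have e6 : ((1 : ℝ), _root_.fderiv ℝ c 0 1) = (1, 0) + (0, _root_.fderiv ℝ c 0 1) := by simp
      rw [e6, map_add, e5, add_zero] at e4
      exact e4.symm
    -- The induction hypothesis is applied to the family of space derivatives, which also vanishes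
    -- identically at `τ = 0`.
    · refine VanishesTo.congr (ih (F := E →L[ℝ] F)
        (f := fun p => (_root_.fderiv ℝ f p).comp (ContinuousLinearMap.inr ℝ ℝ E)) ?_ hzero ?_)
        cf.fderiv_slice_comm
      · exact cf.fderiv_infty.clm_comp contDiffAt_const
      · filter_upwards [h, hcc.eventually hslice.eventually_nhds] with τ hτ hs
        refine hτ.fderiv.congr ?_
        have : Tendsto (fun x : E => (τ, x)) (𝓝 (c τ)) (𝓝 (τ, c τ)) := by
          have : ContinuousAt (fun x : E => (τ, x)) (c τ) := by fun_prop
          exact this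
        exact this.eventually hs

theorem VanishesTo.of_fderiv {m : ℕ} {f : E → F} {y : E} (h : VanishesTo m (_root_.fderiv ℝ f) y)
    (h0 : f y = 0) : VanishesTo (m + 1) f y := vanishesTo_succ_iff.2 ⟨h0, h⟩

end Vanishing

/-! ### Symmetric derivatives, Taylor polynomials and the radial homotopy for jets of 1-forms -/

section Taylor

open Filter

variable {E F G H : Type} [NormedAddCommGroup E] [NormedSpace ℝ E] [NormedAddCommGroup F]
  [NormedSpace ℝ F] [NormedAddCommGroup G] [NormedSpace ℝ G] [NormedAddCommGroup H]
  [NormedSpace ℝ H]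

theorem iteratedFDeriv_apply_clm {f : E → F →L[ℝ] G} {y : E} (cf : ContDiffAt ℝ ∞ f y) (k : ℕ)
    (v : Fin k → E) (u : F) :
    iteratedFDeriv ℝ k f y v u = iteratedFDeriv ℝ k (fun x => f x u) y v := by
  have h2 := (ContinuousLinearMap.apply ℝ G u).iteratedFDeriv_comp_left (cf.nat_of_infty k)
    (i := k) le_rfl
  exact (congrArg (fun M => M v) h2).symm

/-- The last two arguments are those of the innermost second derivative, which is symmetric near
`y`; the outer `k` derivatives then act on equal germs. -/
theorem ContDiffAt.iteratedFDeriv_swap_last {f : E → F} {y : E} (cf : ContDiffAt ℝ ∞ f y) (k : ℕ)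
    (v : Fin (k + 2) → E) :
    iteratedFDeriv ℝ (k + 2) f y
      (v ∘ Equiv.swap (Fin.last k).castSucc (Fin.last k).succ) = iteratedFDeriv ℝ (k + 2) f y v := by
  have key : ∀ v : Fin (k + 2) → E, iteratedFDeriv ℝ (k + 2) f y v =
      iteratedFDeriv ℝ k (fun x => fderiv ℝ (fderiv ℝ f) x (v (Fin.last k).castSucc)
        (v (Fin.last k).succ)) y (Fin.init (Fin.init v)) := by
    intro v
    rw [iteratedFDeriv_succ_apply_right, iteratedFDeriv_succ_apply_right,
      iteratedFDeriv_apply_clm cf.fderiv_infty.fderiv_infty,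
      iteratedFDeriv_apply_clm (cf.fderiv_infty.fderiv_infty.clm_apply contDiffAt_const)]
    rfl
  have hsym : ∀ a b : E, (fun x => fderiv ℝ (fderiv ℝ f) x a b) =ᶠ[𝓝 y]
      fun x => fderiv ℝ (fderiv ℝ f) x b a := by
    intro a b
    filter_upwards [(cf.nat_of_infty 2).eventually (by decide)] with x hx
    exact (hx.isSymmSndFDerivAt (by simp)) a b
  rw [key, key]
  have h1 : Fin.init (Fin.init (v ∘ Equiv.swap (Fin.last k).castSucc (Fin.last k).succ)) =
      Fin.init (Fin.init v) := by
    ext i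
    simp only [Fin.init, Function.comp]
    rw [Equiv.swap_apply_of_ne_of_ne]
    · exact fun h => by
        have := congrArg Fin.val h; simp at this; omega
    · exact fun h => by
        have := congrArg Fin.val h; simp at this; omega
  rw [h1]
  simp only [Function.comp, Equiv.swap_apply_left, Equiv.swap_apply_right]
  rw [((hsym (v (Fin.last k).succ) (v (Fin.last k).castSucc)).iteratedFDeriv ℝ k).eq_of_nhds]

/-- Iterated derivatives of smooth functions are symmetric. -/
theorem ContDiffAt.iteratedFDeriv_perm {f : E → F} {y : E} (cf : ContDiffAt ℝ ∞ f y) {k : ℕ}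
    (v : Fin k → E) (σ : Equiv.Perm (Fin k)) :
    iteratedFDeriv ℝ k f y (v ∘ σ) = iteratedFDeriv ℝ k f y v := by
  induction k generalizing F with
  | zero => congr 1; ext i; exact i.elim0
  | succ k ih =>
    let M : Submonoid (Equiv.Perm (Fin (k + 1))) :=
      { carrier := {σ | ∀ v : Fin (k + 1) → E,
          iteratedFDeriv ℝ (k + 1) f y (v ∘ σ) = iteratedFDeriv ℝ (k + 1) f y v}
        one_mem' := fun v => rfl
        mul_mem' := fun {a b} ha hb v => by
          have := hb (v ∘ a)
          rw [ha] at this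
          exact this }
    suffices h : M = ⊤ by
      have : σ ∈ M := h ▸ Submonoid.mem_top _
      exact this v
    -- Adjacent transpositions generate the symmetric group. The last one is handled by
    -- `iteratedFDeriv_swap_last`; the others fix the last argument and follow by induction applied
    -- to `fderiv ℝ f`.
    rw [eq_top_iff, ← Equiv.Perm.mclosure_swap_castSucc_succ, Submonoid.closure_le]
    rintro _ ⟨i, rfl⟩ v
    cases k with
    | zero => exact i.elim0
    | succ k =>
      induction i using Fin.lastCases with
      | last => exact cf.iteratedFDeriv_swap_last k v
      | cast i =>
        rw [iteratedFDeriv_succ_apply_right (n := k + 1),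
          iteratedFDeriv_succ_apply_right (n := k + 1) (m := v)]
        have h1 : Fin.init (v ∘ Equiv.swap i.castSucc.castSucc i.castSucc.succ) =
            Fin.init v ∘ Equiv.swap i.castSucc i.succ := by
          ext j
          simp only [Fin.init, Function.comp]
          congr 1
          rw [show i.castSucc.succ = i.succ.castSucc from rfl]
          exact (Fin.castSucc_injective _).swap_apply i.castSucc i.succ j
        have h2 : (v ∘ Equiv.swap i.castSucc.castSucc i.castSucc.succ) (Fin.last (k + 1)) =
            v (Fin.last (k + 1)) := by
          simp only [Function.comp]
          rw [Equiv.swap_apply_of_ne_of_ne]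
          · exact fun h => by
              have := congrArg Fin.val h; simp at this; omega
          · exact fun h => by
              have := congrArg Fin.val h; simp at this; omega
        rw [h1, h2]
        exact DFunLike.congr_fun (ih cf.fderiv_infty (Fin.init v) (Equiv.swap i.castSucc i.succ)) _

/-- The polynomial with prescribed symmetric derivatives `p k`, `k ≤ d`, at `0`. -/
noncomputable def jetPolynomial (d : ℕ) (p : (k : Fin (d + 1)) →
    ContinuousMultilinearMap ℝ (fun _ : Fin (k : ℕ) => E) F) (x : E) : F :=
  ∑ k : Fin (d + 1), ((k : ℕ).factorial : ℝ)⁻¹ • p k (fun _ => x)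

/-- Joint smoothness in the coefficients and the point is what is needed later, when the
coefficients run along a curve of jets. -/
theorem contDiff_jetPolynomial [CompleteSpace F] (d : ℕ) : ContDiff ℝ ∞ (fun a : ((k : Fin (d + 1)) →
    ContinuousMultilinearMap ℝ (fun _ : Fin (k : ℕ) => E) F) × E => jetPolynomial d a.1 a.2) := by
  unfold jetPolynomial
  refine ContDiff.sum fun k _ => contDiff_const.smul ?_
  have h : ContDiff ℝ ∞ (fun q : ContinuousMultilinearMap ℝ (fun _ : Fin (k : ℕ) => E) F ×
      (Fin (k : ℕ) → E) => q.1 q.2) := by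
    refine contDiff_iff_contDiffAt.2 fun q => ?_
    exact (ContinuousLinearMap.analyticAt_uncurry_of_multilinear
      (f := ContinuousLinearMap.id ℝ (ContinuousMultilinearMap ℝ (fun _ : Fin (k : ℕ) => E) F))
      (x := q)).contDiffAt
  refine h.comp (ContDiff.prodMk ?_ ?_)
  · exact contDiff_pi.1 contDiff_fst k
  · exact contDiff_pi.2 fun _ => contDiff_snd

/-- The `k`-th derivative at the centre of a power series is the sum of its `k`-th term over all
permutations of the arguments. By symmetry this is `k!` equal terms, which cancels the factor `1 /
k!`. -/
theorem iteratedFDeriv_jetPolynomial [CompleteSpace F] (d : ℕ) (p : (k : Fin (d + 1)) →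
    ContinuousMultilinearMap ℝ (fun _ : Fin (k : ℕ) => E) F)
    (hp : ∀ (k : Fin (d + 1)) v (σ : Equiv.Perm (Fin (k : ℕ))), p k (v ∘ σ) = p k v) (k : Fin (d + 1)) :
    iteratedFDeriv ℝ (k : ℕ) (jetPolynomial d p) 0 = p k := by
  let q : FormalMultilinearSeries ℝ E F := fun k =>
    if h : k < d + 1 then ((k.factorial : ℝ)⁻¹) • (p ⟨k, h⟩ : ContinuousMultilinearMap ℝ (fun _ : Fin k => E) F) else 0
  have hq : HasFiniteFPowerSeriesOnBall q.sum q 0 (d + 1) ⊤ :=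
    q.hasFiniteFPowerSeriesOnBall_of_finite fun m hm => by
      simp only [q]; rw [dif_neg (by omega)]
  have hsum : jetPolynomial d p = q.sum := by
    ext x
    have h1 := hq.eq_partialSum' x (by simp) (d + 1) le_rfl
    rw [h1, FormalMultilinearSeries.partialSum, Finset.sum_range]
    unfold jetPolynomial
    refine Finset.sum_congr rfl fun k _ => ?_
    simp only [q, sub_zero]
    rw [dif_pos k.2]
    rfl
  rw [hsum]
  ext v
  rw [hq.toHasFPowerSeriesOnBall.iteratedFDeriv_eq_sum_of_completeSpace]
  have : ∀ σ : Equiv.Perm (Fin (k : ℕ)), q k (fun i => v (σ i)) =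
      (((k : ℕ).factorial : ℝ)⁻¹) • p k v := by
    intro σ
    simp only [q]
    rw [dif_pos k.2]
    exact congrArg (fun a => (((k : ℕ).factorial : ℝ)⁻¹) • a) (hp k v σ)
  simp only [this]
  rw [Finset.sum_const, Finset.card_univ, Fintype.card_perm, Fintype.card_fin,
    ← Nat.cast_smul_eq_nsmul ℝ, smul_smul, mul_inv_cancel₀, one_smul]
  exact_mod_cast (Nat.factorial_pos _).ne'

/-- In the Leibniz formula the term with `f` undifferentiated keeps the full order of `f`, and the
term with `f'` keeps the zero of `g`, so induction applies. The extra order prevents a loss in the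
radial Poincaré argument. -/
theorem VanishesTo.bilin_succ (B : F →L[ℝ] G →L[ℝ] H) {m : ℕ} {f : E → F} {g : E → G} {y : E}
    (hf : VanishesTo m f y) (cf : ContDiffAt ℝ ∞ f y) (hg : g y = 0)
    (cg : ContDiffAt ℝ ∞ g y) : VanishesTo (m + 1) (fun x => B (f x) (g x)) y := by
  induction m generalizing F G H with
  | zero => exact VanishesTo.of_fderiv (vanishesTo_zero _ _) (by simp [hg])
  | succ m ih =>
    refine VanishesTo.of_fderiv ?_ (by simp [hg])
    have key : (fun x => (B.precompR E (f x) (_root_.fderiv ℝ g x) +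
        B.precompL E (_root_.fderiv ℝ f x) (g x))) =ᶠ[𝓝 y]
        _root_.fderiv ℝ (fun x => B (f x) (g x)) := by
      filter_upwards [cf.eventually_differentiableAt, cg.eventually_differentiableAt] with x h1 h2
      exact (B.hasFDerivAt_of_bilinear h1.hasFDerivAt h2.hasFDerivAt).fderiv.symm
    refine VanishesTo.congr (VanishesTo.add ?_ ?_ ?_ ?_) key
    · exact hf.bilin _ cf cg.fderiv_infty
    · exact ih (B.precompL E) hf.fderiv cf.fderiv_infty hg cg
    · exact ((B.precompR E).contDiff.contDiffAt.comp y cf).clm_apply cg.fderiv_infty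
    · exact ((B.precompL E).contDiff.contDiffAt.comp y cf.fderiv_infty).clm_apply cg

/-- The derivatives of the Euler field `f ↦ Df(x)(x - y)` applied to `f`, at the centre `y`. -/
theorem iteratedFDeriv_euler {f : E → F} {y : E} (cf : ContDiffAt ℝ ∞ f y) (k : ℕ) :
    iteratedFDeriv ℝ k (fun x => fderiv ℝ f x (x - y)) y = (k : ℝ) • iteratedFDeriv ℝ k f y := by
  induction k generalizing F with
  | zero =>
    ext v; simp
  | succ k ih =>
    have key : fderiv ℝ (fun x => fderiv ℝ f x (x - y)) =ᶠ[𝓝 y]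
        fun x => fderiv ℝ (fderiv ℝ f) x (x - y) + fderiv ℝ f x := by
      filter_upwards [cf.fderiv_infty.eventually_differentiableAt,
        (cf.nat_of_infty 2).eventually (by decide)] with x hx h2
      have hs : IsSymmSndFDerivAt ℝ f x := h2.isSymmSndFDerivAt (by simp)
      have hid : HasFDerivAt (fun x : E => x - y) (ContinuousLinearMap.id ℝ E) x :=
        (hasFDerivAt_id x).sub_const y
      rw [(hx.hasFDerivAt.clm_apply hid).fderiv]
      ext v
      have := hs v (x - y)
      simp only [add_apply, ContinuousLinearMap.comp_apply, ContinuousLinearMap.flip_apply,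
        ContinuousLinearMap.id_apply, this]
      rw [add_comm]
    ext v
    rw [iteratedFDeriv_succ_apply_right, (key.iteratedFDeriv ℝ k).eq_of_nhds]
    have h1 := iteratedFDeriv_add_apply (i := k) (x := y)
      (f := fun x => fderiv ℝ (fderiv ℝ f) x (x - y)) (g := fderiv ℝ f)
      ((cf.fderiv_infty.fderiv_infty.clm_apply (contDiffAt_id.sub contDiffAt_const)).nat_of_infty k)
      (cf.fderiv_infty.nat_of_infty k)
    have h2 : iteratedFDeriv ℝ k (fun x => fderiv ℝ (fderiv ℝ f) x (x - y) + fderiv ℝ f x) y =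
      iteratedFDeriv ℝ k (fun x => fderiv ℝ (fderiv ℝ f) x (x - y)) y +
        iteratedFDeriv ℝ k (fderiv ℝ f) y := h1
    rw [h2, ih cf.fderiv_infty]
    simp [iteratedFDeriv_succ_apply_right, add_smul]

/-- A `1`-form which is closed to order `l` at `y`: derivatives of its radial contraction. -/
theorem iteratedFDeriv_radial {α : E → E →L[ℝ] ℝ} {y : E} {l : ℕ} (cα : ContDiffAt ℝ ∞ α y)
    (hα : VanishesTo l (fun x => fderiv ℝ α x - (fderiv ℝ α x).flip) y) {k : ℕ} (hk : k ≤ l) :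
    iteratedFDeriv ℝ k (fderiv ℝ (fun x => α x (x - y))) y =
      ((k : ℝ) + 1) • iteratedFDeriv ℝ k α y := by
  set W : E → E →L[ℝ] E →L[ℝ] ℝ := fun x => fderiv ℝ α x - (fderiv ℝ α x).flip with hW
  have cid : ContDiffAt ℝ ∞ (fun x : E => x - y) y := contDiffAt_id.sub contDiffAt_const
  have hflip : ContDiff ℝ ∞ (fun T : E →L[ℝ] E →L[ℝ] ℝ => T.flip) :=
    IsBoundedLinearMap.contDiff
      { map_add := fun _ _ => rfl, map_smul := fun _ _ => rfl
        bound := ⟨1, one_pos, fun T => by rw [ContinuousLinearMap.opNorm_flip, one_mul]⟩ }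
  have cW : ContDiffAt ℝ ∞ W y := cα.fderiv_infty.sub
    (hflip.contDiffAt.comp y cα.fderiv_infty)
  -- Cartan's formula for the radial field `E = x - y`: `d(α(E)) = L_E α - dα(E, ·)`, where `W` is
  -- `dα` and `L_E α` is the sum of the first two terms.
  have key : fderiv ℝ (fun x => α x (x - y)) =ᶠ[𝓝 y]
      fun x => (fderiv ℝ α x (x - y) + α x) - W x (x - y) := by
    filter_upwards [cα.eventually_differentiableAt] with x hx
    have hid : HasFDerivAt (fun x : E => x - y) (ContinuousLinearMap.id ℝ E) x :=
      (hasFDerivAt_id x).sub_const y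
    rw [(hx.hasFDerivAt.clm_apply hid).fderiv]
    ext v
    simp [hW]
  have hV : VanishesTo (l + 1) (fun x => W x (x - y)) y :=
    hα.bilin_succ (ContinuousLinearMap.id ℝ (E →L[ℝ] E →L[ℝ] ℝ)) cW (by simp) cid
  have c1 : ContDiffAt ℝ ∞ (fun x => fderiv ℝ α x (x - y)) y := cα.fderiv_infty.clm_apply cid
  have h1 : iteratedFDeriv ℝ k (fun x => (fderiv ℝ α x (x - y) + α x) - W x (x - y)) y =
      iteratedFDeriv ℝ k (fun x => fderiv ℝ α x (x - y) + α x) y -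
        iteratedFDeriv ℝ k (fun x => W x (x - y)) y :=
    iteratedFDeriv_sub_apply ((c1.add cα).nat_of_infty k) ((cW.clm_apply cid).nat_of_infty k)
  have h2 : iteratedFDeriv ℝ k (fun x => fderiv ℝ α x (x - y) + α x) y =
      iteratedFDeriv ℝ k (fun x => fderiv ℝ α x (x - y)) y + iteratedFDeriv ℝ k α y :=
    iteratedFDeriv_add_apply (c1.nat_of_infty k) (cα.nat_of_infty k)
  rw [(key.iteratedFDeriv ℝ k).eq_of_nhds, h1, h2, hV k (by omega), iteratedFDeriv_euler cα,
    sub_zero, add_smul, one_smul]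

end Taylor

/-! ### Polynomials in `(t, q, p)` as sums of powers of affine functions -/

section Hamiltonians

open Filter

/-- Coefficients `(β, α, a, b)` of the affine function `β + α t + a · q + b · p`. -/
abbrev AffineCoeff (n : ℕ) : Type := ℝ × ℝ × (Fin n → ℝ) × (Fin n → ℝ)

/-- The affine function `β + α t + a · q + b · p`. -/
def affineFun {n : ℕ} (c : AffineCoeff n) (w : BigJet n) : ℝ :=
  c.1 + c.2.1 * w.t + ∑ i, c.2.2.1 i * w.q i + ∑ i, c.2.2.2 i * w.p i

/-- The polynomials of degree `≤ d` in `(t, q, p)`, as the span of the `d`-th powers of affine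
functions. -/
def hamiltonians (n d : ℕ) : Submodule ℝ (BigJet n → ℝ) :=
  Submodule.span ℝ (range fun c : AffineCoeff n => fun w => affineFun c w ^ d)

variable {n d : ℕ}

theorem affineFun_add_smul (c c' : AffineCoeff n) (ε : ℝ) (w : BigJet n) :
    affineFun (c + ε • c') w = affineFun c w + ε * affineFun c' w := by
  simp only [affineFun, Prod.fst_add, Prod.snd_add, Prod.smul_fst, Prod.smul_snd, Pi.add_apply,
    Pi.smul_apply, smul_eq_mul, add_mul, Finset.sum_add_distrib, mul_add, Finset.mul_sum]
  simp only [mul_assoc]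
  ring

/-- The linear part of an affine function. -/
noncomputable def affineLin (c : AffineCoeff n) : BigJet n →L[ℝ] ℝ :=
  LinearMap.toContinuousLinearMap
    { toFun := fun v => c.2.1 * v.t + ∑ i, c.2.2.1 i * v.q i + ∑ i, c.2.2.2 i * v.p i
      map_add' := fun v w => by
        simp only [BigJet.t, BigJet.q, BigJet.p, Prod.fst_add, Prod.snd_add, Pi.add_apply, mul_add,
          Finset.sum_add_distrib]
        ring
      map_smul' := fun r v => by
        simp only [BigJet.t, BigJet.q, BigJet.p, Prod.smul_fst, Prod.smul_snd, Pi.smul_apply,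
          smul_eq_mul, RingHom.id_apply, mul_add, Finset.mul_sum]
        simp only [mul_left_comm] }

theorem affineLin_apply (c : AffineCoeff n) (v : BigJet n) :
    affineLin c v = c.2.1 * v.t + ∑ i, c.2.2.1 i * v.q i + ∑ i, c.2.2.2 i * v.p i := rfl

theorem affineFun_eq (c : AffineCoeff n) (w : BigJet n) :
    affineFun c w = c.1 + affineLin c w := by
  rw [affineFun, affineLin_apply]; ring

theorem contDiff_affineFun (c : AffineCoeff n) : ContDiff ℝ ∞ (affineFun c) := by
  have : affineFun c = fun w => c.1 + affineLin c w := funext (affineFun_eq c)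
  rw [this]
  exact contDiff_const.add (affineLin c).contDiff

theorem hasFDerivAt_affineFun (c : AffineCoeff n) (w : BigJet n) :
    HasFDerivAt (affineFun c) (affineLin c) w := by
  have : affineFun c = fun w => c.1 + affineLin c w := funext (affineFun_eq c)
  rw [this]
  exact (affineLin c).hasFDerivAt.const_add _

theorem contDiff_of_mem_hamiltonians {h : BigJet n → ℝ} (hh : h ∈ hamiltonians n d) :
    ContDiff ℝ ∞ h := by
  induction hh using Submodule.span_induction with
  | mem x hx => obtain ⟨c, rfl⟩ := hx; exact (contDiff_affineFun c).pow d
  | zero => exact contDiff_const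
  | add x y _ _ hx hy => exact hx.add hy
  | smul a x _ hx => exact contDiff_const.smul hx

theorem iteratedFDeriv_affineFun_pow (c : AffineCoeff n) (d : ℕ) :
    ∀ k, d < k → iteratedFDeriv ℝ k (fun w => affineFun c w ^ d) = 0 := by
  induction d with
  | zero =>
    intro k hk
    simp only [pow_zero]
    exact iteratedFDeriv_const_of_ne (by omega) _
  | succ d ih =>
    intro k hk
    obtain ⟨k, rfl⟩ : ∃ j, k = j + 1 := ⟨k - 1, by omega⟩
    funext w
    have h1 : fderiv ℝ (fun w => affineFun c w ^ (d + 1)) =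
        fun w => affineFun c w ^ d • ((d + 1 : ℝ) • affineLin c) := by
      funext w
      rw [((hasFDerivAt_affineFun c w).pow (d + 1)).fderiv]
      refine ContinuousLinearMap.ext fun v => ?_
      simp; ring
    refine iteratedFDeriv_succ_eq_zero_iff.2 ?_
    rw [h1]
    have h2 := ((ContinuousLinearMap.id ℝ ℝ).smulRight
      ((d + 1 : ℝ) • affineLin c)).iteratedFDeriv_comp_left (x := w) (i := k)
      (((contDiff_affineFun c).pow d).contDiffAt.nat_of_infty k) le_rfl
    refine Eq.trans h2 ?_
    rw [ih k (by omega)]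
    refine ContinuousMultilinearMap.ext fun u => ContinuousLinearMap.ext fun v => ?_
    simp

theorem iteratedFDeriv_of_mem_hamiltonians {h : BigJet n → ℝ} (hh : h ∈ hamiltonians n d) :
    iteratedFDeriv ℝ (d + 1) h = 0 := by
  induction hh using Submodule.span_induction with
  | mem x hx =>
    obtain ⟨c, rfl⟩ := hx
    exact iteratedFDeriv_affineFun_pow c d _ (Nat.lt_succ_self d)
  | zero => funext w; exact congrFun (iteratedFDeriv_fun_zero (𝕜 := ℝ)) w
  | add x y hx' hy' hx hy =>
    funext w
    have := iteratedFDeriv_add_apply (x := w)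
      ((contDiff_of_mem_hamiltonians hx').contDiffAt.nat_of_infty (d + 1))
      ((contDiff_of_mem_hamiltonians hy').contDiffAt.nat_of_infty (d + 1))
    rw [this, hx, hy]; simp
  | smul a x hx' hx =>
    funext w
    have := iteratedFDeriv_const_smul_apply (x := w) (a := a)
      ((contDiff_of_mem_hamiltonians hx').contDiffAt.nat_of_infty (d + 1))
    rw [this, hx]; simp

theorem eq_zero_of_vanishesTo {E F : Type} [NormedAddCommGroup E] [NormedSpace ℝ E]
    [NormedAddCommGroup F] [NormedSpace ℝ F] {f : E → F} {y : E} {m : ℕ} (cf : ContDiff ℝ ∞ f)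
    (h : VanishesTo m f y) (h0 : iteratedFDeriv ℝ m f = 0) : f = 0 := by
  induction m generalizing F with
  | zero =>
    funext x
    exact iteratedFDeriv_zero_eq_zero_iff.1 (congrFun h0 x)
  | succ m ih =>
    have h1 : fderiv ℝ f = 0 := ih (cf.fderiv_right (m := ∞) (by norm_cast)) h.fderiv
      (funext fun x => iteratedFDeriv_succ_eq_zero_iff.1 (congrFun h0 x))
    funext x
    rw [is_const_of_fderiv_eq_zero (cf.differentiable (by simp)) (fun z => congrFun h1 z) x y,
      h.eq_zero]
    rfl

theorem eq_zero_of_mem_hamiltonians {h : BigJet n → ℝ} (hh : h ∈ hamiltonians n d) {y : BigJet n}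
    (hv : VanishesTo (d + 1) h y) : h = 0 :=
  eq_zero_of_vanishesTo (contDiff_of_mem_hamiltonians hh) hv (iteratedFDeriv_of_mem_hamiltonians hh)

instance ContinuousMultilinearMap.finiteDimensional {ι : Type} [Finite ι] {E F : Type}
    [NormedAddCommGroup E] [NormedSpace ℝ E] [NormedAddCommGroup F] [NormedSpace ℝ F]
    [FiniteDimensional ℝ E] [FiniteDimensional ℝ F] :
    FiniteDimensional ℝ (ContinuousMultilinearMap ℝ (fun _ : ι => E) F) :=
  FiniteDimensional.of_injective
    (ContinuousMultilinearMap.toMultilinearMapLinear (R' := ℝ) (A := ℝ)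
      (M₁ := fun _ : ι => E) (M₂ := F))
    ContinuousMultilinearMap.toMultilinearMap_injective

/-- A polynomial of degree `≤ d` is determined by its `d`-jet at the origin, which lives in a
finite-dimensional space. -/
instance hamiltonians.finiteDimensional : FiniteDimensional ℝ (hamiltonians n d) := by
  let f : hamiltonians n d →ₗ[ℝ] ((k : Fin (d + 1)) →
      ContinuousMultilinearMap ℝ (fun _ : Fin (k : ℕ) => BigJet n) ℝ) :=
    { toFun := fun h k => iteratedFDeriv ℝ (k : ℕ) h.1 0
      map_add' := fun a b => by
        funext k
        exact iteratedFDeriv_add_apply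
          ((contDiff_of_mem_hamiltonians a.2).contDiffAt.nat_of_infty k)
          ((contDiff_of_mem_hamiltonians b.2).contDiffAt.nat_of_infty k)
      map_smul' := fun r a => by
        funext k
        exact iteratedFDeriv_const_smul_apply
          ((contDiff_of_mem_hamiltonians a.2).contDiffAt.nat_of_infty k) }
  refine FiniteDimensional.of_injective f ?_
  rw [← LinearMap.ker_eq_bot, LinearMap.ker_eq_bot']
  intro h hh
  ext1
  exact eq_zero_of_mem_hamiltonians h.2 (y := 0) fun k hk => congrFun hh ⟨k, hk⟩

/-- Products of at most `d` affine functions lie in the span of `d`-th powers. -/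
theorem prod_affineFun_mem (L : List (AffineCoeff n)) (hL : L.length ≤ d) (c : AffineCoeff n) :
    (fun w => affineFun c w ^ (d - L.length) * (L.map fun c => affineFun c w).prod) ∈
      hamiltonians n d := by
  induction L generalizing c with
  | nil => 
    have : (fun w => affineFun c w ^ d) ∈ hamiltonians n d := Submodule.subset_span ⟨c, rfl⟩
    simpa using this
  | cons a L ih =>
    simp only [List.length_cons] at hL
    have hclosed : IsClosed (hamiltonians n d : Set (BigJet n → ℝ)) :=
      Submodule.closed_of_finiteDimensional _
    obtain ⟨j, hj⟩ : ∃ j, d - L.length = j + 1 := ⟨d - L.length - 1, by omega⟩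
    have hj' : d - (L.length + 1) = j := by omega
    have ih' := fun c => ih (by omega) c
    rw [hj] at ih'
    -- Polarisation by differentiation: the derivative at `ε = 0` of `(c + ε a) ^ (j + 1)` is `(j +
    -- 1) c ^ j a`. The difference quotients lie in the span, which is closed because it is
    -- finite-dimensional, so the limit does too.
    have key : Tendsto (fun ε : ℝ => (fun w => ε⁻¹ • (affineFun (c + ε • a) w ^ (j + 1) *
        (L.map fun c => affineFun c w).prod - affineFun c w ^ (j + 1) *
        (L.map fun c => affineFun c w).prod) : BigJet n → ℝ)) (𝓝[≠] 0)
        (𝓝 (fun w => ((j + 1 : ℕ) * affineFun c w ^ j * affineFun a w) *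
          (L.map fun c => affineFun c w).prod)) := by
      rw [tendsto_pi_nhds]
      intro w
      have h1 : HasDerivAt (fun ε : ℝ => affineFun (c + ε • a) w) (affineFun a w) 0 := by
        simp only [affineFun_add_smul]
        simpa using ((hasDerivAt_id (0 : ℝ)).mul_const (affineFun a w)).const_add (affineFun c w)
      have h2 := (h1.pow (j + 1)).mul_const (L.map fun c => affineFun c w).prod
      have h3 := h2.tendsto_slope_zero
      simpa using h3
    have hmem : (fun w => ((j + 1 : ℕ) * affineFun c w ^ j * affineFun a w) *
          (L.map fun c => affineFun c w).prod) ∈ hamiltonians n d := by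
      refine hclosed.mem_of_tendsto key (Eventually.of_forall fun ε => ?_)
      exact (hamiltonians n d).smul_mem ε⁻¹ ((hamiltonians n d).sub_mem (ih' _) (ih' c))
    have := (hamiltonians n d).smul_mem ((j + 1 : ℕ) : ℝ)⁻¹ hmem
    convert this using 1
    funext w
    have : ((j + 1 : ℕ) : ℝ) ≠ 0 := by exact_mod_cast Nat.succ_ne_zero j
    simp only [List.length_cons, hj', List.map_cons, List.prod_cons, Pi.smul_apply, smul_eq_mul]
    field_simp

/-- Indices of the coordinates of the jet bundle. -/
abbrev CoordIndex (n : ℕ) : Type := (Unit ⊕ (Fin n ⊕ Fin n)) ⊕ (Unit ⊕ Unit)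

/-- The coordinate basis. -/
def coordVec : CoordIndex n → BigJet n
  | .inl (.inl _) => (1, 0, 0, 0, 0)
  | .inl (.inr (.inl i)) => (0, Pi.single i 1, 0, 0, 0)
  | .inl (.inr (.inr i)) => (0, 0, 0, 0, Pi.single i 1)
  | .inr (.inl _) => (0, 0, 1, 0, 0)
  | .inr (.inr _) => (0, 0, 0, 1, 0)

/-- The coordinates. -/
def coordFun (v : BigJet n) : CoordIndex n → ℝ
  | .inl (.inl _) => v.t
  | .inl (.inr (.inl i)) => v.q i
  | .inl (.inr (.inr i)) => v.p i
  | .inr (.inl _) => v.z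
  | .inr (.inr _) => v.s

theorem sum_coord (v : BigJet n) : ∑ i, coordFun v i • coordVec i = v := by
  simp only [Fintype.sum_sum_type, Fintype.sum_unique, coordFun, coordVec]
  have h : ∀ u : Fin n → ℝ, ∑ i, u i • Pi.single (M := fun _ => ℝ) i (1 : ℝ) = u := by
    intro u
    conv_rhs => rw [← Finset.univ_sum_single u]
    refine Finset.sum_congr rfl fun i _ => ?_
    rw [← Pi.single_smul]; simp
  ext : 1
  · simp [Prod.fst_sum]
  · ext : 1
    · simp [Prod.fst_sum, Prod.snd_sum, h]
    · ext : 1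
      · simp [Prod.fst_sum, Prod.snd_sum]
      · ext : 1
        · simp [Prod.fst_sum, Prod.snd_sum]
        · simp [Prod.snd_sum, h]

theorem exists_affineFun_eq_coord (y : BigJet n) (i : Unit ⊕ (Fin n ⊕ Fin n)) :
    ∃ c : AffineCoeff n, ∀ w, affineFun c w = coordFun (w - y) (.inl i) := by
  rcases i with _ | i | i
  · exact ⟨(-y.t, 1, 0, 0), fun w => by simp [affineFun, coordFun]; ring⟩
  · exact ⟨(-y.q i, 0, Pi.single i 1, 0), fun w => by
      simp [affineFun, coordFun, Pi.single_apply, BigJet.q, BigJet.p]; ring⟩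
  · exact ⟨(-y.p i, 0, 0, Pi.single i 1), fun w => by
      simp [affineFun, coordFun, Pi.single_apply, BigJet.q, BigJet.p]; ring⟩

/-- Expand `M` in coordinates. The monomials with a factor in `z` or `s` have zero coefficient, and
the others are products of `k ≤ d` affine functions of `(t, q, p)`. -/
theorem multilinear_mem_hamiltonians {k : ℕ} (hk : k ≤ d) (y : BigJet n)
    (M : ContinuousMultilinearMap ℝ (fun _ : Fin k => BigJet n) ℝ)
    (hM : ∀ (u : Fin k → BigJet n) i j, u i = coordVec (.inr j) → M u = 0) :
    (fun w => M fun _ => w - y) ∈ hamiltonians n d := by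
  have h1 : (fun w => M fun _ => w - y) = ∑ r : Fin k → CoordIndex n,
      fun w => (∏ i, coordFun (w - y) (r i)) • M (fun i => coordVec (r i)) := by
    funext w
    rw [Finset.sum_apply]
    have := M.map_sum (fun (_ : Fin k) (j : CoordIndex n) => coordFun (w - y) j • coordVec j)
    simp only [sum_coord] at this
    rw [this]
    exact Finset.sum_congr rfl fun r _ => M.map_smul_univ _ _
  rw [h1]
  refine Submodule.sum_mem _ fun r _ => ?_
  by_cases hr : ∃ i j, r i = .inr j
  · obtain ⟨i, j, hij⟩ := hr
    rw [hM (fun i => coordVec (r i)) i j (by simp [hij])]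
    simp only [smul_zero]
    exact (hamiltonians n d).zero_mem
  · have h2 : ∀ i, ∃ c : AffineCoeff n, ∀ w, affineFun c w = coordFun (w - y) (r i) := by
      intro i
      rcases hri : r i with j | j
      · exact exists_affineFun_eq_coord y j
      · exact absurd ⟨i, j, hri⟩ hr
    choose c hc using h2
    -- The coefficient `(1, 0, 0, 0)` is the constant function `1`; its power pads the product up to
    -- degree `d`.
    have h3 := prod_affineFun_mem (d := d) (List.ofFn c) (by simpa using hk) (1, 0, 0, 0)
    have h4 := (hamiltonians n d).smul_mem (M fun i => coordVec (r i)) h3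
    convert h4 using 1
    funext w
    have h5 : affineFun ((1, 0, 0, 0) : AffineCoeff n) w = 1 := by simp [affineFun]
    simp only [Pi.smul_apply, h5, one_pow, one_mul, List.map_ofFn, List.prod_ofFn,
      Function.comp, hc, smul_eq_mul]
    ring

/-- A `1`-form in the variables `(t, q, p)` which is closed to order `l` is the differential of a
polynomial of degree `≤ l + 1`, to order `l + 1`. -/
theorem exists_hamiltonian {α : BigJet n → BigJet n →L[ℝ] ℝ} {y : BigJet n} {l : ℕ}
    (cα : ContDiffAt ℝ ∞ α y)
    (hα : VanishesTo l (fun x => fderiv ℝ α x - (fderiv ℝ α x).flip) y)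
    (hzs : ∀ j, VanishesTo (l + 1) (fun x => α x (coordVec (.inr j))) y) (h0 : ℝ) :
    ∃ h ∈ hamiltonians n (l + 1), h y = h0 ∧ VanishesTo (l + 1) (fun x => fderiv ℝ h x - α x) y := by
  set g : BigJet n → ℝ := fun x => α x (x - y) with hg
  have cg : ContDiffAt ℝ ∞ g y := cα.clm_apply (contDiffAt_id.sub contDiffAt_const)
  have hrad : ∀ k ≤ l, ∀ v : Fin (k + 1) → BigJet n, iteratedFDeriv ℝ (k + 1) g y v =
      (k + 1 : ℝ) • iteratedFDeriv ℝ k α y (Fin.init v) (v (Fin.last k)) := by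
    intro k hk v
    rw [iteratedFDeriv_succ_apply_right]
    have := iteratedFDeriv_radial cα hα hk
    exact DFunLike.congr_fun (DFunLike.congr_fun this (Fin.init v)) (v (Fin.last k))
  -- By symmetry of the derivatives of `g`, an argument `∂/∂z` or `∂/∂s` can be moved to the last
  -- slot, where it is fed to `α`, whose component in that direction vanishes to order `l + 1`.
  have hv : ∀ (k : ℕ) (u : Fin k → BigJet n) i j, k ≤ l + 1 → u i = coordVec (.inr j) →
      iteratedFDeriv ℝ k g y u = 0 := by
    intro k u i j hk hu
    obtain ⟨k, rfl⟩ : ∃ m, k = m + 1 := ⟨k - 1, by have := i.pos; omega⟩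
    rw [← cg.iteratedFDeriv_perm u (Equiv.swap i (Fin.last k)), hrad k (by omega)]
    simp only [Function.comp, Equiv.swap_apply_right, hu]
    rw [iteratedFDeriv_apply_clm cα, hzs j k (by omega)]
    simp
  -- The Poincaré primitive `∫₀¹ α(y + τ (x - y)) (x - y) dτ` divides the degree `k` part of `g` by
  -- `k`. For `k = 0` the convention `0⁻¹ = 0` kills the second term, and only the prescribed value
  -- `h0` remains.
  let p : (k : Fin (l + 1 + 1)) → ContinuousMultilinearMap ℝ (fun _ : Fin (k : ℕ) => BigJet n) ℝ :=
    fun k => iteratedFDeriv ℝ (k : ℕ) (fun _ => h0) y +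
      ((k : ℕ) : ℝ)⁻¹ • iteratedFDeriv ℝ (k : ℕ) g y
  have hp0 : ∀ u, p 0 u = h0 := fun u => by
    have e : p 0 u = h0 + ((0 : ℕ) : ℝ)⁻¹ * iteratedFDeriv ℝ 0 g y u :=
      congrArg (· + _) (iteratedFDeriv_zero_apply (𝕜 := ℝ) (f := fun _ : BigJet n => h0) u)
    rw [e]; simp
  have hps : ∀ k (hk : k ≤ l) u, p ⟨k + 1, by omega⟩ u =
      iteratedFDeriv ℝ k α y (Fin.init u) (u (Fin.last k)) := by
    intro k hk u
    have : (k + 1 : ℝ) ≠ 0 := by positivity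
    simp only [p]
    rw [iteratedFDeriv_const_of_ne (by omega)]
    simp [hrad k hk, this]
  have hsym : ∀ (k : Fin (l + 1 + 1)) v (σ : Equiv.Perm (Fin (k : ℕ))), p k (v ∘ σ) = p k v := by
    intro k v σ
    have h1 := cg.iteratedFDeriv_perm v σ
    have h2 := (contDiffAt_const (n := ∞) (c := h0) (x := y) (𝕜 := ℝ)).iteratedFDeriv_perm v σ
    simp only [p, add_apply, smul_apply, h1, h2]
  have hder := iteratedFDeriv_jetPolynomial (l + 1) p hsym
  have hmem : (fun w => jetPolynomial (l + 1) p (w - y)) ∈ hamiltonians n (l + 1) := by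
    have : (fun w => jetPolynomial (l + 1) p (w - y)) = ∑ k : Fin (l + 1 + 1),
        (((k : ℕ).factorial : ℝ)⁻¹) • fun w => p k (fun _ => w - y) := by
      funext w
      simp [jetPolynomial, Finset.sum_apply]
    rw [this]
    refine Submodule.sum_mem _ fun k _ => Submodule.smul_mem _ _ ?_
    refine multilinear_mem_hamiltonians (by omega) y (p k) fun u i j hu => ?_
    simp only [p]
    rw [iteratedFDeriv_const_of_ne (by have := i.pos; omega)]
    simp [hv k u i j (by omega) hu]
  refine ⟨_, hmem, ?_, fun k hk => ?_⟩
  · have h1 := DFunLike.congr_fun (hder 0) (fun _ => 0)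
    rw [hp0] at h1
    rw [sub_self, ← h1]
    exact (iteratedFDeriv_zero_apply _).symm
  · have cH := (contDiff_of_mem_hamiltonians hmem).contDiffAt (x := y)
    have h1 : iteratedFDeriv ℝ k (fun x => fderiv ℝ (fun w => jetPolynomial (l + 1) p (w - y)) x
        - α x) y = iteratedFDeriv ℝ k (fderiv ℝ fun w => jetPolynomial (l + 1) p (w - y)) y -
        iteratedFDeriv ℝ k α y :=
      iteratedFDeriv_sub_apply (cH.fderiv_infty.nat_of_infty k) (cα.nat_of_infty k)
    rw [h1, sub_eq_zero]
    refine ContinuousMultilinearMap.ext fun u => ContinuousLinearMap.ext fun v => ?_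
    have h2 := iteratedFDeriv_succ_apply_right (𝕜 := ℝ) (x := y)
      (f := fun w => jetPolynomial (l + 1) p (w - y)) (Fin.snoc (α := fun _ => BigJet n) u v)
    rw [Fin.init_snoc, Fin.snoc_last, iteratedFDeriv_comp_sub, sub_self,
      hder ⟨k + 1, by omega⟩, hps k (by omega), Fin.init_snoc, Fin.snoc_last] at h2
    exact h2.symm

end Hamiltonians

/-! ### Contact Hamiltonian fields and the linearised equations -/

section Contact

open Filter

variable {n l : ℕ}

/-- The bilinear form `∑ pᵢ(u) qᵢ(v) + s(u) t(v)`. -/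
noncomputable def liouvilleForm (n : ℕ) : BigJet n →L[ℝ] BigJet n →L[ℝ] ℝ :=
  LinearMap.toContinuousBilinearMap (LinearMap.mk₂ ℝ
    (fun u v : BigJet n => ∑ i, u.p i * v.q i + u.s * v.t)
    (fun a b c => by
      simp only [BigJet.t, BigJet.q, BigJet.p, BigJet.s, Prod.fst_add, Prod.snd_add,
        Pi.add_apply, add_mul, Finset.sum_add_distrib]; ring)
    (fun r a c => by
      simp only [BigJet.t, BigJet.q, BigJet.p, BigJet.s, Prod.smul_fst, Prod.smul_snd,
        Pi.smul_apply, smul_eq_mul, mul_add, Finset.mul_sum, mul_assoc])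
    (fun a b c => by
      simp only [BigJet.t, BigJet.q, BigJet.p, BigJet.s, Prod.fst_add, Prod.snd_add,
        Pi.add_apply, mul_add, Finset.sum_add_distrib]; ring)
    (fun r a c => by
      simp only [BigJet.t, BigJet.q, BigJet.p, BigJet.s, Prod.smul_fst, Prod.smul_snd,
        Pi.smul_apply, smul_eq_mul, mul_add, Finset.mul_sum, mul_left_comm]))

theorem liouvilleForm_apply (u v : BigJet n) :
    liouvilleForm n u v = ∑ i, u.2.2.2.2 i * v.2.1 i + u.2.2.2.1 * v.1 := rfl

/-- The coordinate `z` as a continuous linear form. -/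
noncomputable def zForm (n : ℕ) : BigJet n →L[ℝ] ℝ :=
  (ContinuousLinearMap.fst ℝ ℝ _).comp
    ((ContinuousLinearMap.snd ℝ (Fin n → ℝ) _).comp (ContinuousLinearMap.snd ℝ ℝ _))

theorem zForm_apply (v : BigJet n) : zForm n v = v.z := rfl

/-- The coordinate `t` as a continuous linear form. -/
noncomputable def tForm (n : ℕ) : BigJet n →L[ℝ] ℝ := ContinuousLinearMap.fst ℝ ℝ _

theorem tForm_apply (v : BigJet n) : tForm n v = v.t := rfl

theorem canonicalForm_eq (w v : BigJet n) :
    canonicalForm w v = zForm n v - liouvilleForm n w v := by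
  rw [canonicalForm, zForm_apply, liouvilleForm_apply]; simp only [BigJet.z, BigJet.p, BigJet.q,
    BigJet.s, BigJet.t]; ring

/-- The constant `2`-form `- dΘ`. -/
noncomputable def omegaForm (n : ℕ) : BigJet n →L[ℝ] BigJet n →L[ℝ] ℝ :=
  liouvilleForm n - (liouvilleForm n).flip

theorem omegaForm_apply (u v : BigJet n) :
    omegaForm n u v = liouvilleForm n u v - liouvilleForm n v u := rfl

/-- The linear map which recovers the components `q, s, p` of `u` from `ω(u, ·)`. -/
noncomputable def sharp (n : ℕ) : (BigJet n →L[ℝ] ℝ) →L[ℝ] BigJet n :=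
  LinearMap.toContinuousLinearMap
    { toFun := fun a => (0, fun i => - a (coordVec (.inl (.inr (.inr i)))), 0,
        a (coordVec (.inl (.inl ()))), fun i => a (coordVec (.inl (.inr (.inl i)))))
      map_add' := fun a b => by
        ext <;> simp [add_comm]
      map_smul' := fun r a => by ext <;> simp }

theorem sharp_apply (a : BigJet n →L[ℝ] ℝ) :
    sharp n a = (0, fun i => - a (coordVec (.inl (.inr (.inr i)))), 0,
        a (coordVec (.inl (.inl ()))), fun i => a (coordVec (.inl (.inr (.inl i))))) := rfl

/-- The unit vector `∂/∂z`. -/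
abbrev zVec (n : ℕ) : BigJet n := (0, 0, 1, 0, 0)

/-- The unit vector `∂/∂t`. -/
abbrev tVec (n : ℕ) : BigJet n := (1, 0, 0, 0, 0)

theorem sharp_omegaForm (u : BigJet n) :
    u = sharp n (omegaForm n u) + u.t • tVec n + u.z • zVec n := by
  rw [sharp_apply]
  ext <;> simp [omegaForm_apply, liouvilleForm_apply, coordVec, Pi.single_apply]

/-- `sharp n a` has no `t` or `z` component, so `ω` pairs it to zero with `∂/∂s` and `∂/∂z`. Forms
killing these two directions are therefore exactly those that can be recovered. -/
theorem omegaForm_sharp (a : BigJet n →L[ℝ] ℝ) (ha : ∀ j, a (coordVec (.inr j)) = 0)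
    (v : BigJet n) : omegaForm n (sharp n a) v = a v := by
  conv_rhs => rw [← sum_coord v, map_sum]
  simp only [map_smul, Fintype.sum_sum_type, Fintype.sum_unique, ha]
  simp only [sharp_apply, omegaForm_apply, liouvilleForm_apply, coordFun]
  simp [mul_comm, BigJet.q, BigJet.p, BigJet.t]
  ring

theorem liouvilleForm_zVec (u : BigJet n) : liouvilleForm n u (zVec n) = 0 := by
  simp [liouvilleForm_apply]

theorem omegaForm_zVec (v : BigJet n) : omegaForm n (zVec n) v = 0 := by
  simp [omegaForm_apply, liouvilleForm_apply]

/-- The contact Hamiltonian vector field of a function of `(t, q, p)`. -/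
noncomputable def hamField (h : BigJet n → ℝ) (y : BigJet n) : BigJet n :=
  sharp n (fderiv ℝ h y) + (h y + liouvilleForm n y (sharp n (fderiv ℝ h y))) • zVec n

theorem contDiffAt_hamField {h : BigJet n → ℝ} {y : BigJet n} (ch : ContDiffAt ℝ ∞ h y) :
    ContDiffAt ℝ ∞ (hamField h) y := by
  have h1 : ContDiffAt ℝ ∞ (fun y => sharp n (fderiv ℝ h y)) y :=
    (sharp n).contDiff.contDiffAt.comp y ch.fderiv_infty
  exact h1.add ((ch.add (((liouvilleForm n).contDiff.contDiffAt).clm_apply h1)).smul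
    contDiffAt_const)

/-- A germ at `w` of map which preserves `Θ` and `t`. -/
structure IsStrictGerm (C : BigJet n → BigJet n) (w : BigJet n) : Prop where
  contDiffAt : ContDiffAt ℝ ∞ C w
  t_eq : ∀ᶠ x in 𝓝 w, (C x).t = x.t
  preserves : ∀ᶠ x in 𝓝 w, ∀ v, canonicalForm (C x) (fderiv ℝ C x v) = canonicalForm x v

theorem IsStrictGerm.comp {C D : BigJet n → BigJet n} {w : BigJet n} (hC : IsStrictGerm C (D w))
    (hD : IsStrictGerm D w) : IsStrictGerm (fun x => C (D x)) w := by
  have hc := hD.contDiffAt.continuousAt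
  refine ⟨hC.contDiffAt.comp w hD.contDiffAt, ?_, ?_⟩
  · filter_upwards [hc.eventually hC.t_eq, hD.t_eq] with x h1 h2 using h1.trans h2
  · filter_upwards [hc.eventually hC.preserves, hD.preserves,
      hc.eventually hC.contDiffAt.eventually_differentiableAt,
      hD.contDiffAt.eventually_differentiableAt] with x h1 h2 h3 h4 v
    have h5 : fderiv ℝ (fun x => C (D x)) x = (fderiv ℝ C (D x)).comp (fderiv ℝ D x) :=
      fderiv_comp x h3 h4
    rw [h5, ContinuousLinearMap.comp_apply, h1, h2]

/-- Differentiate the invariance of `Θ` and antisymmetrise: the terms with second derivatives of `C`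
cancel by symmetry, which leaves the invariance of `dΘ`. -/
theorem IsStrictGerm.omegaForm_eq {C : BigJet n → BigJet n} {w : BigJet n}
    (hC : IsStrictGerm C w) :
    ∀ᶠ x in 𝓝 w, ∀ u v, omegaForm n (fderiv ℝ C x u) (fderiv ℝ C x v) = omegaForm n u v := by
  filter_upwards [hC.preserves.eventually_nhds, hC.contDiffAt.eventually_differentiableAt,
    hC.contDiffAt.fderiv_infty.eventually_differentiableAt,
    (hC.contDiffAt.nat_of_infty 2).eventually (by decide)] with x h1 h2 h3 h4 u v
  have hs : IsSymmSndFDerivAt ℝ C x := h4.isSymmSndFDerivAt (by simp)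
  have key : ∀ u v, zForm n (fderiv ℝ (fderiv ℝ C) x u v) -
      (liouvilleForm n (C x) (fderiv ℝ (fderiv ℝ C) x u v) +
        liouvilleForm n (fderiv ℝ C x u) (fderiv ℝ C x v)) = - liouvilleForm n u v := by
    intro u v
    have e1 : (fun x => zForm n (fderiv ℝ C x v) - liouvilleForm n (C x) (fderiv ℝ C x v)) =ᶠ[𝓝 x]
        fun x => zForm n v - liouvilleForm n x v := by
      filter_upwards [h1] with x hx
      rw [← canonicalForm_eq, ← canonicalForm_eq, hx]
    have d1 : HasFDerivAt (fun x => fderiv ℝ C x v)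
        ((ContinuousLinearMap.apply ℝ _ v).comp (fderiv ℝ (fderiv ℝ C) x)) x :=
      HasFDerivAt.comp x (g := ContinuousLinearMap.apply ℝ (BigJet n) v)
        (ContinuousLinearMap.hasFDerivAt _) h3.hasFDerivAt
    have d2 := ((zForm n).hasFDerivAt.comp x d1).sub
      ((liouvilleForm n).hasFDerivAt_of_bilinear h2.hasFDerivAt d1)
    have d3 : HasFDerivAt (fun x => zForm n v - liouvilleForm n x v)
        (-((liouvilleForm n).flip v)) x := by
      simpa using ((liouvilleForm n).flip v).hasFDerivAt.const_sub (zForm n v)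
    have := DFunLike.congr_fun ((d2.congr_of_eventuallyEq e1.symm).unique d3) u
    simpa using this
  have k1 := key u v
  have k2 := key v u
  rw [hs v u] at k2
  simp only [omegaForm_apply]
  linarith

theorem IsStrictGerm.symm {C G : BigJet n → BigJet n} {w : BigJet n} (hC : IsStrictGerm C w)
    (cG : ContDiffAt ℝ ∞ G (C w)) (hGw : G (C w) = w) (hCG : ∀ᶠ y in 𝓝 (C w), C (G y) = y) :
    IsStrictGerm G (C w) := by
  have hc : Tendsto G (𝓝 (C w)) (𝓝 w) := by
    have := cG.continuousAt.tendsto; rwa [hGw] at this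
  refine ⟨cG, ?_, ?_⟩
  · filter_upwards [hc.eventually hC.t_eq, hCG] with y h1 h2
    rw [← h1, h2]
  · filter_upwards [hc.eventually hC.preserves, hCG.eventually_nhds,
      hc.eventually hC.contDiffAt.eventually_differentiableAt,
      cG.eventually_differentiableAt] with y h1 h2 h3 h4 v
    have h5 : fderiv ℝ (fun y => C (G y)) y = (fderiv ℝ C (G y)).comp (fderiv ℝ G y) :=
      fderiv_comp y h3 h4
    have h6 : (fun y => C (G y)) =ᶠ[𝓝 y] id := h2
    rw [h6.fderiv_eq, fderiv_id] at h5
    rw [← h1, h2.self_of_nhds, ← ContinuousLinearMap.comp_apply, ← h5]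
    rfl

/-- Linearisation at the identity of the equations of `Θ`-preserving maps: a vector field which
is the velocity of a family of maps agreeing to order `l` with `Θ`-preserving germs is Hamiltonian
to order `l`. -/
theorem exists_hamField_of_linearized {X : BigJet n → BigJet n} {y : BigJet n}
    (cX : ContDiffAt ℝ ∞ X y)
    (h1 : ∀ v, VanishesTo l (fun x => zForm n (fderiv ℝ X x v) - liouvilleForm n (X x) v -
      liouvilleForm n x (fderiv ℝ X x v)) y)
    (h2 : ∀ u v, VanishesTo l (fun x => omegaForm n (fderiv ℝ X x u) v +
      omegaForm n u (fderiv ℝ X x v)) y)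
    (h3 : VanishesTo (l + 1) (fun x => (X x).t) y) :
    ∃ h ∈ hamiltonians n (l + 1), VanishesTo (l + 1) (fun x => X x - hamField h x) y := by
  set α : BigJet n → BigJet n →L[ℝ] ℝ := fun x => omegaForm n (X x) with hαdef
  have cα : ContDiffAt ℝ ∞ α y := (omegaForm n).contDiff.contDiffAt.comp y cX
  have cz : ContDiffAt ℝ ∞ (fun x => (X x).z) y := (zForm n).contDiff.contDiffAt.comp y cX
  have ct : ContDiffAt ℝ ∞ (fun x => (X x).t) y := (tForm n).contDiff.contDiffAt.comp y cX
  have cB : ContDiffAt ℝ ∞ (fun x => liouvilleForm n x) y := (liouvilleForm n).contDiff.contDiffAt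
  have hflip : ContDiff ℝ ∞ (fun T : BigJet n →L[ℝ] BigJet n →L[ℝ] ℝ => T.flip) :=
    IsBoundedLinearMap.contDiff
      { map_add := fun _ _ => rfl, map_smul := fun _ _ => rfl
        bound := ⟨1, one_pos, fun T => by rw [ContinuousLinearMap.opNorm_flip, one_mul]⟩ }
  have cW : ContDiffAt ℝ ∞ (fun x => fderiv ℝ α x - (fderiv ℝ α x).flip) y :=
    cα.fderiv_infty.sub (hflip.contDiffAt.comp y cα.fderiv_infty)
  have hdα : ∀ᶠ x in 𝓝 y, fderiv ℝ α x = (omegaForm n).comp (fderiv ℝ X x) := by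
    filter_upwards [cX.eventually_differentiableAt] with x hx
    exact ((omegaForm n).hasFDerivAt.comp x hx.hasFDerivAt).fderiv
  have hanti : ∀ u v, omegaForm n u v = - omegaForm n v u := fun u v => by
    simp only [omegaForm_apply]; ring
  -- The form `α = ω(X, ·)` is closed to order `l` by `h2`. Differentiating `h1` would only give
  -- order `l - 1`, which is why the linearised invariance of `ω` is assumed separately.
  have hclosed : VanishesTo l (fun x => fderiv ℝ α x - (fderiv ℝ α x).flip) y := by
    refine VanishesTo.of_forall_apply cW fun u => VanishesTo.of_forall_apply
      (cW.clm_apply contDiffAt_const) fun v => (h2 u v).congr ?_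
    filter_upwards [hdα] with x hx
    rw [hx]
    simp [hanti u]
    ring
  -- Indeed `ω(X, ∂/∂z) = 0` and `ω(X, ∂/∂s) = -dt(X)`, so this is where preservation of `t` enters.
  have hzs : ∀ j, VanishesTo (l + 1) (fun x => α x (coordVec (.inr j))) y := by
    rintro (_ | _)
    · exact VanishesTo.of_eventually_eq_zero (Eventually.of_forall fun x => by
        simp [hαdef, coordVec, omegaForm_apply, liouvilleForm_apply])
    · exact (h3.neg ct).congr (Eventually.of_forall fun x => by
        simp [hαdef, coordVec, omegaForm_apply, liouvilleForm_apply])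
  -- The constant of integration is chosen so that `h` agrees with `Θ(X)` at `y`.
  obtain ⟨h, hh, hy, hv⟩ := exists_hamiltonian cα hclosed hzs
    ((X y).z - liouvilleForm n y (X y))
  have ch : ContDiffAt ℝ ∞ h y := (contDiff_of_mem_hamiltonians hh).contDiffAt
  refine ⟨h, hh, ?_⟩
  have cD : ContDiffAt ℝ ∞ (fun x => fderiv ℝ h x - α x) y := ch.fderiv_infty.sub cα
  -- the Hamiltonian function of `X`
  set g : BigJet n → ℝ := fun x => (X x).z - liouvilleForm n x (X x) - h x with hg
  have cg : ContDiffAt ℝ ∞ g y := (cz.sub (cB.clm_apply cX)).sub ch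
  have hgv : VanishesTo (l + 1) g y := by
    -- Here `g = Θ(X) - h`. By `h1`, `d(Θ(X)) = ω(X, ·) = α` to order `l`, while `dh = α` to order
    -- `l + 1`; hence `dg` vanishes to order `l`, and `g y = 0` gains one order.
    refine VanishesTo.of_fderiv ?_ (by simp [hg, hy])
    refine VanishesTo.of_forall_apply cg.fderiv_infty fun v => ?_
    have hc1 : ContDiffAt ℝ ∞ (fun x => fderiv ℝ X x v) y :=
      cX.fderiv_infty.clm_apply contDiffAt_const
    refine VanishesTo.congr (((h1 v)).sub ((hv.mono (Nat.le_succ l)).clm_apply_const cD v) ?_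
      (cD.clm_apply contDiffAt_const)) ?_
    · exact (((zForm n).contDiff.contDiffAt.comp y hc1).sub
        (((liouvilleForm n).contDiff.contDiffAt.comp y cX).clm_apply contDiffAt_const)).sub
        (cB.clm_apply hc1)
    · filter_upwards [cX.eventually_differentiableAt, ch.eventually_differentiableAt] with x hx hhx
      have e : HasFDerivAt g (((zForm n).comp (fderiv ℝ X x) -
          ((liouvilleForm n).precompR (BigJet n) x (fderiv ℝ X x) +
          (liouvilleForm n).precompL (BigJet n) (ContinuousLinearMap.id ℝ _) (X x))) -
          fderiv ℝ h x) x :=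
        (((zForm n).hasFDerivAt.comp x hx.hasFDerivAt).sub
          ((liouvilleForm n).hasFDerivAt_of_bilinear (hasFDerivAt_id x) hx.hasFDerivAt)).sub
          hhx.hasFDerivAt
      rw [e.fderiv]
      simp [hαdef, omegaForm_apply]
      ring
  have cs : ContDiffAt ℝ ∞ (fun x => sharp n (fderiv ℝ h x - α x)) y :=
    (sharp n).contDiff.contDiffAt.comp y cD
  have hs : VanishesTo (l + 1) (fun x => sharp n (fderiv ℝ h x - α x)) y :=
    hv.clm_comp (sharp n) cD
  -- This is the `∂/∂z` component of `X - hamField h`, rewritten by splitting `X` as `sharp n (α x)`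
  -- plus its `t` and `z` components.
  have hc : VanishesTo (l + 1) (fun x => g x - liouvilleForm n x (sharp n (fderiv ℝ h x - α x)) +
      (X x).t * liouvilleForm n x (tVec n)) y :=
    (hgv.sub (hs.clm_apply_right cB cs) cg (cB.clm_apply cs)).add
      (h3.mul ct (cB.clm_apply contDiffAt_const)) (cg.sub (cB.clm_apply cs))
      (ct.mul (cB.clm_apply contDiffAt_const))
  have cc : ContDiffAt ℝ ∞ (fun x => g x - liouvilleForm n x (sharp n (fderiv ℝ h x - α x)) +
      (X x).t * liouvilleForm n x (tVec n)) y :=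
    (cg.sub (cB.clm_apply cs)).add (ct.mul (cB.clm_apply contDiffAt_const))
  have hsmul : ∀ (a : BigJet n → ℝ) (e : BigJet n), VanishesTo (l + 1) a y → ContDiffAt ℝ ∞ a y →
      VanishesTo (l + 1) (fun x => a x • e) y := fun a e ha ca =>
    ha.clm_comp ((ContinuousLinearMap.id ℝ ℝ).smulRight e) ca
  refine VanishesTo.congr (((hsmul _ (tVec n) h3 ct).add (hsmul _ (zVec n) hc cc)
    (ct.smul contDiffAt_const) (cc.smul contDiffAt_const)).sub hs
    ((ct.smul contDiffAt_const).add (cc.smul contDiffAt_const)) cs)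
    (Eventually.of_forall fun x => ?_)
  have e1 := sharp_omegaForm (X x)
  have e2 : liouvilleForm n x (X x) = liouvilleForm n x (sharp n (α x)) +
      (X x).t * liouvilleForm n x (tVec n) := by
    conv_lhs => rw [e1]
    simp only [map_add, map_smul, smul_eq_mul, liouvilleForm_zVec, mul_zero, add_zero, hαdef]
  have e3 : X x - hamField h x = sharp n (α x) + (X x).t • tVec n + (X x).z • zVec n -
      hamField h x := by
    rw [← e1]
  refine Eq.trans ?_ e3.symm
  simp only [hamField, hg, e2, map_sub]
  module

end Contact

/-! ### Velocity of a family that agrees to order `l` with `Θ`-preserving germs -/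

section Linearisation

open Filter

variable {n l : ℕ}

set_option maxHeartbeats 1000000 in
-- The germs may depend on `τ` in any way; only the family `R` is smooth in `τ`. Each equation
-- satisfied by the germs (for `Θ`, `ω` and `t`) holds for `R (τ, ·)` to finite order at `c τ` and
-- exactly at `τ = 0`, so `VanishesTo.family_deriv` yields the linearised equations for the
-- velocity.
theorem IsStrictGerm.family_hamField {R : ℝ × BigJet n → BigJet n} {c : ℝ → BigJet n}
    (cR : ∀ᶠ p in 𝓝 ((0 : ℝ), c 0), ContDiffAt ℝ ∞ R p) (hc : DifferentiableAt ℝ c 0)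
    (h0 : ∀ᶠ y in 𝓝 (c 0), R (0, y) = y)
    (h : ∀ᶠ τ in 𝓝 (0 : ℝ), ∃ φ, IsStrictGerm φ (c τ) ∧
      VanishesTo (l + 1) (fun y => R (τ, y) - φ y) (c τ)) :
    ∃ h ∈ hamiltonians n (l + 1),
      VanishesTo (l + 1) (fun y => fderiv ℝ R ((0 : ℝ), y) (1, 0) - hamField h y) (c 0) := by
  set A : ℝ × BigJet n → BigJet n →L[ℝ] BigJet n :=
    fun p => (fderiv ℝ R p).comp (ContinuousLinearMap.inr ℝ ℝ (BigJet n)) with hA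
  have cR0 : ContDiffAt ℝ ∞ R (0, c 0) := cR.self_of_nhds
  have cA0 : ContDiffAt ℝ ∞ A (0, c 0) := cR0.fderiv_infty.clm_comp contDiffAt_const
  have hslice := eventuallyEq_fderiv_slice cR0
  have hcomm := cR0.fderiv_slice_comm
  have hcc : Tendsto (fun τ => (τ, c τ)) (𝓝 0) (𝓝 ((0 : ℝ), c 0)) :=
    continuousAt_id.prodMk hc.continuousAt
  have hx0 : ∀ x, Tendsto (fun x : BigJet n => ((0 : ℝ), x)) (𝓝 x) (𝓝 ((0 : ℝ), x)) := by
    intro x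
    have : ContinuousAt (fun x : BigJet n => ((0 : ℝ), x)) x := by fun_prop
    exact this
  have hx : ∀ (τ : ℝ) (x : BigJet n), Tendsto (fun x : BigJet n => (τ, x)) (𝓝 x) (𝓝 (τ, x)) := by
    intro τ x
    have : ContinuousAt (fun x : BigJet n => (τ, x)) x := by fun_prop
    exact this
  have hA0 : ∀ᶠ y in 𝓝 (c 0), A (0, y) = ContinuousLinearMap.id ℝ _ := by
    filter_upwards [(hx0 _).eventually hslice, h0.eventually_nhds] with y hy h0y
    have : (fun y => R (0, y)) =ᶠ[𝓝 y] id := h0y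
    have e : A (0, y) = fderiv ℝ (fun y => R (0, y)) y := hy.symm
    rw [e, this.fderiv_eq, fderiv_id]
  have hAd : ∀ᶠ y in 𝓝 (c 0), DifferentiableAt ℝ A (0, y) :=
    (hx0 _).eventually cA0.eventually_differentiableAt
  have hRd : ∀ᶠ y in 𝓝 (c 0), DifferentiableAt ℝ R (0, y) :=
    (hx0 _).eventually cR0.eventually_differentiableAt
  have hAv : ∀ (v : BigJet n) (p : ℝ × BigJet n), DifferentiableAt ℝ A p →
      HasFDerivAt (fun p => A p v) ((ContinuousLinearMap.apply ℝ (BigJet n) v).comp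
        (fderiv ℝ A p)) p := fun v p hp =>
    HasFDerivAt.comp p (g := ContinuousLinearMap.apply ℝ (BigJet n) v)
      (ContinuousLinearMap.hasFDerivAt _) hp.hasFDerivAt
  have cAv : ∀ v : BigJet n, ContDiffAt ℝ ∞ (fun p => A p v) (0, c 0) := fun v =>
    cA0.clm_apply contDiffAt_const
  have cX : ContDiffAt ℝ ∞ (fun y => fderiv ℝ R ((0 : ℝ), y) (1, 0)) (c 0) := by
    have h1 : ContDiffAt ℝ ∞ (fun y : BigJet n => ((0 : ℝ), y)) (c 0) :=
      contDiffAt_const.prodMk contDiffAt_id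
    exact (cR0.fderiv_infty.comp (c 0) h1).clm_apply contDiffAt_const
  -- comparison of the family with the germs
  have hcmp : ∀ᶠ τ in 𝓝 (0 : ℝ), ∃ φ, IsStrictGerm φ (c τ) ∧
      VanishesTo (l + 1) (fun y => R (τ, y) - φ y) (c τ) ∧
      ContDiffAt ℝ ∞ (fun y => R (τ, y)) (c τ) ∧
      ∀ᶠ y in 𝓝 (c τ), A (τ, y) = fderiv ℝ φ y + fderiv ℝ (fun y => R (τ, y) - φ y) y := by
    filter_upwards [h, hcc.eventually hslice.eventually_nhds, hcc.eventually cR]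
      with τ ⟨φ, hφ, hv⟩ hs cτ
    have cτ' : ContDiffAt ℝ ∞ (fun y => R (τ, y)) (c τ) :=
      ContDiffAt.comp (c τ) cτ (contDiffAt_const.prodMk contDiffAt_id)
    refine ⟨φ, hφ, hv, cτ', ?_⟩
    filter_upwards [(hx τ (c τ)).eventually hs, cτ'.eventually_differentiableAt,
      hφ.contDiffAt.eventually_differentiableAt] with y h1 h2 h3
    have h4 : fderiv ℝ (fun y => R (τ, y) - φ y) y = fderiv ℝ (fun y => R (τ, y)) y -
      fderiv ℝ φ y := fderiv_fun_sub h2 h3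
    rw [h4, h1]
    simp [hA]
  have hcontB : ∀ {f : BigJet n → BigJet n} {g : BigJet n → BigJet n} {x},
      ContDiffAt ℝ ∞ f x → ContDiffAt ℝ ∞ g x →
      ContDiffAt ℝ ∞ (fun y => liouvilleForm n (f y) (g y)) x := fun hf hg =>
    ((liouvilleForm n).contDiff.contDiffAt.comp _ hf).clm_apply hg
  refine exists_hamField_of_linearized cX (fun v => ?_) (fun u v => ?_) ?_
  · have key := VanishesTo.family_deriv (m := l) (c := c)
      (f := fun p => zForm n (A p v) - liouvilleForm n (R p) (A p v) -
        (zForm n v - liouvilleForm n p.2 v)) ?_ hc ?_ ?_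
    · refine key.congr ?_
      filter_upwards [hA0, hAd, hRd, h0, hcomm] with y hy1 hy2 hy3 hy4 hy5
      have e1 := (((zForm n).hasFDerivAt.comp ((0 : ℝ), y) (hAv v _ hy2)).sub
        ((liouvilleForm n).hasFDerivAt_of_bilinear hy3.hasFDerivAt (hAv v _ hy2))).sub
        ((((liouvilleForm n).flip v).hasFDerivAt.comp ((0 : ℝ), y)
          (hasFDerivAt_snd (𝕜 := ℝ) (p := ((0 : ℝ), y)))).const_sub (zForm n v))
      have e2 : fderiv ℝ (fun p : ℝ × BigJet n => zForm n (A p v) - liouvilleForm n (R p) (A p v) -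
        (zForm n v - liouvilleForm n p.2 v)) ((0 : ℝ), y) = _ := e1.fderiv
      rw [e2]
      rw [← hy5]
      simp [hy1, hy4]
      ring
    · refine ContDiffAt.sub (ContDiffAt.sub ((zForm n).contDiff.contDiffAt.comp _ (cAv v)) ?_) ?_
      · exact ((liouvilleForm n).contDiff.contDiffAt.comp _ cR0).clm_apply (cAv v)
      · exact contDiffAt_const.sub (((liouvilleForm n).contDiff.contDiffAt.comp _
          contDiffAt_snd).clm_apply contDiffAt_const)
    · filter_upwards [hA0, h0] with y h1 h2
      simp [h1, h2]
    -- With `r = R (τ, ·) - φ`, the defect of `R` in the equation for `Θ` consists of terms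
    -- containing `r` or `Dr`, because `φ` has no defect; `Dr` vanishes to order `l`, one less than
    -- `r`.
    · filter_upwards [hcmp] with τ ⟨φ, hφ, hv, cτ, hτ⟩
      set r : BigJet n → BigJet n := fun y => R (τ, y) - φ y with hr
      have cr : ContDiffAt ℝ ∞ r (c τ) := cτ.sub hφ.contDiffAt
      have v1 : VanishesTo l (fun y => fderiv ℝ r y v) (c τ) :=
        hv.fderiv.clm_apply_const cr.fderiv_infty v
      have c1 : ContDiffAt ℝ ∞ (fun y => fderiv ℝ r y v) (c τ) :=
        cr.fderiv_infty.clm_apply contDiffAt_const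
      have c2 : ContDiffAt ℝ ∞ (fun y => fderiv ℝ φ y v) (c τ) :=
        hφ.contDiffAt.fderiv_infty.clm_apply contDiffAt_const
      have vz := v1.clm_comp (zForm n) c1
      have vb := v1.bilin (liouvilleForm n).flip c1 cτ
      have vb' := (hv.mono (Nat.le_succ l)).bilin (liouvilleForm n) cr c2
      refine ((vz.sub vb ((zForm n).contDiff.contDiffAt.comp _ c1) (hcontB cτ c1)).sub vb'
        (((zForm n).contDiff.contDiffAt.comp _ c1).sub (hcontB cτ c1)) (hcontB cr c2)).congr ?_
      filter_upwards [hτ, hφ.preserves] with y hy hp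
      have := hp v
      rw [canonicalForm_eq, canonicalForm_eq] at this
      rw [← this, hy]
      simp [hr]
      ring
  · have key := VanishesTo.family_deriv (m := l) (c := c)
      (f := fun p => omegaForm n (A p u) (A p v) - omegaForm n u v) ?_ hc ?_ ?_
    · refine key.congr ?_
      filter_upwards [hA0, hAd, hcomm] with y hy1 hy2 hy5
      have e1 := ((omegaForm n).hasFDerivAt_of_bilinear (hAv u _ hy2) (hAv v _ hy2)).sub_const
        (omegaForm n u v)
      have e2 : fderiv ℝ (fun p => omegaForm n (A p u) (A p v) - omegaForm n u v) ((0 : ℝ), y)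
        = _ := e1.fderiv
      rw [e2, ← hy5]
      simp [hy1, add_comm]
      rfl
    · exact (((omegaForm n).contDiff.contDiffAt.comp _ (cAv u)).clm_apply (cAv v)).sub
        contDiffAt_const
    · filter_upwards [hA0] with y h1
      simp [h1]
    · filter_upwards [hcmp] with τ ⟨φ, hφ, hv, cτ, hτ⟩
      set r : BigJet n → BigJet n := fun y => R (τ, y) - φ y with hr
      have cr : ContDiffAt ℝ ∞ r (c τ) := cτ.sub hφ.contDiffAt
      have v1 : ∀ v, VanishesTo l (fun y => fderiv ℝ r y v) (c τ) := fun v =>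
        hv.fderiv.clm_apply_const cr.fderiv_infty v
      have c1 : ∀ v, ContDiffAt ℝ ∞ (fun y => fderiv ℝ r y v) (c τ) := fun v =>
        cr.fderiv_infty.clm_apply contDiffAt_const
      have c2 : ∀ v, ContDiffAt ℝ ∞ (fun y => fderiv ℝ φ y v) (c τ) := fun v =>
        hφ.contDiffAt.fderiv_infty.clm_apply contDiffAt_const
      have va := (v1 u).bilin (omegaForm n) (c1 u) ((c1 v).add (c2 v))
      have vb := (v1 v).bilin (omegaForm n).flip (c1 v) (c2 u)
      have ca := ((omegaForm n).contDiff.contDiffAt.comp _ (c1 u)).clm_apply ((c1 v).add (c2 v))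
      have cb := ((omegaForm n).flip.contDiff.contDiffAt.comp _ (c1 v)).clm_apply (c2 u)
      refine (va.add vb ca cb).congr ?_
      filter_upwards [hτ, hφ.omegaForm_eq] with y hy hp
      rw [← hp u v, hy]
      simp
      ring
  · have key := VanishesTo.family_deriv (m := l + 1) (c := c)
      (f := fun p => tForm n (R p) - tForm n p.2) ?_ hc ?_ ?_
    · refine key.congr ?_
      filter_upwards [hRd] with y hy
      have e0 : HasFDerivAt (fun p : ℝ × BigJet n => tForm n p.2)
          ((tForm n).comp (ContinuousLinearMap.snd ℝ ℝ (BigJet n))) ((0 : ℝ), y) :=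
        ((tForm n).comp (ContinuousLinearMap.snd ℝ ℝ (BigJet n))).hasFDerivAt
      have e1 := (HasFDerivAt.comp ((0 : ℝ), y) (g := tForm n)
        (ContinuousLinearMap.hasFDerivAt _) hy.hasFDerivAt).sub e0
      have e2 : fderiv ℝ (fun p => tForm n (R p) - tForm n p.2) ((0 : ℝ), y) = _ := e1.fderiv
      rw [e2]
      simp [tForm]
    · exact ((tForm n).contDiff.contDiffAt.comp _ cR0).sub
        ((tForm n).contDiff.contDiffAt.comp _ contDiffAt_snd)
    · filter_upwards [h0] with y h1
      simp [h1]
    · filter_upwards [hcmp] with τ ⟨φ, hφ, hv, cτ, hτ⟩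
      refine (hv.clm_comp (tForm n) (cτ.sub hφ.contDiffAt)).congr ?_
      filter_upwards [hφ.t_eq] with y hy
      rw [map_sub, tForm_apply (φ y), hy, tForm_apply y]

/-- The local inverse of a smooth map with invertible differentials. -/
theorem exists_local_inverse {E : Type} [NormedAddCommGroup E] [NormedSpace ℝ E]
    [FiniteDimensional ℝ E] {C : E → E} {w : E} (cC : ∀ᶠ x in 𝓝 w, ContDiffAt ℝ ∞ C x)
    (hinj : ∀ᶠ x in 𝓝 w, Function.Injective (fderiv ℝ C x)) :
    ∃ G : E → E, (∀ᶠ y in 𝓝 (C w), ContDiffAt ℝ ∞ G y) ∧ (∀ᶠ x in 𝓝 w, G (C x) = x) ∧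
      ∀ᶠ y in 𝓝 (C w), C (G y) = y := by
  have : CompleteSpace E := FiniteDimensional.complete ℝ E
  have key : ∀ x, ContDiffAt ℝ ∞ C x → Function.Injective (fderiv ℝ C x) →
      ∃ e : E ≃L[ℝ] E, HasFDerivAt C (e : E →L[ℝ] E) x := by
    intro x hx hix
    refine ⟨(LinearEquiv.ofInjectiveEndo (fderiv ℝ C x : E →ₗ[ℝ] E) hix).toContinuousLinearEquiv,
      ?_⟩
    convert! (hx.differentiableAt (by simp)).hasFDerivAt
  obtain ⟨e, he⟩ := key w cC.self_of_nhds hinj.self_of_nhds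
  have hs := cC.self_of_nhds.mem_toOpenPartialHomeomorph_source he (by simp)
  have ht := cC.self_of_nhds.image_mem_toOpenPartialHomeomorph_target he (by simp)
  set φ := cC.self_of_nhds.toOpenPartialHomeomorph C he (by simp) with hφ
  refine ⟨φ.symm, ?_, ?_, ?_⟩
  · have hc : Tendsto φ.symm (𝓝 (C w)) (𝓝 w) := by
      have := (φ.continuousAt_symm ht).tendsto
      rwa [show φ.symm (C w) = w from φ.left_inv hs] at this
    filter_upwards [φ.open_target.mem_nhds ht, hc.eventually cC, hc.eventually hinj]
      with y hy h1 h2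
    obtain ⟨e', he'⟩ := key _ h1 h2
    exact φ.contDiffAt_symm hy he' h1
  · filter_upwards [φ.open_source.mem_nhds hs] with x hx
    exact φ.left_inv hx
  · filter_upwards [φ.open_target.mem_nhds ht] with y hy
    exact φ.right_inv hy

end Linearisation

/-! ### Tangent vectors of the space of jets -/

section TangentJets

open Filter

variable {n l : ℕ} {U : Set (BigJet n)} {C : BigJet n → BigJet n}

theorem IsThetaPContactEmbeddingOn.contDiffAt (hC : IsThetaPContactEmbeddingOn U C)
    (hU : IsOpen U) {w : BigJet n} (hw : w ∈ U) : ContDiffAt ℝ ∞ C w :=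
  hC.contDiffOn.contDiffAt (hU.mem_nhds hw)

theorem IsThetaPContactEmbeddingOn.isStrictGerm (hC : IsThetaPContactEmbeddingOn U C)
    (hU : IsOpen U) {w : BigJet n} (hw : w ∈ U) : IsStrictGerm C w := by
  refine ⟨hC.contDiffAt hU hw, ?_, ?_⟩
  · obtain ⟨qC, zC, hC', pC, h⟩ := hC.hasPForm
    filter_upwards [hU.mem_nhds hw] with x hx
    have := congrArg Prod.fst (h x.1 x.2.1 x.2.2.1 x.2.2.2.1 x.2.2.2.2 hx)
    exact this
  · filter_upwards [hU.mem_nhds hw] with x hx using hC.preserves x hx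

theorem hasFDerivAt_jet {w : BigJet n} (cC : ContDiffAt ℝ ∞ C w) :
    HasFDerivAt (jet l C) ((ContinuousLinearMap.id ℝ (BigJet n)).prod
      (ContinuousLinearMap.pi fun k : Fin (l + 1) => fderiv ℝ (iteratedFDeriv ℝ (k : ℕ) C) w)) w :=
  (hasFDerivAt_id w).prodMk (hasFDerivAt_pi.2 fun k =>
    ((cC.iteratedFDeriv_infty (k : ℕ)).differentiableAt (by simp)).hasFDerivAt)

theorem contDiffAt_jet {w : BigJet n} (cC : ContDiffAt ℝ ∞ C w) : ContDiffAt ℝ ∞ (jet l C) w :=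
  contDiffAt_id.prodMk (contDiffAt_pi.2 fun k => cC.iteratedFDeriv_infty (k : ℕ))

theorem ContDiffAt.jetPolynomial {E F G : Type} [NormedAddCommGroup E] [NormedSpace ℝ E]
    [NormedAddCommGroup F] [NormedSpace ℝ F] [NormedAddCommGroup G] [NormedSpace ℝ G]
    [CompleteSpace F] {d : ℕ} {f : G → (k : Fin (d + 1)) →
      ContinuousMultilinearMap ℝ (fun _ : Fin (k : ℕ) => E) F} {g : G → E} {x : G}
    (hf : ContDiffAt ℝ ∞ f x) (hg : ContDiffAt ℝ ∞ g x) :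
    ContDiffAt ℝ ∞ (fun x => jetPolynomial d (f x) (g x)) x := by
  have h := (contDiff_jetPolynomial (E := E) (F := F) d).contDiffAt (x := (f x, g x))
  have h2 := hf.prodMk hg
  exact ContDiffAt.comp (g := fun a : ((k : Fin (d + 1)) →
    ContinuousMultilinearMap ℝ (fun _ : Fin (k : ℕ) => E) F) × E => _root_.jetPolynomial d a.1 a.2)
    (f := fun x => (f x, g x)) x h h2

theorem jetPolynomial_zero {E F : Type} [NormedAddCommGroup E] [NormedSpace ℝ E]
    [NormedAddCommGroup F] [NormedSpace ℝ F] (d : ℕ) (x : E) :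
    jetPolynomial (F := F) d 0 x = 0 := by
  simp [jetPolynomial]

theorem jetPolynomial_smul {E F : Type} [NormedAddCommGroup E] [NormedSpace ℝ E]
    [NormedAddCommGroup F] [NormedSpace ℝ F] (d : ℕ) (r : ℝ) (p : (k : Fin (d + 1)) →
    ContinuousMultilinearMap ℝ (fun _ : Fin (k : ℕ) => E) F) (x : E) :
    jetPolynomial d (r • p) x = r • jetPolynomial d p x := by
  simp only [jetPolynomial, Finset.smul_sum]
  refine Finset.sum_congr rfl fun k _ => ?_
  simp [smul_comm r]

/-- The polynomial is linear in its coefficients. Since these vanish at `τ = 0`, the motion of the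
point contributes nothing to the derivative. -/
theorem hasDerivAt_jetPolynomial {E F : Type} [NormedAddCommGroup E] [NormedSpace ℝ E]
    [NormedAddCommGroup F] [NormedSpace ℝ F] [CompleteSpace F] {d : ℕ} {b : ℝ → (k : Fin (d + 1)) →
    ContinuousMultilinearMap ℝ (fun _ : Fin (k : ℕ) => E) F} {b' : (k : Fin (d + 1)) →
    ContinuousMultilinearMap ℝ (fun _ : Fin (k : ℕ) => E) F} (hb : HasDerivAt b b' 0) (hb0 : b 0 = 0)
    {c : ℝ → E} {c' : E} (hc : HasDerivAt c c' 0) :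
    HasDerivAt (fun τ => jetPolynomial d (b τ) (c τ)) (jetPolynomial d b' (c 0)) 0 := by
  set P := fun a : ((k : Fin (d + 1)) →
    ContinuousMultilinearMap ℝ (fun _ : Fin (k : ℕ) => E) F) × E => jetPolynomial d a.1 a.2 with hPdef
  have hP : DifferentiableAt ℝ P (0, c 0) :=
    (contDiff_jetPolynomial (E := E) (F := F) d).differentiable (by simp) (0, c 0)
  have h1 := HasFDerivAt.comp_hasDerivAt_of_eq (0 : ℝ) hP.hasFDerivAt (hb.prodMk hc) (by rw [hb0])
  have h2 : HasDerivAt (fun r : ℝ => r • b') b' 0 := by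
    simpa using (hasDerivAt_id (0 : ℝ)).smul_const b'
  have h3 := HasFDerivAt.comp_hasDerivAt_of_eq (0 : ℝ) hP.hasFDerivAt
    (h2.prodMk (hasDerivAt_const (0 : ℝ) (c 0))) (by simp)
  have h4 := HasFDerivAt.comp_hasDerivAt (0 : ℝ) hP.hasFDerivAt
    ((hasDerivAt_const (0 : ℝ) (0 : (k : Fin (d + 1)) →
      ContinuousMultilinearMap ℝ (fun _ : Fin (k : ℕ) => E) F)).prodMk hc)
  have h5 : HasDerivAt (P ∘ fun τ : ℝ => (τ • b', c 0)) (jetPolynomial d b' (c 0)) 0 := by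
    have : (P ∘ fun τ : ℝ => (τ • b', c 0)) = fun τ => τ • jetPolynomial d b' (c 0) := by
      funext τ; exact jetPolynomial_smul d τ b' (c 0)
    rw [this]
    simpa using (hasDerivAt_id (0 : ℝ)).smul_const (jetPolynomial d b' (c 0))
  have h6 : HasDerivAt (P ∘ fun τ : ℝ => (0, c τ)) 0 0 := by
    have : (P ∘ fun τ : ℝ => (0, c τ)) = fun τ => 0 := by
      funext τ; exact jetPolynomial_zero d (c τ)
    rw [this]
    exact hasDerivAt_const _ _
  have e5 := h3.unique h5
  have e6 := h4.unique h6
  rw [show (b', c') = (b', 0) + (0, c') by simp, map_add, e6, add_zero, e5] at h1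
  exact h1

/-- The vertical jet at `w` of the Hamiltonian field of `h` along `C`. -/
noncomputable def hamJet (l : ℕ) (C : BigJet n → BigJet n) (w : BigJet n) (h : BigJet n → ℝ) :
    JetSpace n l :=
  (0, fun k => iteratedFDeriv ℝ (k : ℕ) (fun x => hamField h (C x)) w)

theorem iteratedFDeriv_eq_of_vanishesTo {E F : Type} [NormedAddCommGroup E] [NormedSpace ℝ E]
    [NormedAddCommGroup F] [NormedSpace ℝ F] {f g : E → F} {y : E} {m k : ℕ}
    (h : VanishesTo m (fun x => f x - g x) y) (cf : ContDiffAt ℝ ∞ f y) (cg : ContDiffAt ℝ ∞ g y)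
    (hk : k < m) : iteratedFDeriv ℝ k f y = iteratedFDeriv ℝ k g y := by
  have h1 : iteratedFDeriv ℝ k (fun x => f x - g x) y = iteratedFDeriv ℝ k f y -
    iteratedFDeriv ℝ k g y := iteratedFDeriv_sub_apply (cf.nat_of_infty k) (cg.nat_of_infty k)
  rw [h k hk] at h1
  exact (sub_eq_zero.1 h1.symm)

set_option maxHeartbeats 1000000 in
-- Subtract from a curve of jets the jets of `C` at the moving base point: the remaining velocity is
-- vertical. Transported to the target by a local inverse of `C`, it is the velocity of a family
-- through the identity that agrees to order `l` with `Θ`-preserving germs, hence it is Hamiltonian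
-- to that order.
theorem exists_of_mem_tangentVectors (hU : IsOpen U) (hC : IsThetaPContactEmbeddingOn U C)
    {w : BigJet n} (hw : w ∈ U) {v : JetSpace n l}
    (hv : v ∈ tangentVectors (thetaPContactJets l U) (jet l C w)) :
    ∃ x, ∃ h ∈ hamiltonians n (l + 1), v = fderiv ℝ (jet l C) w x + hamJet l C w h := by
  obtain ⟨ε, γ, hε, cγ, hγJ, hγ0, hγv⟩ := hv
  have hIoo : Ioo (-ε) ε ∈ 𝓝 (0 : ℝ) := Ioo_mem_nhds (by linarith) hε
  have cC := hC.contDiffAt hU hw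
  have cCe : ∀ᶠ x in 𝓝 w, ContDiffAt ℝ ∞ C x := by
    filter_upwards [hU.mem_nhds hw] with x hx using hC.contDiffAt hU hx
  obtain ⟨G, cG, hGC, hCG⟩ := exists_local_inverse cCe (by
    filter_upwards [hU.mem_nhds hw] with x hx using hC.injective_fderiv x hx)
  have hGw : G (C w) = w := hGC.self_of_nhds
  have hGt : Tendsto G (𝓝 (C w)) (𝓝 w) := by
    have := cG.self_of_nhds.continuousAt.tendsto; rwa [hGw] at this
  -- the base point of the curve
  set c : ℝ → BigJet n := fun τ => (γ τ).1 with hcdef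
  have hc0 : c 0 = w := by simp [hcdef, hγ0, jet]
  have hcv : HasDerivAt c v.1 0 := by
    have := (ContinuousLinearMap.fst ℝ (BigJet n) ((k : Fin (l + 1)) →
      ContinuousMultilinearMap ℝ (fun _ : Fin (k : ℕ) => BigJet n) (BigJet n))).hasFDerivAt
      (x := γ 0) |>.comp_hasDerivAt (0 : ℝ) hγv
    exact this
  have hct : Tendsto c (𝓝 0) (𝓝 w) := by
    have := hcv.continuousAt.tendsto; rwa [hc0] at this
  -- These coefficients vary smoothly with `τ`, vanish at `τ = 0`, and are symmetric because both
  -- terms are derivatives of smooth germs; they are thus the derivatives of an actual polynomial.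
  set b : ℝ → (k : Fin (l + 1)) →
      ContinuousMultilinearMap ℝ (fun _ : Fin (k : ℕ) => BigJet n) (BigJet n) :=
    fun τ => (γ τ).2 - (jet l C (c τ)).2 with hbdef
  have hb0 : b 0 = 0 := by
    simp only [hbdef, hc0, hγ0, sub_self]
  have hbv : HasDerivAt b (v - fderiv ℝ (jet l C) w v.1).2 0 := by
    have h1 : HasDerivAt (fun τ => jet l C (c τ)) (fderiv ℝ (jet l C) w v.1) 0 := by
      have h2 : HasFDerivAt (jet l C) (fderiv ℝ (jet l C) w) (c 0) := by
        rw [hc0]; exact (hasFDerivAt_jet cC).differentiableAt.hasFDerivAt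
      exact h2.comp_hasDerivAt (0 : ℝ) hcv
    have := (ContinuousLinearMap.snd ℝ (BigJet n) ((k : Fin (l + 1)) →
      ContinuousMultilinearMap ℝ (fun _ : Fin (k : ℕ) => BigJet n) (BigJet n))).hasFDerivAt
      (x := γ 0 - jet l C (c 0)) |>.comp_hasDerivAt (0 : ℝ) (hγv.sub h1)
    exact this
  -- germs realising the jets of the curve
  have hgerm : ∀ τ ∈ Ioo (-ε) ε, c τ ∈ U ∧ ∃ D, IsStrictGerm D (c τ) ∧ γ τ = jet l D (c τ) := by
    intro τ hτ
    obtain ⟨x, hx, V, hV, hxV, _, D, hD, hj⟩ := hγJ τ hτ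
    have hcx : c τ = x := by simp [hcdef, hj, jet]
    rw [hcx]
    exact ⟨hx, D, hD.isStrictGerm hV hxV, hj⟩
  have hsymm : ∀ τ ∈ Ioo (-ε) ε, ∀ (k : Fin (l + 1)) u (σ : Equiv.Perm (Fin (k : ℕ))),
      b τ k (u ∘ σ) = b τ k u := by
    intro τ hτ k u σ
    obtain ⟨hcU, D, hD, hj⟩ := hgerm τ hτ
    have h1 := hD.contDiffAt.iteratedFDeriv_perm u σ
    have h2 := (hC.contDiffAt hU hcU).iteratedFDeriv_perm u σ
    simp only [hbdef, hj, jet, Pi.sub_apply, sub_apply, h1, h2]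
  set b' := (v - fderiv ℝ (jet l C) w v.1).2 with hb'def
  have hsymm' : ∀ (k : Fin (l + 1)) u (σ : Equiv.Perm (Fin (k : ℕ))), b' k (u ∘ σ) = b' k u := by
    intro k u σ
    have h1 : ∀ u, HasDerivAt (fun τ => b τ k u) (b' k u) 0 := by
      intro u
      have h2 : HasDerivAt (fun τ => b τ k) (b' k) 0 := hasDerivAt_pi.1 hbv k
      exact ((ContinuousMultilinearMap.apply ℝ (fun _ : Fin (k : ℕ) => BigJet n) (BigJet n)
        u).hasFDerivAt (x := b 0 k)).comp_hasDerivAt (0 : ℝ) h2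
    refine (h1 (u ∘ σ)).unique ((h1 u).congr_of_eventuallyEq ?_)
    filter_upwards [hIoo] with τ hτ using hsymm τ hτ k u σ
  -- the family of maps
  set R : ℝ × BigJet n → BigJet n :=
    fun p => C (G p.2) + jetPolynomial l (b p.1) (G p.2 - c p.1) with hR
  have hcC : Tendsto (fun τ => C (c τ)) (𝓝 0) (𝓝 (C w)) := cC.continuousAt.tendsto.comp hct
  have cγe : ∀ᶠ τ in 𝓝 (0 : ℝ), ContDiffAt ℝ ∞ γ τ := by
    filter_upwards [isOpen_Ioo.mem_nhds (show (0 : ℝ) ∈ Ioo (-ε) ε from ⟨by linarith, hε⟩)]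
      with τ hτ using cγ.contDiffAt (isOpen_Ioo.mem_nhds hτ)
  have cRe : ∀ᶠ p in 𝓝 ((0 : ℝ), C w), ContDiffAt ℝ ∞ R p := by
    rw [nhds_prod_eq]
    filter_upwards [(cγe.and (hct.eventually cCe)).prod_mk (cG.and (hGt.eventually cCe))]
      with p ⟨⟨h1, h2⟩, h3, h4⟩
    have c1 : ContDiffAt ℝ ∞ (fun p : ℝ × BigJet n => G p.2) p := h3.comp p contDiffAt_snd
    have c2 : ContDiffAt ℝ ∞ c p.1 := contDiffAt_fst.comp p.1 h1
    have c3 : ContDiffAt ℝ ∞ b p.1 :=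
      (contDiffAt_snd.comp p.1 h1).sub (contDiffAt_snd.comp p.1
        ((contDiffAt_jet (l := l) h2).comp p.1 c2))
    exact (ContDiffAt.comp p h4 c1).add
      ((ContDiffAt.comp (g := b) p c3 contDiffAt_fst).jetPolynomial
        (c1.sub (ContDiffAt.comp (g := c) p c2 contDiffAt_fst)))
  -- The germ to compare with is `D ∘ C⁻¹`, where `D` realises the jet `γ τ`. By construction `C`
  -- plus the polynomial has the same `l`-jet as `D` at `c τ`.
  have hfam : ∀ᶠ τ in 𝓝 (0 : ℝ), ∃ φ, IsStrictGerm φ (C (c τ)) ∧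
      VanishesTo (l + 1) (fun y => R (τ, y) - φ y) (C (c τ)) := by
    filter_upwards [hIoo, hct.eventually hGC, hcC.eventually hCG.eventually_nhds,
      hcC.eventually cG] with τ hτ h1 h2 h3
    obtain ⟨hcU, D, hD, hj⟩ := hgerm τ hτ
    have hDG : IsStrictGerm D (G (C (c τ))) := by rwa [h1]
    refine ⟨fun y => D (G y), hDG.comp ((hC.isStrictGerm hU hcU).symm h3 h1 h2), ?_⟩
    have cP0 : ContDiffAt ℝ ∞ (fun x => jetPolynomial l (b τ) (x - c τ)) (c τ) :=
      contDiffAt_const.jetPolynomial (contDiffAt_id.sub contDiffAt_const)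
    have cP : ContDiffAt ℝ ∞ (fun x => C x + jetPolynomial l (b τ) (x - c τ)) (c τ) :=
      (hC.contDiffAt hU hcU).add cP0
    have hV : VanishesTo (l + 1)
        (fun x => (C x + jetPolynomial l (b τ) (x - c τ)) - D x) (c τ) := by
      intro k hk
      have e1 : iteratedFDeriv ℝ k (fun x => (C x + jetPolynomial l (b τ) (x - c τ)) - D x) (c τ)
          = iteratedFDeriv ℝ k (fun x => C x + jetPolynomial l (b τ) (x - c τ)) (c τ) -
            iteratedFDeriv ℝ k D (c τ) :=
        iteratedFDeriv_sub_apply (cP.nat_of_infty k) (hD.contDiffAt.nat_of_infty k)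
      have e2 : iteratedFDeriv ℝ k (fun x => C x + jetPolynomial l (b τ) (x - c τ)) (c τ) =
          iteratedFDeriv ℝ k C (c τ) +
            iteratedFDeriv ℝ k (fun x => jetPolynomial l (b τ) (x - c τ)) (c τ) :=
        iteratedFDeriv_add_apply ((hC.contDiffAt hU hcU).nat_of_infty k) (cP0.nat_of_infty k)
      have e3 : iteratedFDeriv ℝ k (fun x => jetPolynomial l (b τ) (x - c τ)) (c τ) =
          b τ ⟨k, hk⟩ := by
        rw [iteratedFDeriv_comp_sub, sub_self]
        exact iteratedFDeriv_jetPolynomial l (b τ) (hsymm τ hτ) ⟨k, hk⟩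
      rw [e1, e2, e3]
      simp only [hbdef, hj, jet, Pi.sub_apply]
      abel
    have hV' : VanishesTo (l + 1)
        (fun x => (C x + jetPolynomial l (b τ) (x - c τ)) - D x) (G (C (c τ))) := by rwa [h1]
    exact hV'.comp (by rw [h1]; exact cP.sub hD.contDiffAt) h3
  have hCc : DifferentiableAt ℝ (fun τ => C (c τ)) 0 := by
    have : DifferentiableAt ℝ C (c 0) := by rw [hc0]; exact cC.differentiableAt (by simp)
    exact this.comp (0 : ℝ) hcv.differentiableAt
  have hCG' := hCG
  rw [← hc0] at cRe hCG'
  obtain ⟨h, hh, hv⟩ := IsStrictGerm.family_hamField (R := R) (c := fun τ => C (c τ)) cRe hCc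
    (by
      filter_upwards [hCG'] with y hy
      simp [hR, hb0, jetPolynomial_zero, hy]) hfam
  refine ⟨v.1, h, hh, ?_⟩
  simp only [hc0] at hv cRe
  have cH : ContDiffAt ℝ ∞ (fun x => hamField h (C x)) w :=
    (contDiffAt_hamField (contDiff_of_mem_hamiltonians hh).contDiffAt).comp w cC
  have cP : ContDiffAt ℝ ∞ (fun x => jetPolynomial l b' (x - w)) w :=
    contDiffAt_const.jetPolynomial (contDiffAt_id.sub contDiffAt_const)
  -- Because `b 0 = 0`, the velocity of `R` at `τ = 0` is the polynomial with coefficients `b'`,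
  -- centred at `w` and read through `G`.
  have hRdot : (fun y => fderiv ℝ R ((0 : ℝ), y) (1, 0) - hamField h y) =ᶠ[𝓝 (C w)]
      fun y => jetPolynomial l b' (G y - w) - hamField h y := by
    have hx0 : Tendsto (fun x : BigJet n => ((0 : ℝ), x)) (𝓝 (C w)) (𝓝 ((0 : ℝ), C w)) := by
      have : ContinuousAt (fun x : BigJet n => ((0 : ℝ), x)) (C w) := by fun_prop
      exact this
    filter_upwards [hx0.eventually cRe] with y hy
    have h1 : HasDerivAt (fun τ : ℝ => R (τ, y)) (fderiv ℝ R ((0 : ℝ), y) (1, 0)) 0 :=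
      (hy.differentiableAt (by simp)).hasFDerivAt.comp_hasDerivAt (0 : ℝ)
        ((hasDerivAt_id (0 : ℝ)).prodMk (hasDerivAt_const (0 : ℝ) y))
    have h2 : HasDerivAt (fun τ : ℝ => R (τ, y)) (jetPolynomial l b' (G y - c 0)) 0 := by
      simp only [hR]
      exact (hasDerivAt_jetPolynomial hbv hb0 (hcv.const_sub (G y))).const_add _
    rw [h1.unique h2, hc0]
  have hv2 : VanishesTo (l + 1)
      (fun x => jetPolynomial l b' (x - w) - hamField h (C x)) w := by
    have h1 := hv.congr hRdot
    have c1 : ContDiffAt ℝ ∞ (fun y => jetPolynomial l b' (G y - w)) (C w) :=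
      contDiffAt_const.jetPolynomial (cG.self_of_nhds.sub contDiffAt_const)
    have c2 : ContDiffAt ℝ ∞ (hamField h) (C w) :=
      contDiffAt_hamField (contDiff_of_mem_hamiltonians hh).contDiffAt
    refine (VanishesTo.comp h1 (c1.sub c2) cC).congr ?_
    filter_upwards [hGC] with x hx
    rw [hx]
  have hb'eq : b' = fun k : Fin (l + 1) =>
      iteratedFDeriv ℝ (k : ℕ) (fun x => hamField h (C x)) w := by
    funext k
    rw [← iteratedFDeriv_eq_of_vanishesTo hv2 cP cH k.2, iteratedFDeriv_comp_sub, sub_self]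
    exact (iteratedFDeriv_jetPolynomial l b' hsymm' k).symm
  have hfd : (fderiv ℝ (jet l C) w v.1).1 = v.1 := by
    rw [(hasFDerivAt_jet cC).fderiv]; rfl
  refine Prod.ext ?_ ?_
  · rw [Prod.fst_add, hfd]; simp [hamJet]
  · rw [Prod.snd_add]
    have : (hamJet l C w h).2 = b' := hb'eq.symm
    rw [this, hb'def, Prod.snd_sub]
    abel

end TangentJets

/-! ### Tools for Sard's theorem: straightening, localisation and the highly degenerate points -/

section Sard

open Filter MeasureTheory

/-- Composition with a fixed right inverse of `f` sends `f` to the identity, and the invertible maps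
near the identity are open. -/
theorem ContinuousLinearMap.isOpen_setOf_surjective {E F : Type*} [NormedAddCommGroup E]
    [NormedSpace ℝ E] [NormedAddCommGroup F] [NormedSpace ℝ F] [FiniteDimensional ℝ F] :
    IsOpen {f : E →L[ℝ] F | Function.Surjective f} := by
  have : CompleteSpace F := FiniteDimensional.complete ℝ F
  rw [isOpen_iff_mem_nhds]
  intro f hf
  obtain ⟨r, hr⟩ := f.exists_rightInverse_of_surjective (LinearMap.range_eq_top.2 hf)
  have hc : Continuous fun g : E →L[ℝ] F => g.comp r := by fun_prop
  have h1 : range (ContinuousLinearEquiv.toContinuousLinearMap (R₁ := ℝ) (M₁ := F) (M₂ := F)) ∈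
      𝓝 (f.comp r) := by
    rw [hr]; exact ContinuousLinearEquiv.nhds (ContinuousLinearEquiv.refl ℝ F)
  filter_upwards [hc.continuousAt.preimage_mem_nhds h1] with g ⟨e, he⟩ y
  refine ⟨r (e.symm y), ?_⟩
  have : g (r (e.symm y)) = (e : F →L[ℝ] F) (e.symm y) := by rw [he]; rfl
  simpa using this

/-- The local inverse of a smooth map with an invertible differential at a point. -/
theorem exists_local_inverse_of_equiv {E E' : Type*} [NormedAddCommGroup E] [NormedSpace ℝ E]
    [FiniteDimensional ℝ E] [NormedAddCommGroup E'] [NormedSpace ℝ E'] {C : E → E'} {w : E}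
    (cC : ∀ᶠ x in 𝓝 w, ContDiffAt ℝ ∞ C x) (e : E ≃L[ℝ] E') (he : HasFDerivAt C (e : E →L[ℝ] E') w) :
    ∃ G : E' → E, (∀ᶠ y in 𝓝 (C w), ContDiffAt ℝ ∞ G y) ∧ (∀ᶠ x in 𝓝 w, G (C x) = x) ∧
      ∀ᶠ y in 𝓝 (C w), C (G y) = y := by
  have : CompleteSpace E := FiniteDimensional.complete ℝ E
  have hcont : ContinuousAt (fderiv ℝ C) w :=
    (cC.self_of_nhds.fderiv_right (m := 0) (by norm_cast)).continuousAt
  have key : ∀ᶠ x in 𝓝 w, ∃ e : E ≃L[ℝ] E', HasFDerivAt C (e : E →L[ℝ] E') x := by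
    have h1 : range (ContinuousLinearEquiv.toContinuousLinearMap (R₁ := ℝ) (M₁ := E) (M₂ := E')) ∈
        𝓝 (fderiv ℝ C w) := by
      rw [he.fderiv]; exact ContinuousLinearEquiv.nhds e
    filter_upwards [hcont.preimage_mem_nhds h1, cC] with x ⟨e', he'⟩ hx
    refine ⟨e', ?_⟩
    rw [he']
    exact (hx.differentiableAt (by simp)).hasFDerivAt
  have hs := cC.self_of_nhds.mem_toOpenPartialHomeomorph_source he (by simp)
  have ht := cC.self_of_nhds.image_mem_toOpenPartialHomeomorph_target he (by simp)
  set φ := cC.self_of_nhds.toOpenPartialHomeomorph C he (by simp) with hφ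
  refine ⟨φ.symm, ?_, ?_, ?_⟩
  · have hc : Tendsto φ.symm (𝓝 (C w)) (𝓝 w) := by
      have := (φ.continuousAt_symm ht).tendsto
      rwa [show φ.symm (C w) = w from φ.left_inv hs] at this
    filter_upwards [φ.open_target.mem_nhds ht, hc.eventually cC, hc.eventually key]
      with y hy h1 ⟨e', he'⟩
    exact φ.contDiffAt_symm hy he' h1
  · filter_upwards [φ.open_source.mem_nhds hs] with x hx
    exact φ.left_inv hx
  · filter_upwards [φ.open_target.mem_nhds ht] with y hy
    exact φ.right_inv hy

/-- A nonzero functional is the first coordinate of a splitting. -/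
theorem exists_equiv_prod_ker {E : Type} [NormedAddCommGroup E] [NormedSpace ℝ E]
    [FiniteDimensional ℝ E] {ℓ : E →L[ℝ] ℝ} (h : ℓ ≠ 0) :
    ∃ (κ : E →L[ℝ] ℓ.ker) (e : E ≃L[ℝ] ℝ × ℓ.ker), ∀ x, e x = (ℓ x, κ x) := by
  obtain ⟨v, hv⟩ : ∃ v, ℓ v ≠ 0 := by
    by_contra! hc
    exact h (ContinuousLinearMap.ext hc)
  set u := (ℓ v)⁻¹ • v with hu
  have hu1 : ℓ u = 1 := by simp [hu, hv]
  let κ : E →L[ℝ] ℓ.ker := ((ContinuousLinearMap.id ℝ E) - ℓ.smulRight u).codRestrict ℓ.ker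
    fun x => by simp [hu1]
  refine ⟨κ, ContinuousLinearEquiv.equivOfInverse (ℓ.prod κ)
    ((ContinuousLinearMap.toSpanSingleton ℝ u).comp (ContinuousLinearMap.fst ℝ ℝ ℓ.ker) +
      ℓ.ker.subtypeL.comp (ContinuousLinearMap.snd ℝ ℝ ℓ.ker)) (fun x => ?_) (fun x => ?_),
    fun x => rfl⟩
  · simp [κ]
  · obtain ⟨s, y, hy⟩ := x
    have hy' : ℓ y = 0 := hy
    refine Prod.ext ?_ (Subtype.ext ?_)
    · simp [hu1, hy']
    · simp [κ, hu1, hy']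

/-- `g` serves as first coordinate and a linear projection to the kernel of its differential
supplies the others; the inverse function theorem applies. -/
theorem exists_straightening {E : Type} [NormedAddCommGroup E] [NormedSpace ℝ E]
    [FiniteDimensional ℝ E] {m : ℕ} (hm : Module.finrank ℝ E = m + 1) {g : E → ℝ} {x : E}
    (cg : ∀ᶠ x in 𝓝 x, ContDiffAt ℝ ∞ g x) (h : fderiv ℝ g x ≠ 0) :
    ∃ (E' : Submodule ℝ E) (κ : E →L[ℝ] E') (G : ℝ × E' → E), Module.finrank ℝ E' = m ∧
      (∀ᶠ p in 𝓝 (g x, κ x), ContDiffAt ℝ ∞ G p) ∧ (∀ᶠ y in 𝓝 x, G (g y, κ y) = y) ∧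
      ∀ᶠ p in 𝓝 (g x, κ x), (g (G p), κ (G p)) = p := by
  obtain ⟨κ, e, he⟩ := exists_equiv_prod_ker h
  obtain ⟨G, h1, h2, h3⟩ := exists_local_inverse_of_equiv (C := fun y => (g y, κ y)) (w := x)
    (by filter_upwards [cg] with y hy using hy.prodMk κ.contDiff.contDiffAt) e (by
      convert! ((cg.self_of_nhds.differentiableAt (by simp)).hasFDerivAt).prodMk κ.hasFDerivAt
      exact ContinuousLinearMap.ext fun y => he y)
  refine ⟨_, κ, G, ?_, h1, h2, h3⟩
  have := e.toLinearEquiv.finrank_eq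
  rw [Module.finrank_prod, Module.finrank_self, hm] at this
  omega

/-- The statement is about the outer measure pulled back by `f`, so countable subadditivity and
second countability suffice, without measurability of images. -/
theorem measure_image_null_of_locally {E F : Type} [NormedAddCommGroup E] [NormedSpace ℝ E]
    [FiniteDimensional ℝ E] [MeasurableSpace F] {μ : Measure F} {f : E → F} {A : Set E}
    (h : ∀ x ∈ A, ∃ u ∈ 𝓝 x, μ (f '' (A ∩ u)) = 0) : μ (f '' A) = 0 := by
  have := measure_null_of_locally_null (μ := OuterMeasure.comap f μ.toOuterMeasure) A
    fun x hx => by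
      obtain ⟨u, hu, h0⟩ := h x hx
      exact ⟨A ∩ u, inter_mem_nhdsWithin A hu, h0⟩
  exact this

variable {E F : Type} [NormedAddCommGroup E] [NormedSpace ℝ E]
  [NormedAddCommGroup F] [NormedSpace ℝ F]

theorem norm_le_of_vanishesTo {s : Set E} (hs : Convex ℝ s) {K : ℝ} {m : ℕ} {f : E → F}
    (cf : ∀ x ∈ s, ContDiffAt ℝ ∞ f x) (hK : ∀ x ∈ s, ‖iteratedFDeriv ℝ m f x‖ ≤ K) {x y : E}
    (hx : x ∈ s) (hy : y ∈ s) (hv : VanishesTo m f x) : ‖f y‖ ≤ K * ‖y - x‖ ^ m := by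
  induction m generalizing F y with
  | zero => simpa using hK y hy
  | succ m ih =>
    have hsub : segment ℝ x y ⊆ s := hs.segment_subset hx hy
    have hb : ∀ z ∈ segment ℝ x y, ‖fderiv ℝ f z‖ ≤ K * ‖y - x‖ ^ m := by
      intro z hz
      refine (ih (f := fderiv ℝ f) (fun x hx => (cf x hx).fderiv_infty)
        (fun x hx => by rw [norm_iteratedFDeriv_fderiv]; exact hK x hx) (hsub hz) hv.fderiv).trans ?_
      have hK0 : 0 ≤ K := (norm_nonneg _).trans (hK x hx)
      gcongr
      rw [← dist_eq_norm, ← dist_eq_norm, dist_comm z, dist_comm y]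
      have := dist_add_dist_of_mem_segment hz
      linarith [dist_nonneg (x := z) (y := y)]
    have := Convex.norm_image_sub_le_of_norm_fderiv_le (𝕜 := ℝ)
      (fun z hz => (cf z (hsub hz)).differentiableAt (by simp)) hb (convex_segment x y)
      (left_mem_segment ℝ x y) (right_mem_segment ℝ x y)
    rw [hv.eq_zero, sub_zero] at this
    rw [pow_succ, ← mul_assoc]; exact this

variable [FiniteDimensional ℝ E] [FiniteDimensional ℝ F] [MeasurableSpace F] [BorelSpace F]

/-- If the derivatives of orders `1, …, m` vanish, with `m` the dimension of the source, Taylor's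
estimate makes `f` Hölder of exponent `m + 1` there. The image has Hausdorff dimension at most `m /
(m + 1) < 1`, hence is null for the Hausdorff measure of the dimension of `F`, which has the null
sets of `μ`. -/
theorem measure_image_vanishing (μ : Measure F) [μ.IsAddHaarMeasure] {U : Set E} (hU : IsOpen U)
    {f : E → F} (cf : ContDiffOn ℝ ∞ f U) (hF : 0 < Module.finrank ℝ F) :
    μ (f '' {x ∈ U | VanishesTo (Module.finrank ℝ E) (fderiv ℝ f) x}) = 0 := by
  have : ProperSpace E := FiniteDimensional.proper ℝ E
  set m := Module.finrank ℝ E with hm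
  refine measure_image_null_of_locally fun x hx => ?_
  obtain ⟨r, hr, hrU⟩ := Metric.nhds_basis_closedBall.mem_iff.1 (hU.mem_nhds hx.1)
  have cf' : ∀ y ∈ Metric.closedBall x r, ContDiffAt ℝ ∞ f y := fun y hy =>
    cf.contDiffAt (hU.mem_nhds (hrU hy))
  obtain ⟨K, hK⟩ := (isCompact_closedBall x r).exists_bound_of_continuousOn
    (f := iteratedFDeriv ℝ (m + 1) f) fun y hy =>
      ((cf' y hy).iteratedFDeriv_infty (m + 1)).continuousAt.continuousWithinAt
  have hK0 : 0 ≤ K := (norm_nonneg _).trans (hK x (Metric.mem_closedBall_self hr.le))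
  refine ⟨Metric.closedBall x r, Metric.closedBall_mem_nhds x hr, ?_⟩
  set A := {x ∈ U | VanishesTo m (fderiv ℝ f) x} ∩ Metric.closedBall x r with hA
  have hH : HolderOnWith K.toNNReal (m + 1 : ℕ) f A := by
    intro a ha b hb
    have h1 : ‖f b - f a‖ ≤ K * ‖b - a‖ ^ (m + 1) := by
      have hfd : fderiv ℝ (fun y => f y - f a) = fderiv ℝ f := by
        funext y; exact fderiv_sub_const _
      refine norm_le_of_vanishesTo (f := fun y => f y - f a) (convex_closedBall x r)
        (fun y hy => (cf' y hy).sub contDiffAt_const) (fun y hy => ?_) ha.2 hb.2 ?_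
      · rw [← norm_iteratedFDeriv_fderiv, hfd, norm_iteratedFDeriv_fderiv]
        exact hK y hy
      · rw [vanishesTo_succ_iff, hfd]
        exact ⟨sub_self _, ha.1.2⟩
    rw [edist_comm, edist_comm a, edist_dist, edist_dist, dist_eq_norm, dist_eq_norm]
    have h2 : ENNReal.ofReal ‖b - a‖ ^ (((m + 1 : ℕ) : NNReal) : ℝ) =
      ENNReal.ofReal (‖b - a‖ ^ (m + 1)) := by
      rw [ENNReal.ofReal_pow (norm_nonneg _), NNReal.coe_natCast, ENNReal.rpow_natCast]
    have h3 : (K.toNNReal : ENNReal) = ENNReal.ofReal K := rfl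
    rw [h2, h3, ← ENNReal.ofReal_mul hK0]
    exact ENNReal.ofReal_le_ofReal h1
  have hd : dimH (f '' A) < ((Module.finrank ℝ F : NNReal) : ENNReal) := by
    refine (hH.dimH_image_le (by positivity)).trans_lt ?_
    have h1 : dimH A ≤ (m : ENNReal) :=
      (dimH_mono (subset_univ A)).trans (Real.dimH_univ_eq_finrank E).le
    refine (ENNReal.div_le_div_right h1 _).trans_lt ?_
    have h2 : (m : ENNReal) / (((m + 1 : ℕ) : NNReal) : ENNReal) < 1 := by
      rw [ENNReal.div_lt_iff (by simp) (by simp), one_mul]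
      norm_cast
      omega
    exact h2.trans_le (by norm_cast)
  have hH2 : (Measure.hausdorffMeasure (X := F) ((Module.finrank ℝ F : NNReal) : ℝ)).IsAddHaarMeasure := by
    have := isAddHaarMeasure_hausdorffMeasure (E := F)
    exact_mod_cast this
  exact measure_zero_of_dimH_lt (Measure.absolutelyContinuous_isAddHaarMeasure μ _) hd

end Sard

/-! ### Sard's theorem by induction on the dimension of the source -/

section SardInduction

open Filter MeasureTheory

/-- The theorem of Sard for the smooth maps whose source has dimension `m`. -/
def SardInDimension (m : ℕ) : Prop :=
  ∀ (E F : Type) [NormedAddCommGroup E] [NormedSpace ℝ E] [FiniteDimensional ℝ E]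
    [NormedAddCommGroup F] [NormedSpace ℝ F] [FiniteDimensional ℝ F] [MeasurableSpace F]
    [BorelSpace F] (μ : Measure F) [μ.IsAddHaarMeasure] (U : Set E) (f : E → F),
    Module.finrank ℝ E = m → IsOpen U → ContDiffOn ℝ ∞ f U →
    μ (f '' {x ∈ U | ¬ Function.Surjective (fderiv ℝ f x)}) = 0

variable {E F : Type} [NormedAddCommGroup E] [NormedSpace ℝ E]
  [NormedAddCommGroup F] [NormedSpace ℝ F] [FiniteDimensional ℝ E] [FiniteDimensional ℝ F]
  [MeasurableSpace F] [BorelSpace F] {m : ℕ}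

/-- Some component of `D^k(Df)` vanishes on the set and has nonzero differential at the given point.
Near that point the set lies in a smooth hypersurface. There `Df = 0`, so its points are critical
for the restriction of `f`, and the induction hypothesis applies in dimension `m`. -/
theorem SardInDimension.measure_image_vanishing_exactly (ih : SardInDimension m)
    (hm : Module.finrank ℝ E = m + 1) (μ : Measure F) [μ.IsAddHaarMeasure] {U : Set E}
    (hU : IsOpen U) {f : E → F} (cf : ContDiffOn ℝ ∞ f U) (hF : 0 < Module.finrank ℝ F) (k : ℕ) :
    μ (f '' {x ∈ U | VanishesTo (k + 1) (fderiv ℝ f) x ∧ ¬ VanishesTo (k + 2) (fderiv ℝ f) x})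
      = 0 := by
  have hnt : Nontrivial F := Module.finrank_pos_iff.1 hF
  refine measure_image_null_of_locally fun x ⟨hxU, hx, hx'⟩ => ?_
  have cf' : ∀ y ∈ U, ContDiffAt ℝ ∞ f y := fun y hy => cf.contDiffAt (hU.mem_nhds hy)
  set T := iteratedFDeriv ℝ k (fderiv ℝ f) with hT
  have hne : fderiv ℝ T x ≠ 0 := by
    intro h0
    refine hx' fun j hj => ?_
    rcases Nat.lt_succ_iff_lt_or_eq.1 hj with h | rfl
    · exact hx j h
    · refine ContinuousMultilinearMap.ext fun a => ?_
      rw [iteratedFDeriv_succ_apply_left, ← hT, h0]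
      rfl
  obtain ⟨v, hv⟩ : ∃ v, fderiv ℝ T x v ≠ 0 := by
    by_contra! hc
    exact hne (ContinuousLinearMap.ext hc)
  obtain ⟨ℓ, hℓ⟩ := SeparatingDual.exists_ne_zero (R := ℝ) hv
  have cT : ∀ y ∈ U, ContDiffAt ℝ ∞ T y := fun y hy =>
    ((cf' y hy).fderiv_infty).iteratedFDeriv_infty k
  have cg : ∀ y ∈ U, ContDiffAt ℝ ∞ (fun y => ℓ (T y)) y := fun y hy =>
    ContDiffAt.comp (g := ℓ) y ℓ.contDiff.contDiffAt (cT y hy)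
  have hg' : fderiv ℝ (fun y => ℓ (T y)) x ≠ 0 := by
    intro h0
    have h1 : HasFDerivAt (fun y => ℓ (T y)) (ℓ.comp (fderiv ℝ T x)) x :=
      HasFDerivAt.comp (g := ℓ) x ℓ.hasFDerivAt
        ((cT x hxU).differentiableAt (by simp)).hasFDerivAt
    rw [h1.fderiv] at h0
    exact hℓ (by simpa using congrArg (fun L => L v) h0)
  obtain ⟨E', κ, G, hE', cG, hGl, hGr⟩ := exists_straightening hm
    (by filter_upwards [hU.mem_nhds hxU] with y hy using cg y hy) hg'
  have hT0 : ∀ y, VanishesTo (k + 1) (fderiv ℝ f) y → ℓ (T y) = 0 := fun y hy => by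
    rw [hT, hy k (Nat.lt_succ_self k), map_zero]
  have hGx : G (ℓ (T x), κ x) = x := hGl.self_of_nhds
  have hGU : ∀ᶠ p in 𝓝 (ℓ (T x), κ x), G p ∈ U := by
    have := cG.self_of_nhds.continuousAt.tendsto
    rw [hGx] at this
    exact this.eventually (hU.mem_nhds hxU)
  obtain ⟨W, hW, hWo, hxW⟩ := eventually_nhds_iff.1 (cG.and hGU)
  have hΦ : ∀ᶠ y in 𝓝 x, (ℓ (T y), κ y) ∈ W :=
    ((cg x hxU).continuousAt.prodMk κ.continuous.continuousAt).eventually (hWo.mem_nhds hxW)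
  refine ⟨_, hGl.and hΦ, ?_⟩
  refine measure_mono_null ?_ (ih E' F μ {v | ((0 : ℝ), v) ∈ W} (fun v => f (G (0, v))) hE'
    (hWo.preimage (by fun_prop)) fun v hv => ?_)
  · rintro _ ⟨y, ⟨⟨hyU, hy, -⟩, hyG, hyW⟩, rfl⟩
    rw [hT0 y hy] at hyG hyW
    refine ⟨κ y, ⟨hyW, fun hs => ?_⟩, by simp only [hyG]⟩
    have h1 : HasFDerivAt (fun v : E' => G ((0 : ℝ), v))
        ((fderiv ℝ G (0, κ y)).comp (ContinuousLinearMap.inr ℝ ℝ E')) (κ y) :=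
      HasFDerivAt.comp (κ y) (((hW _ hyW).1.differentiableAt (by simp)).hasFDerivAt)
        (hasFDerivAt_prodMk_right 0 (κ y))
    have h2 : HasFDerivAt f (0 : E →L[ℝ] F) (G (0, κ y)) := by
      rw [hyG, ← (hy.mono (by omega : 1 ≤ k + 1)).eq_zero]
      exact ((cf' y hyU).differentiableAt (by simp)).hasFDerivAt
    have h3 : fderiv ℝ (fun v => f (G (0, v))) (κ y) = 0 := by
      exact (HasFDerivAt.comp (g := f) (κ y) h2 h1).fderiv.trans rfl
    rw [h3] at hs
    obtain ⟨b, hb⟩ := exists_ne (0 : F)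
    obtain ⟨a, ha⟩ := hs b
    exact hb (by simpa using ha.symm)
  · refine ContDiffAt.contDiffWithinAt ?_
    exact ContDiffAt.comp (g := f) v (cf' _ (hW _ hv).2)
      (ContDiffAt.comp (g := G) v (hW _ hv).1 (contDiffAt_const.prodMk contDiffAt_id))

/-- The critical values of a map over `ℝ` whose first coordinate is the projection. -/
theorem SardInDimension.measure_image_fibred (ih : SardInDimension m)
    {E' F' : Type} [NormedAddCommGroup E'] [NormedSpace ℝ E'] [FiniteDimensional ℝ E']
    [NormedAddCommGroup F'] [NormedSpace ℝ F'] [FiniteDimensional ℝ F'] [MeasurableSpace F']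
    [BorelSpace F'] (ν : Measure F') [ν.IsAddHaarMeasure] (hE' : Module.finrank ℝ E' = m)
    {W : Set (ℝ × E')} (hW : IsOpen W) {f : ℝ × E' → F'} (cf : ContDiffOn ℝ ∞ f W)
    {K : Set (ℝ × E')} (hK : IsCompact K) (hKW : K ⊆ W) :
    ((volume : Measure ℝ).prod ν) ((fun p => (p.1, f p)) '' {p ∈ K | ¬ Function.Surjective
      (fderiv ℝ (fun p : ℝ × E' => (p.1, f p)) p)}) = 0 := by
  set g : ℝ × E' → ℝ × F' := fun p => (p.1, f p) with hg
  have cf' : ∀ p ∈ W, ContDiffAt ℝ ∞ f p := fun p hp => cf.contDiffAt (hW.mem_nhds hp)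
  have cg : ∀ p ∈ W, ContDiffAt ℝ ∞ g p := fun p hp => contDiffAt_fst.prodMk (cf' p hp)
  have hcl : IsCompact {p ∈ K | ¬ Function.Surjective (fderiv ℝ g p)} := by
    have h1 : ContinuousOn (fderiv ℝ g) K := fun p hp =>
      (cg p (hKW hp)).fderiv_infty.continuousAt.continuousWithinAt
    have h2 := h1.preimage_isClosed_of_isClosed hK.isClosed
      ((ContinuousLinearMap.isOpen_setOf_surjective (E := ℝ × E') (F := ℝ × F')).isClosed_compl)
    exact hK.of_isClosed_subset h2 fun p hp => hp.1
  have hgc : ContinuousOn g {p ∈ K | ¬ Function.Surjective (fderiv ℝ g p)} := fun p hp =>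
    (cg p (hKW hp.1)).continuousAt.continuousWithinAt
  -- Fubini: it is enough that each slice over `s` is null, and such a slice consists of critical
  -- values of `f (s, ·)`. The compactness of `K` provides the measurability required here.
  rw [Measure.measure_prod_null (hcl.image_of_continuousOn hgc).measurableSet]
  refine Eventually.of_forall fun s => ?_
  refine measure_mono_null ?_ (ih E' F' ν {v | (s, v) ∈ W} (fun v => f (s, v)) hE'
    (hW.preimage (by fun_prop)) fun v hv => ?_)
  · rintro b ⟨⟨s', v⟩, ⟨hK', hns⟩, heq⟩
    obtain ⟨rfl, rfl⟩ := Prod.mk_inj.1 heq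
    refine ⟨v, ⟨hKW hK', fun hs => hns ?_⟩, rfl⟩
    have hd := ((cf' _ (hKW hK')).differentiableAt (by simp)).hasFDerivAt
    have h1 : HasFDerivAt g ((ContinuousLinearMap.fst ℝ ℝ E').prod (fderiv ℝ f (s', v))) (s', v) :=
      hasFDerivAt_fst.prodMk hd
    have h2 : HasFDerivAt (fun v => f (s', v))
        ((fderiv ℝ f (s', v)).comp (ContinuousLinearMap.inr ℝ ℝ E')) v :=
      HasFDerivAt.comp (g := f) v hd (hasFDerivAt_prodMk_right s' v)
    rw [h2.fderiv] at hs
    rw [h1.fderiv]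
    rintro ⟨a, b⟩
    obtain ⟨u, hu⟩ := hs (b - fderiv ℝ f (s', v) (a, 0))
    refine ⟨(a, u), ?_⟩
    have : ((a, u) : ℝ × E') = (a, 0) + (0, u) := by simp
    rw [this, map_add]
    have hu' : fderiv ℝ f (s', v) (0, u) = b - fderiv ℝ f (s', v) (a, 0) := hu
    simp [hu']
  · exact (ContDiffAt.comp (g := f) v (cf' _ hv)
      (contDiffAt_const.prodMk contDiffAt_id)).contDiffWithinAt

/-- Where `Df ≠ 0` some functional `ℓ ∘ f` is a submersion. Using it as a coordinate of the source,
and `ℓ` as a coordinate of the target, turns `f` into a map fibred over `ℝ` with fibres of dimension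
`m`. -/
theorem SardInDimension.measure_image_nonvanishing (ih : SardInDimension m)
    (hm : Module.finrank ℝ E = m + 1) (μ : Measure F) [μ.IsAddHaarMeasure] {U : Set E}
    (hU : IsOpen U) {f : E → F} (cf : ContDiffOn ℝ ∞ f U) :
    μ (f '' {x ∈ U | ¬ Function.Surjective (fderiv ℝ f x) ∧ fderiv ℝ f x ≠ 0}) = 0 := by
  refine measure_image_null_of_locally fun x ⟨hxU, _, hx'⟩ => ?_
  have cf' : ∀ y ∈ U, ContDiffAt ℝ ∞ f y := fun y hy => cf.contDiffAt (hU.mem_nhds hy)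
  obtain ⟨v, hv⟩ : ∃ v, fderiv ℝ f x v ≠ 0 := by
    by_contra! hc
    exact hx' (ContinuousLinearMap.ext hc)
  obtain ⟨ℓ, hℓ⟩ := SeparatingDual.exists_ne_zero (R := ℝ) hv
  obtain ⟨π, e, he⟩ := exists_equiv_prod_ker (ℓ := ℓ) (by rintro rfl; simp at hℓ)
  have cg : ∀ y ∈ U, ContDiffAt ℝ ∞ (fun y => ℓ (f y)) y := fun y hy =>
    ContDiffAt.comp (g := ℓ) y ℓ.contDiff.contDiffAt (cf' y hy)
  have hg' : fderiv ℝ (fun y => ℓ (f y)) x ≠ 0 := by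
    intro h0
    have h1 : HasFDerivAt (fun y => ℓ (f y)) (ℓ.comp (fderiv ℝ f x)) x :=
      HasFDerivAt.comp (g := ℓ) x ℓ.hasFDerivAt
        ((cf' x hxU).differentiableAt (by simp)).hasFDerivAt
    rw [h1.fderiv] at h0
    exact hℓ (by simpa using congrArg (fun L => L v) h0)
  obtain ⟨E', κ, G, hE', cG, hGl, hGr⟩ := exists_straightening hm
    (by filter_upwards [hU.mem_nhds hxU] with y hy using cg y hy) hg'
  have hGx : G (ℓ (f x), κ x) = x := hGl.self_of_nhds
  have hGU : ∀ᶠ p in 𝓝 (ℓ (f x), κ x), G p ∈ U := by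
    have := cG.self_of_nhds.continuousAt.tendsto
    rw [hGx] at this
    exact this.eventually (hU.mem_nhds hxU)
  obtain ⟨W, hW, hWo, hxW⟩ := eventually_nhds_iff.1 ((cG.and hGU).and hGr)
  obtain ⟨r, hr, hrW⟩ := Metric.nhds_basis_closedBall.mem_iff.1 (hWo.mem_nhds hxW)
  have hΦ : ∀ᶠ y in 𝓝 x, (ℓ (f y), κ y) ∈ Metric.closedBall (ℓ (f x), κ x) r :=
    ((cg x hxU).continuousAt.prodMk κ.continuous.continuousAt).eventually
      (Metric.closedBall_mem_nhds _ hr)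
  have : ProperSpace (ℝ × E') := FiniteDimensional.proper ℝ _
  refine ⟨_, hGl.and hΦ, ?_⟩
  have cfG : ∀ p ∈ W, ContDiffAt ℝ ∞ (fun p => f (G p)) p := fun p hp =>
    ContDiffAt.comp (g := f) p (cf' _ (hW _ hp).1.2) (hW _ hp).1.1
  borelize (↥ℓ.ker)
  have key := ih.measure_image_fibred (Measure.addHaar : Measure ℓ.ker) hE' hWo
    (f := fun p => π (f (G p)))
    (fun p hp => (ContDiffAt.comp (g := π) p π.contDiff.contDiffAt (cfG p hp)).contDiffWithinAt)
    (isCompact_closedBall _ r) hrW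
  -- The image of `μ` under the splitting and the product measure are both Haar measures, so they
  -- have the same null sets.
  have hmap : (μ.map e).IsAddHaarMeasure := e.isAddHaarMeasure_map μ
  have key2 := Measure.absolutelyContinuous_isAddHaarMeasure (μ.map e)
    ((volume : Measure ℝ).prod (Measure.addHaar : Measure ℓ.ker)) key
  refine measure_mono_null ?_ (Measure.preimage_null_of_map_null
    e.continuous.measurable.aemeasurable key2)
  rintro _ ⟨y, ⟨⟨hyU, hy, -⟩, hyG, hyW⟩, rfl⟩
  have heq : (fun p : ℝ × E' => (p.1, π (f (G p)))) =ᶠ[𝓝 (ℓ (f y), κ y)]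
      fun p => e (f (G p)) := by
    filter_upwards [hWo.mem_nhds (hrW hyW)] with p hp
    rw [he, (Prod.mk_inj.1 (hW p hp).2).1]
  refine ⟨(ℓ (f y), κ y), ⟨hyW, fun hs => hy ?_⟩, ?_⟩
  · have h1 : HasFDerivAt (fun p => e (f (G p))) ((e : F →L[ℝ] ℝ × ℓ.ker).comp
        ((fderiv ℝ f y).comp (fderiv ℝ G (ℓ (f y), κ y)))) (ℓ (f y), κ y) := by
      refine HasFDerivAt.comp (g := e) _ e.hasFDerivAt (HasFDerivAt.comp (g := f) _ ?_
        ((hW _ (hrW hyW)).1.1.differentiableAt (by simp)).hasFDerivAt)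
      rw [hyG]
      exact ((cf' y hyU).differentiableAt (by simp)).hasFDerivAt
    rw [heq.fderiv_eq, h1.fderiv] at hs
    intro b
    obtain ⟨a, ha⟩ := hs (e b)
    exact ⟨_, e.injective ha⟩
  · have := heq.self_of_nhds
    simp only [hyG] at this
    simpa only [hyG] using this

/-- Critical points are of three kinds: `Df ≠ 0`; all derivatives up to the order of the dimension
vanish; or `Df = 0` and some first nonvanishing derivative exists. A target of dimension zero has no
critical points. -/
theorem sardInDimension (m : ℕ) : SardInDimension m := by
  induction m with
  | zero =>
    intro E F _ _ _ _ _ _ _ _ μ _ U f hm hU cf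
    rcases Nat.eq_zero_or_pos (Module.finrank ℝ F) with h0 | hF
    · have := Module.finrank_zero_iff.1 h0
      refine measure_mono_null ?_ measure_empty
      rintro _ ⟨x, ⟨-, hx⟩, -⟩
      exact (hx fun b => ⟨0, Subsingleton.elim _ _⟩).elim
    · refine measure_mono_null ?_ (measure_image_vanishing μ hU cf hF)
      rintro _ ⟨x, hx, rfl⟩
      exact ⟨x, ⟨hx.1, by rw [hm]; exact vanishesTo_zero _ _⟩, rfl⟩
  | succ m ih =>
    intro E F _ _ _ _ _ _ _ _ μ _ U f hm hU cf
    rcases Nat.eq_zero_or_pos (Module.finrank ℝ F) with h0 | hF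
    · have := Module.finrank_zero_iff.1 h0
      refine measure_mono_null ?_ measure_empty
      rintro _ ⟨x, ⟨-, hx⟩, -⟩
      exact (hx fun b => ⟨0, Subsingleton.elim _ _⟩).elim
    · refine measure_mono_null ?_ (measure_union_null (measure_union_null
        (measure_image_vanishing μ hU cf hF) (ih.measure_image_nonvanishing hm μ hU cf))
        (measure_iUnion_null fun k : ℕ => ih.measure_image_vanishing_exactly hm μ hU cf hF k))
      rintro _ ⟨x, ⟨hxU, hx⟩, rfl⟩
      by_cases h1 : VanishesTo (Module.finrank ℝ E) (fderiv ℝ f) x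
      · exact Or.inl (Or.inl ⟨x, ⟨hxU, h1⟩, rfl⟩)
      · by_cases h2 : fderiv ℝ f x = 0
        -- If the order of vanishing of `Df` were never exactly `k + 1`, it would increase forever
        -- and exceed the dimension.
        · refine Or.inr (mem_iUnion.2 ?_)
          by_contra! hc
          refine h1 ?_
          have : ∀ k, VanishesTo (k + 1) (fderiv ℝ f) x := by
            intro k
            induction k with
            | zero => exact vanishesTo_succ_iff.2 ⟨h2, vanishesTo_zero _ _⟩
            | succ k ihk =>
              by_contra h3
              exact hc k ⟨x, ⟨hxU, ihk, h3⟩, rfl⟩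
          rw [hm]
          exact this m
        · exact Or.inl (Or.inr ⟨x, ⟨hxU, hx, h2⟩, rfl⟩)

/-- **Sard's theorem**: the critical values of a smooth map form a null set. -/
theorem measure_image_critical (μ : Measure F) [μ.IsAddHaarMeasure] {U : Set E}
    (hU : IsOpen U) {f : E → F} (cf : ContDiffOn ℝ ∞ f U) :
    μ (f '' {x ∈ U | ¬ Function.Surjective (fderiv ℝ f x)}) = 0 :=
  sardInDimension _ E F μ U f rfl hU cf

end SardInduction

/-! ### Global `Θ`-preserving diffeomorphisms: flows of powers of affine functions -/

section Shears

open Filter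

variable {n l : ℕ}

/-- The unit vector `∂/∂s`. -/
abbrev sVec (n : ℕ) : BigJet n := (0, 0, 0, 1, 0)

/-- Lines parallel to `∂/∂s` go to such lines and `t` is fixed. In this form, stability under
composition is immediate. -/
theorem hasPForm_iff {U : Set (BigJet n)} {C : BigJet n → BigJet n} :
    HasPForm U C ↔ (∀ w ∈ U, (C w).t = w.t) ∧
      ∀ w ∈ U, ∀ r : ℝ, w + r • sVec n ∈ U → ∃ r' : ℝ, C (w + r • sVec n) = C w + r' • sVec n := by
  classical
  have hadd : ∀ (t : ℝ) (q : Fin n → ℝ) (z s : ℝ) (p : Fin n → ℝ) (r : ℝ),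
      ((t, q, z, s, p) : BigJet n) + r • sVec n = (t, q, z, s + r, p) := by
    intros; simp
  constructor
  · rintro ⟨qC, zC, hC, pC, h⟩
    refine ⟨fun ⟨t, q, z, s, p⟩ hw => by rw [h t q z s p hw], fun ⟨t, q, z, s, p⟩ hw r hr => ?_⟩
    rw [hadd] at hr ⊢
    refine ⟨hC t q z (s + r) p - hC t q z s p, ?_⟩
    rw [h _ _ _ _ _ hw, h _ _ _ _ _ hr, hadd]
    simp
  · rintro ⟨ht, hs⟩
    -- The fibre of `U` over `(t, q, z, p)` may be disconnected; any chosen point of it defines the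
    -- components, since the hypothesis compares arbitrary pairs of its points.
    let w0 : ℝ → (Fin n → ℝ) → ℝ → (Fin n → ℝ) → BigJet n := fun t q z p =>
      if h : ∃ s, (t, q, z, s, p) ∈ U then C (t, q, z, h.choose, p) else 0
    refine ⟨fun t q z p => (w0 t q z p).q, fun t q z p => (w0 t q z p).z,
      fun t q z s p => (C (t, q, z, s, p)).s, fun t q z p => (w0 t q z p).p, ?_⟩
    intro t q z s p hw
    have hex : ∃ s, (t, q, z, s, p) ∈ U := ⟨s, hw⟩
    have he : ((t, q, z, hex.choose, p) : BigJet n) + (s - hex.choose) • sVec n =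
      (t, q, z, s, p) := by rw [hadd]; simp
    obtain ⟨r', hr'⟩ := hs _ hex.choose_spec (s - hex.choose) (by rw [he]; exact hw)
    rw [he] at hr'
    have hw0 : w0 t q z p = C (t, q, z, hex.choose, p) := dif_pos hex
    simp only [hw0]
    refine Prod.ext (ht _ hw) (Prod.ext ?_ (Prod.ext ?_ (Prod.ext rfl ?_))) <;> rw [hr'] <;> simp

/-- Global diffeomorphisms onto their image which preserve `Θ` and have the form of a
`P`-contact map. -/
structure IsStrictDiffeo (D : BigJet n → BigJet n) : Prop where
  contDiff : ContDiff ℝ ∞ D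
  exists_leftInverse : ∃ E : BigJet n → BigJet n, ContDiff ℝ ∞ E ∧ Function.LeftInverse E D
  t_eq : ∀ w, (D w).t = w.t
  add_sVec : ∀ w (r : ℝ), ∃ r' : ℝ, D (w + r • sVec n) = D w + r' • sVec n
  preserves : ∀ w v, canonicalForm (D w) (fderiv ℝ D w v) = canonicalForm w v

theorem IsStrictDiffeo.id : IsStrictDiffeo (fun w : BigJet n => w) :=
  ⟨contDiff_id, ⟨_, contDiff_id, fun _ => rfl⟩, fun _ => rfl, fun _ r => ⟨r, rfl⟩,
    fun w v => by rw [fderiv_fun_id]; rfl⟩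

theorem IsStrictDiffeo.comp {D D' : BigJet n → BigJet n} (hD : IsStrictDiffeo D)
    (hD' : IsStrictDiffeo D') : IsStrictDiffeo (fun w => D (D' w)) := by
  obtain ⟨E, hE, hED⟩ := hD.exists_leftInverse
  obtain ⟨E', hE', hED'⟩ := hD'.exists_leftInverse
  refine ⟨hD.contDiff.comp hD'.contDiff, ⟨_, hE'.comp hE, hED.comp hED'⟩,
    fun w => (hD.t_eq _).trans (hD'.t_eq w), fun w r => ?_, fun w v => ?_⟩
  · obtain ⟨r', h'⟩ := hD'.add_sVec w r
    rw [h']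
    exact hD.add_sVec _ r'
  · have h : fderiv ℝ (fun w => D (D' w)) w = (fderiv ℝ D (D' w)).comp (fderiv ℝ D' w) :=
      fderiv_comp w (hD.contDiff.differentiable (by simp) _)
        (hD'.contDiff.differentiable (by simp) _)
    rw [h, ContinuousLinearMap.comp_apply, hD.preserves, hD'.preserves]

/-- The smooth global left inverse of `D` gives both the topological embedding and the injectivity
of the differentials. -/
theorem IsStrictDiffeo.isThetaPContactEmbeddingOn {D : BigJet n → BigJet n}
    (hD : IsStrictDiffeo D) {U : Set (BigJet n)} (hU : IsOpen U) {C : BigJet n → BigJet n}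
    (hC : IsThetaPContactEmbeddingOn U C) :
    IsThetaPContactEmbeddingOn U (fun w => D (C w)) := by
  obtain ⟨E, hE, hED⟩ := hD.exists_leftInverse
  have hd : ∀ w, DifferentiableAt ℝ D w := fun w => hD.contDiff.differentiable (by simp) w
  have hc : ∀ w ∈ U, fderiv ℝ (fun w => D (C w)) w = (fderiv ℝ D (C w)).comp (fderiv ℝ C w) :=
    fun w hw => fderiv_comp w (hd _) ((hC.contDiffAt hU hw).differentiableAt (by simp))
  have hp : ∀ w ∈ U, ∀ v, canonicalForm (D (C w)) (fderiv ℝ (fun w => D (C w)) w v) =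
      canonicalForm w v := fun w hw v => by
    rw [hc w hw, ContinuousLinearMap.comp_apply, hD.preserves, hC.preserves w hw]
  have hinj : ∀ w, Function.Injective (fderiv ℝ D w) := fun w => by
    have h1 : (fderiv ℝ E (D w)).comp (fderiv ℝ D w) = ContinuousLinearMap.id ℝ _ := by
      rw [← fderiv_comp w (hE.differentiable (by simp) _) (hd w), hED.comp_eq_id, fderiv_id]
    exact Function.LeftInverse.injective (g := fderiv ℝ E (D w)) fun v =>
      DFunLike.congr_fun h1 v
  refine { contDiffOn := hD.contDiff.comp_contDiffOn hC.contDiffOn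
           injective_fderiv := fun w hw => ?_
           isEmbedding := ?_
           contact := fun w hw v => by rw [hp w hw v]
           hasPForm := ?_
           preserves := hp }
  · rw [hc w hw]
    exact (hinj _).comp (hC.injective_fderiv w hw)
  · exact (hED.isEmbedding hE.continuous hD.contDiff.continuous).comp hC.isEmbedding
  · obtain ⟨h1, h2⟩ := hasPForm_iff.1 hC.hasPForm
    refine hasPForm_iff.2 ⟨fun w hw => (hD.t_eq _).trans (h1 w hw), fun w hw r hr => ?_⟩
    obtain ⟨r', hr'⟩ := h2 w hw r hr
    rw [hr']
    exact hD.add_sVec _ r'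

/-- The direction of the shears along the levels of an affine function. -/
noncomputable def shearVec (c : AffineCoeff n) : BigJet n := sharp n (affineLin c)

/-- The flow of the contact Hamiltonian `(affineFun c) ^ (l + 1)`. -/
noncomputable def shear (l : ℕ) (c : AffineCoeff n) (ε : ℝ) (w : BigJet n) : BigJet n :=
  w + (ε * ((l + 1) * affineFun c w ^ l)) • shearVec c +
    (ε * (affineFun c w ^ (l + 1) +
        ((l + 1) * affineFun c w ^ l) * liouvilleForm n w (shearVec c)) +
      ε ^ 2 / 2 * ((l + 1) * affineFun c w ^ l) ^ 2 *
        liouvilleForm n (shearVec c) (shearVec c)) • zVec n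

theorem affineLin_coordVec_inr (c : AffineCoeff n) (j) : affineLin c (coordVec (.inr j)) = 0 := by
  rcases j with _ | _ <;> simp [affineLin_apply, coordVec, BigJet.t, BigJet.q, BigJet.p]

theorem affineLin_zVec (c : AffineCoeff n) : affineLin c (zVec n) = 0 :=
  affineLin_coordVec_inr c (.inl ())

theorem affineLin_sVec (c : AffineCoeff n) : affineLin c (sVec n) = 0 :=
  affineLin_coordVec_inr c (.inr ())

theorem omegaForm_shearVec (c : AffineCoeff n) (v : BigJet n) :
    omegaForm n (shearVec c) v = affineLin c v :=
  omegaForm_sharp _ (affineLin_coordVec_inr c) v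

theorem affineLin_shearVec (c : AffineCoeff n) : affineLin c (shearVec c) = 0 := by
  rw [← omegaForm_shearVec, omegaForm_apply, sub_self]

theorem zVec_liouvilleForm (v : BigJet n) : liouvilleForm n (zVec n) v = 0 := by
  simp [liouvilleForm_apply]

theorem sVec_liouvilleForm_shearVec (c : AffineCoeff n) :
    liouvilleForm n (sVec n) (shearVec c) = 0 := by
  simp [liouvilleForm_apply, shearVec, sharp_apply]

theorem affineFun_add (c : AffineCoeff n) (w v : BigJet n) :
    affineFun c (w + v) = affineFun c w + affineLin c v := by
  rw [affineFun_eq, affineFun_eq, map_add]; ring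

/-- Conservation of the Hamiltonian: `shearVec c` is tangent to the levels of `affineFun c` because
`ω` is alternating. So the velocity along `shearVec c` is constant on each orbit and the `z`
velocity is affine in time, whence the term `ε ^ 2 / 2` in `shear`. -/
theorem affineFun_shear (c : AffineCoeff n) (ε : ℝ) (w : BigJet n) :
    affineFun c (shear l c ε w) = affineFun c w := by
  rw [shear, affineFun_add, affineFun_add, map_smul, map_smul, affineLin_zVec, affineLin_shearVec]
  simp

theorem shear_neg_shear (c : AffineCoeff n) (ε : ℝ) (w : BigJet n) :
    shear l c (-ε) (shear l c ε w) = w := by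
  have h : liouvilleForm n (shear l c ε w) (shearVec c) = liouvilleForm n w (shearVec c) +
      (ε * ((l + 1) * affineFun c w ^ l)) * liouvilleForm n (shearVec c) (shearVec c) := by
    rw [shear, map_add, map_add, map_smul, map_smul, add_apply, add_apply, smul_apply, smul_apply,
      zVec_liouvilleForm]
    simp
  rw [shear, affineFun_shear, h]
  set x := affineFun c w
  rw [shear]
  module

theorem shear_add_sVec (c : AffineCoeff n) (ε : ℝ) (w : BigJet n) (r : ℝ) :
    shear l c ε (w + r • sVec n) = shear l c ε w + r • sVec n := by
  have h : liouvilleForm n (w + r • sVec n) (shearVec c) = liouvilleForm n w (shearVec c) := by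
    rw [map_add, map_smul, add_apply, smul_apply, sVec_liouvilleForm_shearVec]
    simp
  rw [shear, shear, affineFun_add, map_smul, affineLin_sVec, h, smul_zero, add_zero]
  module

theorem contDiff_shear (l : ℕ) (c : AffineCoeff n) :
    ContDiff ℝ ∞ (fun p : ℝ × BigJet n => shear l c p.1 p.2) := by
  have hm : ContDiff ℝ ∞ (fun p : ℝ × BigJet n => affineFun c p.2) :=
    (contDiff_affineFun c).comp contDiff_snd
  have hB : ContDiff ℝ ∞ (fun p : ℝ × BigJet n => liouvilleForm n p.2 (shearVec c)) :=
    ((liouvilleForm n).flip (shearVec c)).contDiff.comp contDiff_snd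
  unfold shear
  fun_prop

theorem fderiv_shear_right (c : AffineCoeff n) (ε : ℝ) (w v : BigJet n) :
    fderiv ℝ (shear l c ε) w v = v +
      (ε * ((l + 1) * (l * affineFun c w ^ (l - 1) * affineLin c v))) • shearVec c +
      (ε * ((l + 1) * affineFun c w ^ l * affineLin c v +
        ((l + 1) * affineFun c w ^ l * liouvilleForm n v (shearVec c) +
          (l + 1) * (l * affineFun c w ^ (l - 1) * affineLin c v) *
            liouvilleForm n w (shearVec c))) +
      ε ^ 2 / 2 * (2 * ((l + 1) * affineFun c w ^ l) *
        ((l + 1) * (l * affineFun c w ^ (l - 1) * affineLin c v))) *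
        liouvilleForm n (shearVec c) (shearVec c)) • zVec n := by
  have hm := hasFDerivAt_affineFun c w
  have hB : HasFDerivAt (fun w => liouvilleForm n w (shearVec c))
    ((liouvilleForm n).flip (shearVec c)) w := ((liouvilleForm n).flip (shearVec c)).hasFDerivAt
  have h1 := (hm.pow l).const_mul ((l : ℝ) + 1)
  have h2 := hm.pow (l + 1)
  have h3 := ((hasFDerivAt_id w).add ((h1.const_mul ε).smul_const (shearVec c))).add
    ((((h2.add (h1.mul hB)).const_mul ε).add
      (((h1.pow 2).const_mul (ε ^ 2 / 2)).mul_const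
        (liouvilleForm n (shearVec c) (shearVec c)))).smul_const (zVec n))
  have h4 : HasFDerivAt (shear l c ε) _ w := h3
  rw [h4.fderiv]
  simp
  ring_nf

theorem isStrictDiffeo_shear (c : AffineCoeff n) (ε : ℝ) : IsStrictDiffeo (shear l c ε) := by
  have hs : ∀ ε, ContDiff ℝ ∞ (shear l c ε) := fun ε =>
    (contDiff_shear l c).comp (contDiff_const.prodMk contDiff_id)
  refine ⟨hs ε, ⟨_, hs (-ε), shear_neg_shear c ε⟩, fun w => ?_,
    fun w r => ⟨r, shear_add_sVec c ε w r⟩, fun w v => ?_⟩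
  · simp [shear, shearVec, sharp_apply, BigJet.t]
  · have hz : zForm n (shearVec c) = 0 := by simp [zForm_apply, shearVec, sharp_apply, BigJet.z]
    have hzz : zForm n (zVec n) = 1 := by simp [zForm_apply, BigJet.z]
    -- Replacing the differential of the affine function by `ω(shearVec c, ·)` reduces the
    -- invariance of `Θ` to an identity between values of `liouvilleForm`.
    have hω := omegaForm_shearVec c v
    rw [omegaForm_apply] at hω
    rw [canonicalForm_eq, canonicalForm_eq, fderiv_shear_right, shear, ← hω]
    simp only [map_add, map_smul, add_apply, smul_apply, zVec_liouvilleForm, liouvilleForm_zVec,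
      hz, hzz, smul_eq_mul]
    ring

theorem shear_zero (c : AffineCoeff n) (w : BigJet n) : shear l c 0 w = w := by
  simp [shear]

theorem hamField_affineFun_pow (c : AffineCoeff n) (w : BigJet n) :
    hamField (fun w => affineFun c w ^ (l + 1)) w = ((l + 1) * affineFun c w ^ l) • shearVec c +
      (affineFun c w ^ (l + 1) +
        ((l + 1) * affineFun c w ^ l) * liouvilleForm n w (shearVec c)) • zVec n := by
  have h : sharp n (fderiv ℝ (fun w => affineFun c w ^ (l + 1)) w) =
      ((l + 1) * affineFun c w ^ l) • shearVec c := by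
    rw [((hasFDerivAt_affineFun c w).pow (l + 1)).fderiv]
    simp [shearVec]
  rw [hamField, h]
  simp

/-- At `ε = 0` the shear is the identity, and its velocity is the Hamiltonian field of the power. -/
theorem hasFDerivAt_shear (c : AffineCoeff n) (w : BigJet n) :
    HasFDerivAt (fun p : ℝ × BigJet n => shear l c p.1 p.2)
      (ContinuousLinearMap.snd ℝ ℝ (BigJet n) + (ContinuousLinearMap.fst ℝ ℝ (BigJet n)).smulRight
        (hamField (fun w => affineFun c w ^ (l + 1)) w)) (0, w) := by
  have hd : DifferentiableAt ℝ (fun p : ℝ × BigJet n => shear l c p.1 p.2) (0, w) :=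
    (contDiff_shear l c).differentiable (by simp) _
  convert! hd.hasFDerivAt using 1
  symm
  refine ContinuousLinearMap.ext fun p => ?_
  obtain ⟨ε, v⟩ := p
  have h1 : fderiv ℝ (fun p : ℝ × BigJet n => shear l c p.1 p.2) (0, w) (0, v) = v := by
    have := hd.hasFDerivAt.comp w (hasFDerivAt_prodMk_right (0 : ℝ) w)
    have h2 : (fun p : ℝ × BigJet n => shear l c p.1 p.2) ∘ (fun v => ((0 : ℝ), v)) =
      fun v => v := funext fun v => shear_zero c v
    rw [h2] at this
    exact DFunLike.congr_fun (this.unique (hasFDerivAt_id w)) v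
  have h3 : fderiv ℝ (fun p : ℝ × BigJet n => shear l c p.1 p.2) (0, w) (1, 0) =
      hamField (fun w => affineFun c w ^ (l + 1)) w := by
    have h4 : HasDerivAt (fun ε : ℝ => shear l c ε w)
        (fderiv ℝ (fun p : ℝ × BigJet n => shear l c p.1 p.2) (0, w) (1, 0)) 0 :=
      HasFDerivAt.comp_hasDerivAt (f := fun ε : ℝ => (ε, w)) (0 : ℝ) hd.hasFDerivAt
        ((hasDerivAt_id (0 : ℝ)).prodMk (hasDerivAt_const (0 : ℝ) w))
    have h5 : HasDerivAt (fun ε : ℝ => shear l c ε w)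
        (hamField (fun w => affineFun c w ^ (l + 1)) w) 0 := by
      rw [hamField_affineFun_pow]
      have e1 := (((hasDerivAt_id (0 : ℝ)).mul_const ((l + 1) * affineFun c w ^ l)).smul_const
        (shearVec c)).const_add w
      have e2 := (((hasDerivAt_id (0 : ℝ)).mul_const (affineFun c w ^ (l + 1) +
        ((l + 1) * affineFun c w ^ l) * liouvilleForm n w (shearVec c))).add
        (((((hasDerivAt_id (0 : ℝ)).pow 2).div_const 2).mul_const
          (((l + 1) * affineFun c w ^ l) ^ 2)).mul_const
          (liouvilleForm n (shearVec c) (shearVec c)))).smul_const (zVec n)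
      have e3 := e1.add e2
      simp only [id, one_mul, Nat.add_one_sub_one, pow_one, mul_zero, zero_mul, zero_div, add_zero] at e3
      exact e3
    exact h4.unique h5
  have h6 : ((ε, v) : ℝ × BigJet n) = ε • (1, 0) + (0, v) := by simp
  rw [h6, map_add, map_smul, h1, h3]
  simp [add_comm]

end Shears

/-! ### Space derivatives of a family, as functions of the parameter and the point -/

section Slices

open Filter

variable {E F Λ : Type} [NormedAddCommGroup E] [NormedSpace ℝ E] [NormedAddCommGroup F]
  [NormedSpace ℝ F] [NormedAddCommGroup Λ] [NormedSpace ℝ Λ] {f : Λ × E → F} {A : Set (Λ × E)}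

theorem HasFDerivAt.comp_right {M : Type} [NormedAddCommGroup M] [NormedSpace ℝ M]
    {T : Λ → M →L[ℝ] F} {T' : Λ →L[ℝ] M →L[ℝ] F} {p : Λ} (h : HasFDerivAt T T' p) (R : E →L[ℝ] M) :
    HasFDerivAt (fun p => (T p).comp R) (((ContinuousLinearMap.compL ℝ E M F).flip R).comp T') p :=
  HasFDerivAt.comp (g := (ContinuousLinearMap.compL ℝ E M F).flip R) p
    (ContinuousLinearMap.hasFDerivAt _) h

theorem HasFDerivAt.slice {p : Λ × E} {f' : Λ × E →L[ℝ] F} (h : HasFDerivAt f f' p) :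
    HasFDerivAt (fun x => f (p.1, x)) (f'.comp (ContinuousLinearMap.inr ℝ Λ E)) p.2 :=
  HasFDerivAt.comp (g := f) p.2 h (hasFDerivAt_prodMk_right p.1 p.2)

theorem eventuallyEq_iteratedFDeriv_slice_succ (hA : IsOpen A) (k : ℕ)
    (hk : ∀ p ∈ A, ContDiffAt ℝ ∞ (fun p : Λ × E => iteratedFDeriv ℝ k (fun x => f (p.1, x)) p.2) p)
    {p : Λ × E} (hp : p ∈ A) :
    (fun p : Λ × E => iteratedFDeriv ℝ (k + 1) (fun x => f (p.1, x)) p.2) =ᶠ[𝓝 p] fun p =>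
      (continuousMultilinearCurryLeftEquiv ℝ (fun _ : Fin (k + 1) => E) F).symm
        ((fderiv ℝ (fun p : Λ × E => iteratedFDeriv ℝ k (fun x => f (p.1, x)) p.2) p).comp
          (ContinuousLinearMap.inr ℝ Λ E)) := by
  filter_upwards [hA.mem_nhds hp] with q hq
  have h1 := (((hk q hq).differentiableAt (by simp)).hasFDerivAt).slice
  rw [iteratedFDeriv_succ_eq_comp_left]
  exact congrArg _ h1.fderiv

/-- Differentiating a slice amounts to restricting the total differential to the space directions,
so joint smoothness passes from each order to the next. -/
theorem contDiffAt_iteratedFDeriv_slice (hA : IsOpen A) (cf : ∀ p ∈ A, ContDiffAt ℝ ∞ f p) (k : ℕ) :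
    ∀ p ∈ A, ContDiffAt ℝ ∞ (fun p : Λ × E => iteratedFDeriv ℝ k (fun x => f (p.1, x)) p.2) p := by
  induction k with
  | zero =>
    intro p hp
    exact ((continuousMultilinearCurryFin0 ℝ E F).symm.contDiff.contDiffAt).comp p (cf p hp)
  | succ k ih =>
    intro p hp
    refine ContDiffAt.congr_of_eventuallyEq ?_ (eventuallyEq_iteratedFDeriv_slice_succ hA k ih hp)
    exact ((continuousMultilinearCurryLeftEquiv ℝ (fun _ : Fin (k + 1) =>
      E) F).symm.contDiff.contDiffAt).comp p ((ih p hp).fderiv_infty.clm_comp contDiffAt_const)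

/-- The velocity of a jet is the jet of the velocity: one exchange of derivatives per order, by
symmetry of the second derivative. -/
theorem fderiv_iteratedFDeriv_slice (hA : IsOpen A) (cf : ∀ p ∈ A, ContDiffAt ℝ ∞ f p) (a : Λ)
    (k : ℕ) : ∀ p ∈ A,
      fderiv ℝ (fun p : Λ × E => iteratedFDeriv ℝ k (fun x => f (p.1, x)) p.2) p (a, 0) =
      iteratedFDeriv ℝ k (fun x => fderiv ℝ f (p.1, x) (a, 0)) p.2 := by
  induction k with
  | zero =>
    intro p hp
    have h := ((continuousMultilinearCurryFin0 ℝ E F).symm.toContinuousLinearEquiv.hasFDerivAt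
      (x := f p)).comp p ((cf p hp).differentiableAt (by simp)).hasFDerivAt
    exact DFunLike.congr_fun h.fderiv (a, 0)
  | succ k ih =>
    intro p hp
    have cg := contDiffAt_iteratedFDeriv_slice hA cf k
    rw [(eventuallyEq_iteratedFDeriv_slice_succ hA k cg hp).fderiv_eq]
    set g : Λ × E → ContinuousMultilinearMap ℝ (fun _ : Fin k => E) F :=
      fun p => iteratedFDeriv ℝ k (fun x => f (p.1, x)) p.2 with hg
    have hd : HasFDerivAt (fderiv ℝ g) (fderiv ℝ (fderiv ℝ g) p) p :=
      (((cg p hp).fderiv_infty).differentiableAt (by simp)).hasFDerivAt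
    have e1 := hd.comp_right (ContinuousLinearMap.inr ℝ Λ E)
    have e2 := ((continuousMultilinearCurryLeftEquiv ℝ (fun _ : Fin (k + 1) =>
      E) F).symm.toContinuousLinearEquiv.hasFDerivAt
      (x := (fderiv ℝ g p).comp (ContinuousLinearMap.inr ℝ Λ E))).comp p e1
    refine (DFunLike.congr_fun e2.fderiv (a, 0)).trans ?_
    rw [iteratedFDeriv_succ_eq_comp_left]
    refine congrArg (continuousMultilinearCurryLeftEquiv ℝ (fun _ : Fin (k + 1) => E) F).symm ?_
    have hslice : Tendsto (fun x : E => (p.1, x)) (𝓝 p.2) (𝓝 p) := by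
      have : ContinuousAt (fun x : E => (p.1, x)) p.2 := by fun_prop
      exact this
    have e3 : iteratedFDeriv ℝ k (fun x => fderiv ℝ f (p.1, x) (a, 0)) =ᶠ[𝓝 p.2]
        fun x => fderiv ℝ g (p.1, x) (a, 0) := by
      filter_upwards [hslice.eventually (hA.mem_nhds hp)] with x hx
      exact (ih _ hx).symm
    rw [e3.fderiv_eq]
    have e4 : HasFDerivAt (fun x => fderiv ℝ g (p.1, x) (a, 0))
        ((ContinuousLinearMap.apply ℝ _ (a, (0 : E))).comp
          ((fderiv ℝ (fderiv ℝ g) p).comp (ContinuousLinearMap.inr ℝ Λ E))) p.2 :=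
      HasFDerivAt.comp (g := ContinuousLinearMap.apply ℝ _ (a, (0 : E)))
        (f := fun x => fderiv ℝ g (p.1, x)) p.2 (ContinuousLinearMap.hasFDerivAt _)
        (HasFDerivAt.slice (f := fderiv ℝ g) hd)
    rw [e4.fderiv]
    have hs : IsSymmSndFDerivAt ℝ g p := ((cg p hp).nat_of_infty 2).isSymmSndFDerivAt (by simp)
    refine ContinuousLinearMap.ext fun x => ?_
    exact hs (a, 0) (0, x)

end Slices

/-! ### A finite-dimensional family of deformations -/

section Family

open Filter

variable {n l r : ℕ}

/-- The powers of the affine functions `c i` form a basis of the polynomials of degree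
`≤ l + 1`. -/
structure IsGenerating (l : ℕ) (c : Fin r → AffineCoeff n) : Prop where
  linearIndependent : LinearIndependent ℝ fun (i : Fin r) w => affineFun (c i) w ^ (l + 1)
  span_eq : Submodule.span ℝ (range fun (i : Fin r) w => affineFun (c i) w ^ (l + 1)) =
    hamiltonians n (l + 1)

theorem exists_isGenerating (n l : ℕ) : ∃ (r : ℕ) (c : Fin r → AffineCoeff n), IsGenerating l c := by
  have : Module.Finite ℝ (Submodule.span ℝ (range fun (c : AffineCoeff n) (w : BigJet n) =>
    affineFun c w ^ (l + 1))) := hamiltonians.finiteDimensional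
  obtain ⟨f, hf, hs, hi⟩ := Submodule.exists_fun_fin_finrank_span_eq ℝ
    (range fun (c : AffineCoeff n) (w : BigJet n) => affineFun c w ^ (l + 1))
  choose c hc using hf
  have : f = fun i w => affineFun (c i) w ^ (l + 1) := funext fun i => (hc i).symm
  subst this
  exact ⟨_, c, hi, hs⟩

/-- The polynomial with coordinates `a`. -/
def genHam (l : ℕ) (c : Fin r → AffineCoeff n) (a : Fin r → ℝ) (w : BigJet n) : ℝ :=
  ∑ i, a i * affineFun (c i) w ^ (l + 1)

theorem genHam_eq (c : Fin r → AffineCoeff n) (a : Fin r → ℝ) :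
    genHam l c a = ∑ i, a i • fun w => affineFun (c i) w ^ (l + 1) := by
  funext w
  simp [genHam, Finset.sum_apply]

theorem genHam_mem (c : Fin r → AffineCoeff n) (a : Fin r → ℝ) :
    genHam l c a ∈ hamiltonians n (l + 1) := by
  rw [genHam_eq]
  exact Submodule.sum_mem _ fun i _ => Submodule.smul_mem _ _ (Submodule.subset_span ⟨c i, rfl⟩)

theorem IsGenerating.exists_genHam {c : Fin r → AffineCoeff n} (hc : IsGenerating l c)
    {h : BigJet n → ℝ} (hh : h ∈ hamiltonians n (l + 1)) : ∃ a, h = genHam l c a := by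
  rw [← hc.span_eq, Submodule.mem_span_range_iff_exists_fun] at hh
  obtain ⟨a, ha⟩ := hh
  exact ⟨a, by rw [genHam_eq, ha]⟩

theorem IsGenerating.eq_zero_of_genHam {c : Fin r → AffineCoeff n} (hc : IsGenerating l c)
    {a : Fin r → ℝ} (ha : genHam l c a = 0) : a = 0 := by
  rw [genHam_eq] at ha
  exact funext (Fintype.linearIndependent_iff.1 hc.linearIndependent a ha)

theorem hamField_genHam (c : Fin r → AffineCoeff n) (a : Fin r → ℝ) (w : BigJet n) :
    hamField (genHam l c a) w =
      ∑ i, a i • hamField (fun w => affineFun (c i) w ^ (l + 1)) w := by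
  have h : HasFDerivAt (genHam l c a)
      (∑ i, a i • fderiv ℝ (fun w => affineFun (c i) w ^ (l + 1)) w) w := by
    refine HasFDerivAt.fun_sum fun i _ => ?_
    exact ((((contDiff_affineFun (c i)).pow (l + 1)).differentiable (by simp)
      w).hasFDerivAt).const_mul (a i)
  simp only [hamField, h.fderiv, map_sum, map_smul, genHam, smul_add, Finset.sum_add_distrib,
    smul_smul, ← Finset.sum_smul, smul_eq_mul, mul_add]

/-- The composite of the shears of parameters `a i`, for `i` in a list. -/
noncomputable def shearComp (l : ℕ) (c : Fin r → AffineCoeff n) :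
    List (Fin r) → (Fin r → ℝ) → BigJet n → BigJet n
  | [], _, w => w
  | i :: L, a, w => shear l (c i) (a i) (shearComp l c L a w)

theorem isStrictDiffeo_shearComp (c : Fin r → AffineCoeff n) (L : List (Fin r)) (a : Fin r → ℝ) :
    IsStrictDiffeo (shearComp l c L a) := by
  induction L with
  | nil => exact IsStrictDiffeo.id
  | cons i L ih => exact (isStrictDiffeo_shear (c i) (a i)).comp ih

theorem contDiff_shearComp (l : ℕ) (c : Fin r → AffineCoeff n) (L : List (Fin r)) :
    ContDiff ℝ ∞ (fun p : (Fin r → ℝ) × BigJet n => shearComp l c L p.1 p.2) := by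
  induction L with
  | nil => exact contDiff_snd
  | cons i L ih =>
    exact (contDiff_shear l (c i)).comp (((contDiff_apply ℝ ℝ i).comp contDiff_fst).prodMk ih)

theorem shearComp_zero (c : Fin r → AffineCoeff n) (L : List (Fin r)) (w : BigJet n) :
    shearComp l c L 0 w = w := by
  induction L with
  | nil => rfl
  | cons i L ih => rw [shearComp, ih, Pi.zero_apply, shear_zero]

/-- At `a = 0` every factor is the identity, so the velocities of the factors add up, whatever their
order. -/
theorem fderiv_shearComp (c : Fin r → AffineCoeff n) (L : List (Fin r)) (w : BigJet n)
    (a : Fin r → ℝ) (v : BigJet n) :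
    fderiv ℝ (fun p : (Fin r → ℝ) × BigJet n => shearComp l c L p.1 p.2) (0, w) (a, v) =
      v + (L.map fun i => a i • hamField (fun w => affineFun (c i) w ^ (l + 1)) w).sum := by
  induction L with
  | nil =>
    have : HasFDerivAt (fun p : (Fin r → ℝ) × BigJet n => shearComp l c [] p.1 p.2)
      (ContinuousLinearMap.snd ℝ _ _) (0, w) := hasFDerivAt_snd
    rw [this.fderiv]
    simp
  | cons i L ih =>
    have h1 : HasFDerivAt (fun p : (Fin r → ℝ) × BigJet n => p.1 i)
        ((ContinuousLinearMap.proj i).comp (ContinuousLinearMap.fst ℝ (Fin r → ℝ) (BigJet n)))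
        (0, w) :=
      ((ContinuousLinearMap.proj (R := ℝ) (φ := fun _ : Fin r => ℝ) i).comp
        (ContinuousLinearMap.fst ℝ (Fin r → ℝ) (BigJet n))).hasFDerivAt
    have h2 := ((contDiff_shearComp l c L).differentiable (by simp) (0, w)).hasFDerivAt
    have h3 := hasFDerivAt_shear (l := l) (c i) w
    have e : (((0 : Fin r → ℝ) i, shearComp l c L 0 w) : ℝ × BigJet n) = (0, w) := by
      rw [shearComp_zero]; rfl
    rw [← e] at h3
    have h4 := HasFDerivAt.comp (g := fun p : ℝ × BigJet n => shear l (c i) p.1 p.2)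
      ((0 : Fin r → ℝ), w) h3 (h1.prodMk h2)
    have h5 : HasFDerivAt (fun p : (Fin r → ℝ) × BigJet n => shearComp l c (i :: L) p.1 p.2) _
      (0, w) := h4
    rw [h5.fderiv]
    simp [ih]
    abel

/-- The family of diffeomorphisms generated by the basis of Hamiltonians. -/
noncomputable def shearFamily (l : ℕ) (c : Fin r → AffineCoeff n) (a : Fin r → ℝ)
    (w : BigJet n) : BigJet n :=
  shearComp l c (List.finRange r) a w

theorem isStrictDiffeo_shearFamily (c : Fin r → AffineCoeff n) (a : Fin r → ℝ) :
    IsStrictDiffeo (shearFamily l c a) := isStrictDiffeo_shearComp c _ a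

theorem contDiff_shearFamily (l : ℕ) (c : Fin r → AffineCoeff n) :
    ContDiff ℝ ∞ (fun p : (Fin r → ℝ) × BigJet n => shearFamily l c p.1 p.2) :=
  contDiff_shearComp l c _

theorem shearFamily_zero (c : Fin r → AffineCoeff n) (w : BigJet n) : shearFamily l c 0 w = w :=
  shearComp_zero c _ w

theorem fderiv_shearFamily (c : Fin r → AffineCoeff n) (w : BigJet n)
    (a : Fin r → ℝ) (v : BigJet n) :
    fderiv ℝ (fun p : (Fin r → ℝ) × BigJet n => shearFamily l c p.1 p.2) (0, w) (a, v) =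
      v + hamField (genHam l c a) w := by
  have := fderiv_shearComp (l := l) c (List.finRange r) w a v
  rw [← Fin.sum_univ_def] at this
  rw [hamField_genHam]
  exact this

end Family

/-! ### The jets of the deformations: an immersion that captures all tangent vectors -/

section JetFamily

open Filter

variable {n l r : ℕ} {U : Set (BigJet n)} {C : BigJet n → BigJet n} {c : Fin r → AffineCoeff n}

/-- The jets of the deformations of `C` by the shear family. -/
noncomputable def jetFamily (l : ℕ) (c : Fin r → AffineCoeff n) (C : BigJet n → BigJet n)
    (p : (Fin r → ℝ) × BigJet n) : JetSpace n l :=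
  jet l (fun x => shearFamily l c p.1 (C x)) p.2

theorem jetFamily_zero (w : BigJet n) : jetFamily l c C (0, w) = jet l C w := by
  simp only [jetFamily, shearFamily_zero]

theorem contDiffAt_shearFamily_comp (hU : IsOpen U) (hC : IsThetaPContactEmbeddingOn U C)
    {p : (Fin r → ℝ) × BigJet n} (hp : p.2 ∈ U) :
    ContDiffAt ℝ ∞ (fun p : (Fin r → ℝ) × BigJet n => shearFamily l c p.1 (C p.2)) p :=
  ContDiffAt.comp (g := fun p : (Fin r → ℝ) × BigJet n => shearFamily l c p.1 p.2)
    (f := fun p : (Fin r → ℝ) × BigJet n => (p.1, C p.2)) p (contDiff_shearFamily l c).contDiffAt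
    (contDiffAt_fst.prodMk ((hC.contDiffAt hU hp).comp p contDiffAt_snd))

theorem contDiffAt_iteratedFDeriv_shearFamily_comp (hU : IsOpen U)
    (hC : IsThetaPContactEmbeddingOn U C) (k : ℕ) {p : (Fin r → ℝ) × BigJet n} (hp : p.2 ∈ U) :
    ContDiffAt ℝ ∞ (fun p : (Fin r → ℝ) × BigJet n =>
      iteratedFDeriv ℝ k (fun x => shearFamily l c p.1 (C x)) p.2) p :=
  contDiffAt_iteratedFDeriv_slice (A := Prod.snd ⁻¹' U)
    (f := fun p : (Fin r → ℝ) × BigJet n => shearFamily l c p.1 (C p.2))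
    (hU.preimage continuous_snd) (fun _ hq => contDiffAt_shearFamily_comp hU hC hq) k p hp

theorem contDiffAt_jetFamily (hU : IsOpen U) (hC : IsThetaPContactEmbeddingOn U C)
    {p : (Fin r → ℝ) × BigJet n} (hp : p.2 ∈ U) : ContDiffAt ℝ ∞ (jetFamily l c C) p :=
  contDiffAt_snd.prodMk (contDiffAt_pi.2 fun k =>
    contDiffAt_iteratedFDeriv_shearFamily_comp hU hC k hp)

theorem hasFDerivAt_jetFamily (hU : IsOpen U) (hC : IsThetaPContactEmbeddingOn U C)
    {p : (Fin r → ℝ) × BigJet n} (hp : p.2 ∈ U) :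
    HasFDerivAt (jetFamily l c C) (fderiv ℝ (jetFamily l c C) p) p :=
  ((contDiffAt_jetFamily hU hC hp).differentiableAt (by simp)).hasFDerivAt

theorem fderiv_jetFamily_right (hU : IsOpen U) (hC : IsThetaPContactEmbeddingOn U C)
    {p : (Fin r → ℝ) × BigJet n} (hp : p.2 ∈ U) (x : BigJet n) :
    fderiv ℝ (jetFamily l c C) p (0, x) =
      fderiv ℝ (jet l fun x => shearFamily l c p.1 (C x)) p.2 x := by
  have h := (hasFDerivAt_jetFamily (l := l) (c := c) hU hC hp).slice
  have h2 : HasFDerivAt (jet l fun x => shearFamily l c p.1 (C x)) _ p.2 := h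
  rw [h2.fderiv]
  rfl

theorem fderiv_jetFamily_left (hU : IsOpen U) (hC : IsThetaPContactEmbeddingOn U C)
    {w : BigJet n} (hw : w ∈ U) (a : Fin r → ℝ) :
    fderiv ℝ (jetFamily l c C) (0, w) (a, 0) = hamJet l C w (genHam l c a) := by
  have h : HasFDerivAt (jetFamily l c C) ((ContinuousLinearMap.snd ℝ (Fin r → ℝ) (BigJet n)).prod
      (ContinuousLinearMap.pi fun k : Fin (l + 1) =>
        fderiv ℝ (fun p : (Fin r → ℝ) × BigJet n =>
          iteratedFDeriv ℝ (k : ℕ) (fun x => shearFamily l c p.1 (C x)) p.2) (0, w))) (0, w) :=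
    hasFDerivAt_snd.prodMk (hasFDerivAt_pi.2 fun k =>
      ((contDiffAt_iteratedFDeriv_shearFamily_comp (l := l) (c := c) (p := (0, w)) hU hC k
        hw).differentiableAt (by simp)).hasFDerivAt)
  rw [h.fderiv]
  refine Prod.ext rfl (funext fun k => ?_)
  refine (fderiv_iteratedFDeriv_slice (A := Prod.snd ⁻¹' U)
    (f := fun p : (Fin r → ℝ) × BigJet n => shearFamily l c p.1 (C p.2))
    (hU.preimage continuous_snd) (fun _ hq => contDiffAt_shearFamily_comp hU hC hq) a k (0, w)
    hw).trans ?_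
  refine Filter.EventuallyEq.eq_of_nhds (Filter.EventuallyEq.iteratedFDeriv ℝ ?_ k)
  filter_upwards [hU.mem_nhds hw] with x hx
  have h1 : HasFDerivAt (fun p : (Fin r → ℝ) × BigJet n => (p.1, C p.2))
      ((ContinuousLinearMap.fst ℝ (Fin r → ℝ) (BigJet n)).prod
        ((fderiv ℝ C x).comp (ContinuousLinearMap.snd ℝ (Fin r → ℝ) (BigJet n)))) (0, x) :=
    hasFDerivAt_fst.prodMk (HasFDerivAt.comp (g := C) ((0 : Fin r → ℝ), x)
      (((hC.contDiffAt hU hx).differentiableAt (by simp)).hasFDerivAt) hasFDerivAt_snd)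
  have h2 := ((contDiff_shearFamily l c).differentiable (by simp) (0, C x)).hasFDerivAt
  have h3 := HasFDerivAt.comp (g := fun p : (Fin r → ℝ) × BigJet n => shearFamily l c p.1 p.2)
    ((0 : Fin r → ℝ), x) h2 h1
  have h4 : HasFDerivAt (fun p : (Fin r → ℝ) × BigJet n => shearFamily l c p.1 (C p.2)) _
    (0, x) := h3
  rw [h4.fderiv]
  have := fderiv_shearFamily (l := l) c (C x) a 0
  simpa using this

theorem fderiv_jetFamily_zero (hU : IsOpen U) (hC : IsThetaPContactEmbeddingOn U C)
    {w : BigJet n} (hw : w ∈ U) (a : Fin r → ℝ) (x : BigJet n) :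
    fderiv ℝ (jetFamily l c C) (0, w) (a, x) =
      fderiv ℝ (jet l C) w x + hamJet l C w (genHam l c a) := by
  have h : ((a, x) : (Fin r → ℝ) × BigJet n) = (0, x) + (a, 0) := by simp
  rw [h, map_add, fderiv_jetFamily_left hU hC hw, fderiv_jetFamily_right hU hC hw]
  simp only [shearFamily_zero]

theorem omegaForm_hamField {h : BigJet n → ℝ} (hh : h ∈ hamiltonians n (l + 1)) (y v : BigJet n) :
    omegaForm n (hamField h y) v = fderiv ℝ h y v := by
  rw [hamField, map_add, map_smul, add_apply, smul_apply, omegaForm_zVec, smul_zero, add_zero]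
  refine omegaForm_sharp _ (fun j => ?_) v
  induction hh using Submodule.span_induction with
  | mem x hx =>
    obtain ⟨c, rfl⟩ := hx
    rw [((hasFDerivAt_affineFun c y).pow (l + 1)).fderiv]
    simp [affineLin_coordVec_inr]
  | zero => simp
  | add x z hx' hz' hx hz =>
    rw [fderiv_add ((contDiff_of_mem_hamiltonians hx').differentiable (by simp) y)
      ((contDiff_of_mem_hamiltonians hz').differentiable (by simp) y)]
    rw [add_apply, hx, hz, add_zero]
  | smul a x hx' hx =>
    rw [fderiv_const_smul ((contDiff_of_mem_hamiltonians hx').differentiable (by simp) y)]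
    rw [smul_apply, hx, smul_zero]

/-- The Hamiltonian field vanishes to order `l + 1` at `C w`, after composing with a local inverse
of `C`. So do `dh = ω(X, ·)` and, at the point itself, `h`; a polynomial of degree `≤ l + 1`
vanishing to order `l + 2` is zero. -/
theorem eq_zero_of_hamJet_eq_zero (hU : IsOpen U) (hC : IsThetaPContactEmbeddingOn U C)
    {w : BigJet n} (hw : w ∈ U) {h : BigJet n → ℝ} (hh : h ∈ hamiltonians n (l + 1))
    (h0 : hamJet l C w h = 0) : h = 0 := by
  have ch := contDiff_of_mem_hamiltonians hh
  have hv : VanishesTo (l + 1) (fun x => hamField h (C x)) w := fun k hk =>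
    congrFun (congrArg Prod.snd h0) ⟨k, hk⟩
  obtain ⟨G, cG, hGC, hCG⟩ := exists_local_inverse (C := C) (w := w) (by
    filter_upwards [hU.mem_nhds hw] with x hx using hC.contDiffAt hU hx) (by
    filter_upwards [hU.mem_nhds hw] with x hx using hC.injective_fderiv x hx)
  have hGw : G (C w) = w := hGC.self_of_nhds
  have cX : ContDiffAt ℝ ∞ (hamField h) (C w) := contDiffAt_hamField ch.contDiffAt
  have hX : VanishesTo (l + 1) (hamField h) (C w) := by
    have h1 : VanishesTo (l + 1) (fun x => hamField h (C x)) (G (C w)) := by rwa [hGw]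
    refine (VanishesTo.comp h1 ?_ cG.self_of_nhds).congr ?_
    · rw [hGw]
      exact cX.comp w (hC.contDiffAt hU hw)
    · filter_upwards [hCG] with y hy
      rw [hy]
  have hd : VanishesTo (l + 1) (fderiv ℝ h) (C w) := by
    refine VanishesTo.of_forall_apply ch.contDiffAt.fderiv_infty fun v => ?_
    refine (hX.clm_comp ((omegaForm n).flip v) cX).congr (Eventually.of_forall fun y => ?_)
    exact omegaForm_hamField hh y v
  have hy : h (C w) = 0 := by
    have h1 := hX.eq_zero
    rw [hamField, hd.eq_zero, map_zero, map_zero, zero_add, add_zero] at h1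
    simpa using h1
  exact eq_zero_of_mem_hamiltonians hh (VanishesTo.of_fderiv hd hy)

theorem IsGenerating.injective_fderiv_jetFamily (hc : IsGenerating l c) (hU : IsOpen U)
    (hC : IsThetaPContactEmbeddingOn U C) {w : BigJet n} (hw : w ∈ U) :
    Function.Injective (fderiv ℝ (jetFamily l c C) (0, w)) := by
  refine (injective_iff_map_eq_zero _).2 ?_
  rintro ⟨a, x⟩ h
  rw [fderiv_jetFamily_zero hU hC hw] at h
  have hx : x = 0 := by
    have h1 := congrArg Prod.fst h
    rw [(hasFDerivAt_jet (hC.contDiffAt hU hw)).fderiv] at h1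
    simpa [hamJet] using h1
  subst hx
  rw [map_zero, zero_add] at h
  rw [hc.eq_zero_of_genHam (eq_zero_of_hamJet_eq_zero hU hC hw (genHam_mem c a) h)]
  rfl

theorem IsGenerating.tangentVectors_subset (hc : IsGenerating l c) (hU : IsOpen U)
    (hC : IsThetaPContactEmbeddingOn U C) {w : BigJet n} (hw : w ∈ U) :
    tangentVectors (thetaPContactJets l U) (jet l C w) ⊆
      (fderiv ℝ (jetFamily l c C) (0, w)).range := by
  intro v hv
  obtain ⟨x, h, hh, rfl⟩ := exists_of_mem_tangentVectors hU hC hw hv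
  obtain ⟨a, rfl⟩ := hc.exists_genHam hh
  exact ⟨(a, x), fderiv_jetFamily_zero hU hC hw a x⟩

/-- Segments in the space of parameters and points are sent to smooth curves of jets, since each
deformation of `C` is again an embedding of the required kind. -/
theorem fderiv_jetFamily_mem_tangentVectors (hU : IsOpen U) (hC : IsThetaPContactEmbeddingOn U C)
    {p : (Fin r → ℝ) × BigJet n} (hp : p.2 ∈ U) (v : (Fin r → ℝ) × BigJet n) :
    fderiv ℝ (jetFamily l c C) p v ∈
      tangentVectors (thetaPContactJets l U) (jetFamily l c C p) := by
  have hcont : Continuous fun τ : ℝ => p + τ • v := by fun_prop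
  have hmem : ∀ᶠ τ in 𝓝 (0 : ℝ), (p + τ • v).2 ∈ U := by
    have h1 : (fun τ : ℝ => p + τ • v) ⁻¹' (Prod.snd ⁻¹' U) ∈ 𝓝 (0 : ℝ) :=
      ((hU.preimage continuous_snd).preimage hcont).mem_nhds (by simpa using hp)
    exact h1
  obtain ⟨ε, hε, hball⟩ := Metric.eventually_nhds_iff.1 hmem
  have hI : ∀ τ ∈ Ioo (-ε) ε, (p + τ • v).2 ∈ U := fun τ hτ => hball (by
    rw [Real.dist_eq, sub_zero, abs_lt]; exact hτ)
  refine ⟨ε, fun τ => jetFamily l c C (p + τ • v), hε, fun τ hτ => ?_, fun τ hτ => ?_, by simp, ?_⟩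
  · refine ContDiffAt.contDiffWithinAt ?_
    exact ContDiffAt.comp (g := jetFamily l c C) τ (contDiffAt_jetFamily hU hC (hI τ hτ))
      (contDiffAt_const.add (contDiffAt_id.smul contDiffAt_const))
  · exact ⟨_, hI τ hτ, U, hU, hI τ hτ, Subset.rfl, _,
      (isStrictDiffeo_shearFamily c _).isThetaPContactEmbeddingOn hU hC, rfl⟩
  · have h1 : HasDerivAt (fun τ : ℝ => p + τ • v) v 0 := by
      simpa using ((hasDerivAt_id (0 : ℝ)).smul_const v).const_add p
    exact HasFDerivAt.comp_hasDerivAt_of_eq (0 : ℝ) (hasFDerivAt_jetFamily hU hC hp) h1 (by simp)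

/-- The tangent space of the space of jets along the deformations of `C`. -/
theorem IsGenerating.tangentVectors_jetFamily_subset (hc : IsGenerating l c) (hU : IsOpen U)
    (hC : IsThetaPContactEmbeddingOn U C) {p : (Fin r → ℝ) × BigJet n} (hp : p.2 ∈ U)
    (hinj : Function.Injective (fderiv ℝ (jetFamily l c C) p)) :
    tangentVectors (thetaPContactJets l U) (jetFamily l c C p) ⊆
      (fderiv ℝ (jetFamily l c C) p).range := by
  have hC' := (isStrictDiffeo_shearFamily (l := l) c p.1).isThetaPContactEmbeddingOn hU hC
  have h1 := hc.tangentVectors_subset hU hC' hp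
  -- The deformed embedding has its own shear family, whose differential at parameter `0` already
  -- contains all tangent vectors at this jet, including those produced by the original family at
  -- `p`.
  have h2 : (fderiv ℝ (jetFamily l c C) p).range ≤
      (fderiv ℝ (jetFamily l c fun x => shearFamily l c p.1 (C x)) (0, p.2)).range := by
    rintro _ ⟨v, rfl⟩
    exact h1 (fderiv_jetFamily_mem_tangentVectors hU hC hp v)
  -- The smaller range has the full dimension of the source because `dΨ` is injective at `p`, so the
  -- two ranges coincide.
  have h3 := Submodule.eq_of_le_of_finrank_le h2 (by
    rw [LinearMap.finrank_range_of_inj hinj]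
    exact LinearMap.finrank_range_le _)
  rw [h3]
  exact h1

end JetFamily

/-! ### Straightened submanifolds and parametric transversality -/

section Charts

open Filter

variable {V : Type} [NormedAddCommGroup V] [NormedSpace ℝ V] {S : Set V}

/-- `φ` straightens `S` to the linear subspace `L`. -/
structure IsStraightening (S : Set V) (φ : OpenPartialHomeomorph V V) (L : Submodule ℝ V) :
    Prop where
  contDiffOn : ContDiffOn ℝ ∞ φ φ.source
  contDiffOn_symm : ContDiffOn ℝ ∞ φ.symm φ.target
  mem_iff : ∀ y ∈ φ.source, y ∈ S ↔ φ y ∈ L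

namespace IsStraightening

variable {φ : OpenPartialHomeomorph V V} {L : Submodule ℝ V} {y : V}

theorem contDiffAt (h : IsStraightening S φ L) (hy : y ∈ φ.source) : ContDiffAt ℝ ∞ φ y :=
  h.contDiffOn.contDiffAt (φ.open_source.mem_nhds hy)

theorem contDiffAt_symm (h : IsStraightening S φ L) (hy : y ∈ φ.target) :
    ContDiffAt ℝ ∞ φ.symm y :=
  h.contDiffOn_symm.contDiffAt (φ.open_target.mem_nhds hy)

theorem fderiv_symm_mem_tangentVectors (h : IsStraightening S φ L) (hy : y ∈ φ.source)
    (hyS : y ∈ S) {v : V} (hv : v ∈ L) : fderiv ℝ φ.symm (φ y) v ∈ tangentVectors S y := by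
  have hcont : Continuous fun τ : ℝ => φ y + τ • v := by fun_prop
  have hmem : ∀ᶠ τ in 𝓝 (0 : ℝ), φ y + τ • v ∈ φ.target :=
    (φ.open_target.preimage hcont).mem_nhds (by simpa using φ.map_source hy)
  obtain ⟨ε, hε, hball⟩ := Metric.eventually_nhds_iff.1 hmem
  have hI : ∀ τ ∈ Ioo (-ε) ε, φ y + τ • v ∈ φ.target := fun τ hτ => hball (by
    rw [Real.dist_eq, sub_zero, abs_lt]; exact hτ)
  refine ⟨ε, fun τ => φ.symm (φ y + τ • v), hε, fun τ hτ => ?_, fun τ hτ => ?_,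
    by simp [φ.left_inv hy], ?_⟩
  · refine ContDiffAt.contDiffWithinAt ?_
    exact ContDiffAt.comp (g := φ.symm) τ (h.contDiffAt_symm (hI τ hτ))
      (contDiffAt_const.add (contDiffAt_id.smul contDiffAt_const))
  · refine (h.mem_iff _ (φ.map_target (hI τ hτ))).2 ?_
    rw [φ.right_inv (hI τ hτ)]
    exact L.add_mem ((h.mem_iff y hy).1 hyS) (L.smul_mem τ hv)
  · have h1 : HasDerivAt (fun τ : ℝ => φ y + τ • v) v 0 := by
      simpa using ((hasDerivAt_id (0 : ℝ)).smul_const v).const_add (φ y)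
    exact HasFDerivAt.comp_hasDerivAt_of_eq (0 : ℝ)
      (((h.contDiffAt_symm (φ.map_source hy)).differentiableAt (by simp)).hasFDerivAt) h1 (by simp)

/-- A curve in `S`, read in the chart, stays in `L`; its velocity is a limit of difference quotients
in the closed subspace `L`. -/
theorem exists_of_mem_tangentVectors [FiniteDimensional ℝ V] (h : IsStraightening S φ L)
    (hy : y ∈ φ.source) {u : V} (hu : u ∈ tangentVectors S y) :
    ∃ v ∈ L, u = fderiv ℝ φ.symm (φ y) v := by
  obtain ⟨ε, γ, hε, cγ, hγS, hγ0, hγ⟩ := hu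
  have hIoo : Ioo (-ε) ε ∈ 𝓝 (0 : ℝ) := Ioo_mem_nhds (by linarith) hε
  have hd1 : HasFDerivAt φ (fderiv ℝ φ y) y :=
    ((h.contDiffAt hy).differentiableAt (by simp)).hasFDerivAt
  have hd2 : HasFDerivAt φ.symm (fderiv ℝ φ.symm (φ y)) (φ y) :=
    ((h.contDiffAt_symm (φ.map_source hy)).differentiableAt (by simp)).hasFDerivAt
  refine ⟨fderiv ℝ φ y u, ?_, ?_⟩
  · have h1 : HasDerivAt (fun τ => φ (γ τ)) (fderiv ℝ φ y u) 0 := by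
      exact HasFDerivAt.comp_hasDerivAt_of_eq (0 : ℝ) hd1 hγ hγ0.symm
    have hL : IsClosed (L : Set V) := Submodule.closed_of_finiteDimensional L
    refine hL.mem_of_tendsto h1.tendsto_slope_zero ?_
    refine Filter.Eventually.filter_mono nhdsWithin_le_nhds ?_
    have hγc : Tendsto γ (𝓝 0) (𝓝 y) := by
      have := hγ.continuousAt.tendsto; rwa [hγ0] at this
    have hyS : y ∈ S := by rw [← hγ0]; exact hγS 0 ⟨by linarith, hε⟩
    filter_upwards [hIoo, hγc.eventually (φ.open_source.mem_nhds hy)] with τ hτ hs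
    refine L.smul_mem _ (L.sub_mem ?_ ?_)
    · rw [zero_add]; exact (h.mem_iff _ hs).1 (hγS τ hτ)
    · rw [hγ0]; exact (h.mem_iff _ hy).1 hyS
  · have h2 : HasFDerivAt (fun x => φ.symm (φ x)) ((fderiv ℝ φ.symm (φ y)).comp (fderiv ℝ φ y)) y :=
      HasFDerivAt.comp (g := φ.symm) y hd2 hd1
    have h3 : (fun x => φ.symm (φ x)) =ᶠ[𝓝 y] id := by
      filter_upwards [φ.open_source.mem_nhds hy] with x hx using φ.left_inv hx
    have h4 := h2.unique ((hasFDerivAt_id y).congr_of_eventuallyEq h3)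
    exact (DFunLike.congr_fun h4 u).symm

/-- A submanifold need not be closed. Cutting it by a closed subset of a chart makes it so, which is
what the openness arguments use. -/
theorem isClosed_inter [FiniteDimensional ℝ V] (h : IsStraightening S φ L) {B : Set V}
    (hB : IsClosed B) (hBs : B ⊆ φ.source) : IsClosed (S ∩ B) := by
  have h1 : S ∩ B = B ∩ φ ⁻¹' L := by
    ext y
    constructor
    · rintro ⟨h1, h2⟩
      exact ⟨h2, (h.mem_iff y (hBs h2)).1 h1⟩
    · rintro ⟨h1, h2⟩
      exact ⟨(h.mem_iff y (hBs h1)).2 h2, h1⟩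
  rw [h1]
  exact (φ.continuousOn.mono hBs).preimage_isClosed_of_isClosed hB
    (Submodule.closed_of_finiteDimensional L)

end IsStraightening

/-- A smooth left inverse of an immersion. -/
theorem exists_local_leftInverse {M : Type} [NormedAddCommGroup M] [NormedSpace ℝ M]
    [FiniteDimensional ℝ M] [FiniteDimensional ℝ V] {f : M → V} {m : M}
    (cf : ∀ᶠ x in 𝓝 m, ContDiffAt ℝ ∞ f x) (hinj : Function.Injective (fderiv ℝ f m)) :
    ∃ ρ : V → M, (∀ᶠ y in 𝓝 (f m), ContDiffAt ℝ ∞ ρ y) ∧ ∀ᶠ x in 𝓝 m, ρ (f x) = x := by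
  -- With `W` a complement of the range, `(x, k) ↦ f x + k` has an invertible differential at `(m,
  -- 0)`; the first component of its local inverse is the left inverse.
  obtain ⟨W, hW⟩ := Submodule.exists_isCompl ((fderiv ℝ f m) : M →ₗ[ℝ] V).range
  let D : M × W →ₗ[ℝ] V := ((fderiv ℝ f m) : M →ₗ[ℝ] V).coprod W.subtype
  have hD : Function.Bijective D := by
    constructor
    · rw [← LinearMap.ker_eq_bot, LinearMap.ker_eq_bot']
      rintro ⟨x, k⟩ hxk
      have h1 : fderiv ℝ f m x + k = 0 := hxk
      have h2 : (k : V) ∈ ((fderiv ℝ f m) : M →ₗ[ℝ] V).range :=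
        ⟨-x, by
          change fderiv ℝ f m (-x) = k
          rw [map_neg]; exact (eq_neg_of_add_eq_zero_right h1).symm⟩
      have h3 : (k : V) = 0 := Submodule.disjoint_def.1 hW.disjoint _ h2 k.2
      rw [h3, add_zero] at h1
      have h4 : x = 0 := hinj (by rw [h1, map_zero])
      exact Prod.ext h4 (Subtype.ext h3)
    · intro v
      obtain ⟨_, ⟨x, rfl⟩, k, hk, h1⟩ := Submodule.mem_sup.1
        (show v ∈ ((fderiv ℝ f m) : M →ₗ[ℝ] V).range ⊔ W by rw [hW.sup_eq_top]; trivial)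
      exact ⟨(x, ⟨k, hk⟩), h1⟩
  let e : (M × W) ≃L[ℝ] V := (LinearEquiv.ofBijective D hD).toContinuousLinearEquiv
  obtain ⟨G, h1, h2, -⟩ := exists_local_inverse_of_equiv (C := fun p : M × W => f p.1 + p.2)
    (w := (m, 0)) (by
      have := continuousAt_fst (p := (m, (0 : W))).eventually cf
      filter_upwards [this] with p hp
      exact (hp.comp p contDiffAt_fst).add (W.subtypeL.contDiff.contDiffAt.comp p contDiffAt_snd)) e
    (by
      have h := (HasFDerivAt.comp (g := f) (m, (0 : W))
        (cf.self_of_nhds.differentiableAt (by simp)).hasFDerivAt hasFDerivAt_fst).add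
        (HasFDerivAt.comp (g := W.subtypeL) (m, (0 : W)) W.subtypeL.hasFDerivAt hasFDerivAt_snd)
      convert! h using 1)
  refine ⟨fun y => (G y).1, ?_, ?_⟩
  · have e0 : f m + ((0 : W) : V) = f m := by simp
    simp only [e0] at h1
    filter_upwards [h1] with y hy using contDiffAt_fst.comp y hy
  · have hc : Tendsto (fun x : M => (x, (0 : W))) (𝓝 m) (𝓝 (m, 0)) := by
      have : ContinuousAt (fun x : M => (x, (0 : W))) m := by fun_prop
      exact this
    filter_upwards [hc.eventually h2] with x hx
    have := congrArg Prod.fst hx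
    simpa using this

/-- For almost all the parameters, a family of maps which is an immersion as a whole meets a
submanifold transversally: the tangent vectors of the submanifold have all the components along
the parameters. -/
theorem IsStraightening.exists_null_family [FiniteDimensional ℝ V] {Λ M : Type}
    [NormedAddCommGroup Λ] [NormedSpace ℝ Λ] [FiniteDimensional ℝ Λ] [MeasurableSpace Λ]
    [BorelSpace Λ] (ν : MeasureTheory.Measure Λ) [ν.IsAddHaarMeasure]
    [NormedAddCommGroup M] [NormedSpace ℝ M] [FiniteDimensional ℝ M]
    {φ : OpenPartialHomeomorph V V} {L : Submodule ℝ V} (hφ : IsStraightening S φ L)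
    {f : Λ × M → V} {p₀ : Λ × M} (cf : ∀ᶠ p in 𝓝 p₀, ContDiffAt ℝ ∞ f p)
    (hf : Function.Injective (fderiv ℝ f p₀)) (h0 : f p₀ ∈ φ.source) :
    ∃ Z : Set Λ, ν Z = 0 ∧ ∀ᶠ p in 𝓝 p₀, Function.Injective (fderiv ℝ f p) ∧
      (p.1 ∉ Z → f p ∈ S → ∀ a, ∃ u ∈ tangentVectors S (f p), ∀ v, fderiv ℝ f p v = u →
        v.1 = a) := by
  have hinj : ∀ᶠ p in 𝓝 p₀, Function.Injective (fderiv ℝ f p) :=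
    cf.self_of_nhds.fderiv_infty.continuousAt.eventually
      (ContinuousLinearMap.isOpen_injective.mem_nhds hf)
  obtain ⟨ρ, cρ, hρ⟩ := exists_local_leftInverse cf hf
  obtain ⟨W, hW, hWo, hjW⟩ := eventually_nhds_iff.1 (cρ.and (φ.open_source.mem_nhds h0))
  -- The parameter component of the left inverse `ρ`, restricted to `S` in its chart. Working on `S`
  -- rather than on the preimage `f ⁻¹' S` avoids having to know that the latter is a manifold, or
  -- that `S` lies in the image of `f`. The exceptional set is the set of critical values of `μ`.
  set μ : L → Λ := fun y => (ρ (φ.symm y)).1 with hμ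
  set D : Set L := {y | (y : V) ∈ φ.target ∩ φ.symm ⁻¹' W} with hD
  have hDo : IsOpen D :=
    (φ.isOpen_inter_preimage_symm hWo).preimage continuous_subtype_val
  have hsub : ∀ y ∈ D, HasFDerivAt (fun y : L => φ.symm y)
      ((fderiv ℝ φ.symm y).comp L.subtypeL) y := fun y hy =>
    HasFDerivAt.comp (g := φ.symm) (f := L.subtypeL) y
      (((hφ.contDiffAt_symm hy.1).differentiableAt (by simp)).hasFDerivAt) L.subtypeL.hasFDerivAt
  have cμ : ContDiffOn ℝ ∞ μ D := fun y hy => ContDiffAt.contDiffWithinAt <|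
    contDiffAt_fst.comp y (ContDiffAt.comp (g := ρ) y (hW _ hy.2).1
      (ContDiffAt.comp (g := φ.symm) y (hφ.contDiffAt_symm hy.1)
        L.subtypeL.contDiff.contDiffAt))
  refine ⟨_, measure_image_critical ν hDo cμ, ?_⟩
  filter_upwards [hinj, hρ.eventually_nhds, cf,
    cf.self_of_nhds.continuousAt.eventually (hWo.mem_nhds hjW)] with p hpinj hpρ hpf hpW
  refine ⟨hpinj, fun hpZ hpQ a => ?_⟩
  have hps : f p ∈ φ.source := (hW _ hpW).2
  set y : L := ⟨φ (f p), (hφ.mem_iff _ hps).1 hpQ⟩ with hy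
  have hsy : φ.symm (y : V) = f p := φ.left_inv hps
  have hyD : y ∈ D := ⟨φ.map_source hps, by
    change φ.symm y ∈ W
    rwa [hsy]⟩
  have hμy : μ y = p.1 := by
    simp only [hμ, hsy, hpρ.self_of_nhds]
  have hsurj : Function.Surjective (fderiv ℝ μ y) := by
    by_contra hns
    exact hpZ ⟨y, ⟨hyD, hns⟩, hμy⟩
  have hdρ : HasFDerivAt ρ (fderiv ℝ ρ (f p)) (f p) :=
    ((hW _ hpW).1.differentiableAt (by simp)).hasFDerivAt
  have hdμ : ∀ v : L, fderiv ℝ μ y v = (fderiv ℝ ρ (f p) (fderiv ℝ φ.symm y v)).1 := by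
    have h1 : HasFDerivAt (fun y : L => ρ (φ.symm y))
        ((fderiv ℝ ρ (f p)).comp ((fderiv ℝ φ.symm y).comp L.subtypeL)) y :=
      HasFDerivAt.comp (g := ρ) (f := fun y : L => φ.symm y) y (by rw [hsy]; exact hdρ)
        (hsub y hyD)
    have h2 := HasFDerivAt.comp (g := (Prod.fst : Λ × M → Λ)) y hasFDerivAt_fst h1
    have h3 : HasFDerivAt μ _ y := h2
    intro v
    rw [h3.fderiv]
    rfl
  have hdρΨ : ∀ v, fderiv ℝ ρ (f p) (fderiv ℝ f p v) = v := by
    have h1 := HasFDerivAt.comp (g := ρ) p hdρ (hpf.differentiableAt (by simp)).hasFDerivAt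
    have h2 := h1.unique ((hasFDerivAt_id p).congr_of_eventuallyEq hpρ)
    exact fun v => DFunLike.congr_fun h2 v
  -- Since `p.1` is a regular value, some tangent vector of `S` has parameter component `a` under
  -- `dρ`. Any preimage of it under `df` equals its image under `dρ`, hence has the same component.
  obtain ⟨u, hu⟩ := hsurj a
  refine ⟨_, hφ.fderiv_symm_mem_tangentVectors hps hpQ u.2, fun v hv => ?_⟩
  rw [← hu, hdμ, ← hdρΨ v, hv]

end Charts

/-! ### Transversality at a point: rank criterion and almost sure occurrence -/

section TransversalAt

open Filter MeasureTheory

variable {n l r : ℕ} {U : Set (BigJet n)} {C : BigJet n → BigJet n} {c : Fin r → AffineCoeff n}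
  {Q : Set (JetSpace n l)} {φ : OpenPartialHomeomorph (JetSpace n l) (JetSpace n l)}
  {L : Submodule ℝ (JetSpace n l)}

/-- Transversality of the jet extension to `Q` at the point `w`. -/
def JetTransversalAt (l : ℕ) (U : Set (BigJet n)) (C : BigJet n → BigJet n)
    (Q : Set (JetSpace n l)) (w : BigJet n) : Prop :=
  ∀ v ∈ tangentVectors (thetaPContactJets l U) (jet l C w),
    ∃ u ∈ tangentVectors Q (jet l C w), ∃ x : BigJet n, v = u + fderiv ℝ (jet l C) w x

theorem eventuallyEq_jet {C' : BigJet n → BigJet n} {w : BigJet n} (h : C =ᶠ[𝓝 w] C') :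
    jet l C =ᶠ[𝓝 w] jet l C' := by
  have : ∀ᶠ x in 𝓝 w, ∀ k : Fin (l + 1), iteratedFDeriv ℝ (k : ℕ) C x =
      iteratedFDeriv ℝ (k : ℕ) C' x :=
    eventually_all.2 fun k => h.iteratedFDeriv ℝ (k : ℕ)
  filter_upwards [this] with x hx
  exact Prod.ext rfl (funext hx)

theorem JetTransversalAt.congr {C' : BigJet n → BigJet n} {w : BigJet n}
    (hC : JetTransversalAt l U C Q w) (h : C =ᶠ[𝓝 w] C') : JetTransversalAt l U C' Q w := by
  have h1 := eventuallyEq_jet (l := l) h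
  intro v hv
  rw [← h1.eq_of_nhds] at hv ⊢
  rw [← h1.fderiv_eq]
  exact hC v hv

theorem tangentVectors_mono {V : Type} [NormedAddCommGroup V] [NormedSpace ℝ V] {S T : Set V}
    (h : S ⊆ T) (x : V) : tangentVectors S x ⊆ tangentVectors T x := by
  rintro v ⟨ε, γ, hε, h1, h2, h3⟩
  exact ⟨ε, γ, hε, h1, fun τ hτ => h (h2 τ hτ), h3⟩

/-- The differential of the sum of a straightened submanifold and of the jet extension. -/
noncomputable def sumDifferential (φ : OpenPartialHomeomorph (JetSpace n l) (JetSpace n l))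
    (L : Submodule ℝ (JetSpace n l)) (C : BigJet n → BigJet n) (w : BigJet n) :
    L × BigJet n →L[ℝ] JetSpace n l :=
  ((fderiv ℝ φ.symm (φ (jet l C w))).comp L.subtypeL).coprod (fderiv ℝ (jet l C) w)

theorem IsGenerating.range_sumDifferential_le (hc : IsGenerating l c) (hU : IsOpen U)
    (hC : IsThetaPContactEmbeddingOn U C) (hQU : Q ⊆ thetaPContactJets l U)
    (hφ : IsStraightening Q φ L) {w : BigJet n} (hw : w ∈ U) (hj : jet l C w ∈ φ.source)
    (hjQ : jet l C w ∈ Q) :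
    (sumDifferential φ L C w).range ≤ (fderiv ℝ (jetFamily l c C) (0, w)).range := by
  rintro _ ⟨⟨v, x⟩, rfl⟩
  refine Submodule.add_mem _ ?_ ?_
  · exact hc.tangentVectors_subset hU hC hw (tangentVectors_mono hQU _
      (hφ.fderiv_symm_mem_tangentVectors hj hjQ v.2))
  · refine ⟨(0, x), ?_⟩
    refine (fderiv_jetFamily_right (p := ((0 : Fin r → ℝ), w)) hU hC hw x).trans ?_
    simp only [shearFamily_zero]
    rfl

/-- The sum of the tangent vectors of `Q` and of the image of the jet extension always lies in the
range of `dΨ`. That range has dimension `dim(a, w)` and contains all tangent vectors of the space of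
jets, so transversality means that the sum fills it. -/
theorem IsGenerating.jetTransversalAt_iff (hc : IsGenerating l c) (hU : IsOpen U)
    (hC : IsThetaPContactEmbeddingOn U C) (hQU : Q ⊆ thetaPContactJets l U)
    (hφ : IsStraightening Q φ L) {w : BigJet n} (hw : w ∈ U) (hj : jet l C w ∈ φ.source)
    (hjQ : jet l C w ∈ Q) :
    JetTransversalAt l U C Q w ↔ Module.finrank ℝ ((Fin r → ℝ) × BigJet n) ≤
      Module.finrank ℝ (sumDifferential φ L C w).range := by
  have hle := hc.range_sumDifferential_le hU hC hQU hφ hw hj hjQ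
  have hinj := hc.injective_fderiv_jetFamily hU hC hw
  have hfin := LinearMap.finrank_range_of_inj hinj
  constructor
  · intro h
    rw [← hfin]
    refine Submodule.finrank_mono ?_
    rintro _ ⟨y, rfl⟩
    have hy := fderiv_jetFamily_mem_tangentVectors (l := l) (c := c) (p := (0, w)) hU hC hw y
    rw [jetFamily_zero] at hy
    obtain ⟨u, hu, x, hx⟩ := h _ hy
    obtain ⟨v, hv, rfl⟩ := hφ.exists_of_mem_tangentVectors hj hu
    exact ⟨(⟨v, hv⟩, x), hx.symm⟩
  · intro h v hv
    have heq := Submodule.eq_of_le_of_finrank_le hle (hfin.le.trans h)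
    have h1 := hc.tangentVectors_subset hU hC hw hv
    rw [← heq] at h1
    obtain ⟨⟨u, x⟩, h2⟩ := h1
    exact ⟨_, hφ.fderiv_symm_mem_tangentVectors hj hjQ u.2, x, h2.symm⟩

/-- Almost all the deformations of `C` are transversal to `Q`, locally. -/
theorem IsGenerating.exists_null_local (hc : IsGenerating l c) (hU : IsOpen U)
    (hC : IsThetaPContactEmbeddingOn U C) (hQU : Q ⊆ thetaPContactJets l U)
    (hφ : IsStraightening Q φ L) {B : Set (JetSpace n l)} (hB : IsClosed B) (hBs : B ⊆ φ.source)
    {w₀ : BigJet n} (hw₀ : w₀ ∈ U) :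
    ∃ Z : Set (Fin r → ℝ), volume Z = 0 ∧ ∀ᶠ p in 𝓝 ((0 : Fin r → ℝ), w₀), p.1 ∉ Z →
      jetFamily l c C p ∈ Q ∩ B →
      JetTransversalAt l U (fun x => shearFamily l c p.1 (C x)) Q p.2 := by
  have hcont : ContinuousAt (jetFamily l c C) (0, w₀) :=
    (contDiffAt_jetFamily (p := ((0 : Fin r → ℝ), w₀)) hU hC hw₀).continuousAt
  -- If the undeformed jet is outside the closed set `Q ∩ B`, so are all nearby jets and there is
  -- nothing to prove.
  by_cases h0 : jetFamily l c C (0, w₀) ∈ Q ∩ B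
  swap
  · refine ⟨∅, measure_empty, ?_⟩
    filter_upwards [hcont.eventually ((hφ.isClosed_inter hB hBs).isOpen_compl.mem_nhds h0)]
      with p hp _ hp'
    exact absurd hp' hp
  have hUe : ∀ᶠ p in 𝓝 ((0 : Fin r → ℝ), w₀), p.2 ∈ U :=
    (continuousAt_snd (p := ((0 : Fin r → ℝ), w₀))).eventually (hU.mem_nhds hw₀)
  have hsm : ∀ᶠ p in 𝓝 ((0 : Fin r → ℝ), w₀), ContDiffAt ℝ ∞ (jetFamily l c C) p := by
    filter_upwards [hUe] with p hp using contDiffAt_jetFamily hU hC hp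
  obtain ⟨Z, hZ, h⟩ := hφ.exists_null_family volume hsm
    (hc.injective_fderiv_jetFamily hU hC hw₀) (hBs h0.2)
  refine ⟨Z, hZ, ?_⟩
  filter_upwards [hUe, h] with p hpU hp hpZ ⟨hpQ, hpB⟩
  obtain ⟨hpinj, hp⟩ := hp
  have htan := hc.tangentVectors_jetFamily_subset hU hC hpU hpinj
  intro v hv
  obtain ⟨⟨a, x⟩, rfl⟩ := htan hv
  obtain ⟨u, huQ, hu⟩ := hp hpZ hpQ a
  obtain ⟨⟨a', x'⟩, hu'⟩ := htan (tangentVectors_mono hQU _ huQ)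
  have hu'' : fderiv ℝ (jetFamily l c C) p (a', x') = u := hu'
  obtain rfl : a' = a := hu _ hu''
  -- The given vector and `u` are images under `dΨ` of vectors with the same parameter component, so
  -- they differ by the image of `(0, x - x')`, which is tangent to the jet extension of the
  -- deformed embedding.
  refine ⟨u, huQ, x - x', ?_⟩
  rw [← fderiv_jetFamily_right hU hC hpU]
  have h1 : ((0, x - x') : (Fin r → ℝ) × BigJet n) = (a', x) - (a', x') := by simp
  rw [h1, map_sub, hu'']
  exact (add_sub_cancel _ _).symm

end TransversalAt

/-! ### Lower semicontinuity of the rank -/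

section RankSemicontinuity

open Filter

theorem eventually_le_finrank_range {X E V : Type} [TopologicalSpace X] [NormedAddCommGroup E]
    [NormedSpace ℝ E] [FiniteDimensional ℝ E] [NormedAddCommGroup V] [NormedSpace ℝ V]
    {M : X → E →L[ℝ] V} {x : X} (hM : ContinuousAt M x) {d : ℕ}
    (hd : d ≤ Module.finrank ℝ (M x).range) : ∀ᶠ y in 𝓝 x, d ≤ Module.finrank ℝ (M y).range := by
  have h : ∀ T : E →L[ℝ] V, d ≤ Module.finrank ℝ T.range ↔ (d : Cardinal) ≤ (T : E →ₗ[ℝ] V).rank := by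
    intro T
    rw [LinearMap.rank, ← Module.finrank_eq_rank]
    exact Nat.cast_le.symm
  have h1 : {T : E →L[ℝ] V | (d : Cardinal) ≤ (T : E →ₗ[ℝ] V).rank} ∈ 𝓝 (M x) :=
    (isOpen_setOfPred_nat_le_rank d).mem_nhds ((h _).1 hd)
  filter_upwards [hM.eventually h1] with y hy using (h _).2 hy

theorem eventually_le_finrank_range_coprod {X E V : Type} [TopologicalSpace X]
    [NormedAddCommGroup E] [NormedSpace ℝ E] [FiniteDimensional ℝ E] [NormedAddCommGroup V]
    [NormedSpace ℝ V] [FiniteDimensional ℝ V] {L : Submodule ℝ V} {A : X → V →L[ℝ] V}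
    {B : X → E →L[ℝ] V} {x : X} (hA : ContinuousAt A x) (hB : ContinuousAt B x) {d : ℕ}
    (hd : d ≤ Module.finrank ℝ (((A x).comp L.subtypeL).coprod (B x)).range) :
    ∀ᶠ y in 𝓝 x, d ≤ Module.finrank ℝ (((A y).comp L.subtypeL).coprod (B y)).range := by
  refine eventually_le_finrank_range ?_ hd
  rw [continuousAt_clm_apply]
  rintro ⟨v, e⟩
  exact (hA.clm_apply continuousAt_const).add (hB.clm_apply continuousAt_const)

end RankSemicontinuity

/-! ### Continuity of deformations and of jet evaluation in the `C^∞` topology -/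

section EmbeddingSpace

open Filter MeasureTheory

variable {n l r : ℕ} {U : Set (BigJet n)} {c : Fin r → AffineCoeff n}

theorem IsThetaPContactEmbeddingOn.congr {C C' : BigJet n → BigJet n}
    (hC : IsThetaPContactEmbeddingOn U C) (hU : IsOpen U) (h : EqOn C' C U) :
    IsThetaPContactEmbeddingOn U C' := by
  have hd : ∀ w ∈ U, fderiv ℝ C' w = fderiv ℝ C w := fun w hw =>
    Filter.EventuallyEq.fderiv_eq (by filter_upwards [hU.mem_nhds hw] with x hx using h hx)
  refine { contDiffOn := hC.contDiffOn.congr h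
           injective_fderiv := fun w hw => by rw [hd w hw]; exact hC.injective_fderiv w hw
           isEmbedding := ?_
           contact := fun w hw v => by rw [hd w hw, h hw]; exact hC.contact w hw v
           hasPForm := ?_
           preserves := fun w hw v => by rw [hd w hw, h hw]; exact hC.preserves w hw v }
  · have : U.domRestrict C' = U.domRestrict C := funext fun x => h x.2
    rw [this]
    exact hC.isEmbedding
  · obtain ⟨qC, zC, hC', pC, hf⟩ := hC.hasPForm
    exact ⟨qC, zC, hC', pC, fun t q z s p hw => by rw [h hw]; exact hf t q z s p hw⟩

open Classical in
/-- Post-composition of an embedding of `U` with a strict diffeomorphism. -/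
noncomputable def ThetaPContactEmbedding.post (hU : IsOpen U) {D : BigJet n → BigJet n}
    (hD : IsStrictDiffeo D) (C : ThetaPContactEmbedding U) : ThetaPContactEmbedding U where
  toFun w := if w ∈ U then D (C.toFun w) else 0
  eq_zero _ hw := if_neg hw
  isThetaPContactEmbeddingOn :=
    (hD.isThetaPContactEmbeddingOn hU C.isThetaPContactEmbeddingOn).congr hU fun _ hw => if_pos hw

theorem ThetaPContactEmbedding.post_eventuallyEq (hU : IsOpen U) {D : BigJet n → BigJet n}
    (hD : IsStrictDiffeo D) (C : ThetaPContactEmbedding U) {w : BigJet n} (hw : w ∈ U) :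
    (C.post hU hD).toFun =ᶠ[𝓝 w] fun w => D (C.toFun w) := by
  filter_upwards [hU.mem_nhds hw] with x hx using if_pos hx

theorem ThetaPContactEmbedding.tendsto_iff {ι : Type} {p : Filter ι}
    {F : ι → ThetaPContactEmbedding U} {C : ThetaPContactEmbedding U} :
    Tendsto F p (𝓝 C) ↔ ∀ (k : ℕ) (K : Set (BigJet n)), IsCompact K → K ⊆ U →
      TendstoUniformlyOn (fun i => iteratedFDeriv ℝ k (F i).toFun) (iteratedFDeriv ℝ k C.toFun)
        p K := by
  rw [ThetaPContactEmbedding.instTopologicalSpace, nhds_iInf, tendsto_iInf]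
  refine forall_congr' fun k => ?_
  rw [nhds_induced, tendsto_comap_iff, UniformOnFun.tendsto_iff_tendstoUniformlyOn]
  exact ⟨fun h K h1 h2 => h K ⟨h1, h2⟩, fun h K hK => h K hK.1 hK.2⟩

/-- All space derivatives of the deformations are jointly continuous in `(a, w)`; compactness of `K`
makes the convergence as `a → 0` uniform. -/
theorem tendsto_post_shearFamily (hU : IsOpen U) (c : Fin r → AffineCoeff n)
    (C : ThetaPContactEmbedding U) :
    Tendsto (fun a => C.post hU (isStrictDiffeo_shearFamily (l := l) c a)) (𝓝 0) (𝓝 C) := by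
  refine ThetaPContactEmbedding.tendsto_iff.2 fun k K hK hKU => ?_
  rw [Metric.tendstoUniformlyOn_iff]
  intro ε hε
  refine hK.eventually_forall_of_forall_eventually fun w hw => ?_
  have hC := C.isThetaPContactEmbeddingOn
  have h1 : ContinuousAt (fun p : (Fin r → ℝ) × BigJet n =>
      iteratedFDeriv ℝ k (fun x => shearFamily l c p.1 (C.toFun x)) p.2) (0, w) :=
    (contDiffAt_iteratedFDeriv_shearFamily_comp (l := l) (c := c) (p := ((0 : Fin r → ℝ), w))
      hU hC k (hKU hw)).continuousAt
  have h2 : ContinuousAt (fun p : (Fin r → ℝ) × BigJet n => iteratedFDeriv ℝ k C.toFun p.2)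
      (0, w) :=
    ContinuousAt.comp (g := iteratedFDeriv ℝ k C.toFun)
      ((hC.contDiffAt hU (hKU hw)).iteratedFDeriv_infty k).continuousAt continuousAt_snd
  have h3 := h2.dist h1
  have h4 : dist (iteratedFDeriv ℝ k C.toFun w)
      (iteratedFDeriv ℝ k (fun x => shearFamily l c 0 (C.toFun x)) w) < ε := by
    simp only [shearFamily_zero]
    rwa [dist_self]
  have h5 : ∀ᶠ p in 𝓝 ((0 : Fin r → ℝ), w), p.2 ∈ U :=
    (continuousAt_snd (p := ((0 : Fin r → ℝ), w))).eventually (hU.mem_nhds (hKU hw))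
  filter_upwards [h3.eventually (gt_mem_nhds h4), h5] with p hp hpU
  rw [((C.post_eventuallyEq hU (isStrictDiffeo_shearFamily c p.1) hpU).iteratedFDeriv ℝ
    k).eq_of_nhds]
  exact hp

/-- Uniform convergence on a compact neighbourhood of `w` inside `U`, combined with continuity of
the limit, gives continuity in the map and the point together. -/
theorem continuousAt_iteratedFDeriv_eval (hU : IsOpen U) (k : ℕ) (C : ThetaPContactEmbedding U)
    {w : BigJet n} (hw : w ∈ U) :
    ContinuousAt (fun p : ThetaPContactEmbedding U × BigJet n =>
      iteratedFDeriv ℝ k p.1.toFun p.2) (C, w) := by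
  have h1 : Continuous fun C : ThetaPContactEmbedding U =>
      UniformOnFun.ofFun {K : Set (BigJet n) | IsCompact K ∧ K ⊆ U}
        (iteratedFDeriv ℝ k C.toFun) :=
    continuous_iInf_dom (i := k) continuous_induced_dom
  obtain ⟨K, hwK, hKU, hK⟩ := local_compact_nhds (hU.mem_nhds hw)
  have h2 := UniformOnFun.continuousAt_eval₂
    (f := UniformOnFun.ofFun {K : Set (BigJet n) | IsCompact K ∧ K ⊆ U}
        (iteratedFDeriv ℝ k C.toFun)) (x := w) ⟨K, ⟨hK, hKU⟩, hwK⟩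
    ((C.isThetaPContactEmbeddingOn.contDiffAt hU hw).iteratedFDeriv_infty k).continuousAt
  exact ContinuousAt.comp (f := fun p : ThetaPContactEmbedding U × BigJet n =>
      (UniformOnFun.ofFun {K : Set (BigJet n) | IsCompact K ∧ K ⊆ U}
        (iteratedFDeriv ℝ k p.1.toFun), p.2)) (x := (C, w)) h2
    ((h1.comp continuous_fst).prodMk continuous_snd).continuousAt

theorem continuousAt_jet_eval (hU : IsOpen U) (C : ThetaPContactEmbedding U)
    {w : BigJet n} (hw : w ∈ U) :
    ContinuousAt (fun p : ThetaPContactEmbedding U × BigJet n => jet l p.1.toFun p.2) (C, w) :=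
  continuousAt_snd.prodMk (continuousAt_pi.2 fun k =>
    continuousAt_iteratedFDeriv_eval hU k C hw)

theorem eventually_snd_mem (hU : IsOpen U) (C : ThetaPContactEmbedding U)
    {w : BigJet n} (hw : w ∈ U) : ∀ᶠ p in 𝓝 (C, w), p.2 ∈ U :=
  (continuousAt_snd (p := (C, w))).eventually (hU.mem_nhds hw)

/-- The differential of the `l`-jet involves derivatives of order `l + 1`, which the `C^∞` topology
also controls. -/
theorem continuousAt_fderiv_jet_eval (hU : IsOpen U) (C : ThetaPContactEmbedding U)
    {w : BigJet n} (hw : w ∈ U) :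
    ContinuousAt (fun p : ThetaPContactEmbedding U × BigJet n =>
      fderiv ℝ (jet l p.1.toFun) p.2) (C, w) := by
  rw [continuousAt_clm_apply]
  intro x
  have h1 : ContinuousAt (fun p : ThetaPContactEmbedding U × BigJet n =>
      ((x, fun k => continuousMultilinearCurryLeftEquiv ℝ (fun _ : Fin ((k : ℕ) + 1) => BigJet n)
        (BigJet n) (iteratedFDeriv ℝ ((k : ℕ) + 1) p.1.toFun p.2) x) : JetSpace n l)) (C, w) := by
    refine continuousAt_const.prodMk (continuousAt_pi.2 fun k => ?_)
    exact (ContinuousAt.comp (g := continuousMultilinearCurryLeftEquiv ℝ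
      (fun _ : Fin ((k : ℕ) + 1) => BigJet n) (BigJet n))
      (LinearIsometryEquiv.continuous _).continuousAt
      (continuousAt_iteratedFDeriv_eval hU _ C hw)).clm_apply continuousAt_const
  refine h1.congr ?_
  filter_upwards [eventually_snd_mem hU C hw] with p hp
  rw [(hasFDerivAt_jet (p.1.isThetaPContactEmbeddingOn.contDiffAt hU hp)).fderiv]
  refine Prod.ext rfl (funext fun k => ?_)
  simp only [iteratedFDeriv_succ_eq_comp_left, Function.comp, LinearIsometryEquiv.apply_symm_apply]
  rfl

end EmbeddingSpace

/-! ### Open dense sets of transversal embeddings and conclusion -/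

section Residual

open Filter MeasureTheory

variable {n l r : ℕ} {U : Set (BigJet n)} {c : Fin r → AffineCoeff n}
  {Q B : Set (JetSpace n l)} {φ : OpenPartialHomeomorph (JetSpace n l) (JetSpace n l)}
  {L : Submodule ℝ (JetSpace n l)} {K : Set (BigJet n)}

/-- The embeddings which are transversal to `Q` at the points of `K` where their jets lie in `B`. -/
def transversalOn (l : ℕ) (U : Set (BigJet n)) (Q B : Set (JetSpace n l)) (K : Set (BigJet n)) :
    Set (ThetaPContactEmbedding U) :=
  {C | ∀ w ∈ K, jet l C.toFun w ∈ Q ∩ B → JetTransversalAt l U C.toFun Q w}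

/-- Near a pair `(C, w)` the condition is either vacuous, when the jet is outside `Q ∩ B`, or
implied by the rank criterion, which is open. Compactness of `K` turns this into a condition on `C`
alone. -/
theorem IsGenerating.isOpen_transversalOn (hc : IsGenerating l c) (hU : IsOpen U)
    (hQU : Q ⊆ thetaPContactJets l U) (hφ : IsStraightening Q φ L) (hB : IsClosed B)
    (hBs : B ⊆ φ.source) (hK : IsCompact K) (hKU : K ⊆ U) : IsOpen (transversalOn l U Q B K) := by
  rw [isOpen_iff_mem_nhds]
  intro C hC
  refine hK.eventually_forall_of_forall_eventually fun w hw => ?_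
  have hjet := continuousAt_jet_eval (l := l) hU C (hKU hw)
  by_cases h0 : jet l C.toFun w ∈ Q ∩ B
  swap
  · filter_upwards [hjet.eventually ((hφ.isClosed_inter hB hBs).isOpen_compl.mem_nhds h0)]
      with p hp hp'
    exact absurd hp' hp
  have hs : jet l C.toFun w ∈ φ.source := hBs h0.2
  have hA : ContinuousAt (fun p : ThetaPContactEmbedding U × BigJet n =>
      fderiv ℝ φ.symm (φ (jet l p.1.toFun p.2))) (C, w) := by
    have h1 : ContinuousAt (fun y => fderiv ℝ φ.symm (φ y)) (jet l C.toFun w) :=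
      ContinuousAt.comp (g := fderiv ℝ φ.symm) (f := φ)
        (hφ.contDiffAt_symm (φ.map_source hs)).fderiv_infty.continuousAt
        (hφ.contDiffAt hs).continuousAt
    exact ContinuousAt.comp (g := fun y => fderiv ℝ φ.symm (φ y))
      (f := fun p : ThetaPContactEmbedding U × BigJet n => jet l p.1.toFun p.2) (x := (C, w))
      h1 hjet
  have hrank := eventually_le_finrank_range_coprod (L := L) hA
    (continuousAt_fderiv_jet_eval hU C (hKU hw)) ((hc.jetTransversalAt_iff hU
      C.isThetaPContactEmbeddingOn hQU hφ (hKU hw) hs h0.1).1 (hC w hw h0))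
  filter_upwards [hrank, eventually_snd_mem hU C (hKU hw)] with p hp hpU hpQ
  exact (hc.jetTransversalAt_iff hU p.1.isThetaPContactEmbeddingOn hQU hφ hpU (hBs hpQ.2)
    hpQ.1).2 hp

/-- Almost every small parameter of the shear family makes the deformation of `C` transversal along
the whole of `K`, and these deformations converge to `C` as the parameter tends to `0`. -/
theorem IsGenerating.dense_transversalOn (hc : IsGenerating l c) (hU : IsOpen U)
    (hQU : Q ⊆ thetaPContactJets l U) (hφ : IsStraightening Q φ L) (hB : IsClosed B)
    (hBs : B ⊆ φ.source) (hK : IsCompact K) (hKU : K ⊆ U) : Dense (transversalOn l U Q B K) := by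
  intro C
  have hC := C.isThetaPContactEmbeddingOn
  have key : ∃ Z : Set (Fin r → ℝ), volume Z = 0 ∧ ∀ᶠ a in 𝓝 (0 : Fin r → ℝ), a ∉ Z →
      ∀ w ∈ K, jetFamily l c C.toFun (a, w) ∈ Q ∩ B →
        JetTransversalAt l U (fun x => shearFamily l c a (C.toFun x)) Q w := by
    -- The null set of bad parameters and the neighbourhood of `0` are local in `w`; a finite
    -- subcover of `K` leaves a finite union of null sets and a finite intersection of
    -- neighbourhoods.
    refine hK.induction_on (p := fun K => ∃ Z : Set (Fin r → ℝ), volume Z = 0 ∧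
      ∀ᶠ a in 𝓝 (0 : Fin r → ℝ), a ∉ Z → ∀ w ∈ K, jetFamily l c C.toFun (a, w) ∈ Q ∩ B →
        JetTransversalAt l U (fun x => shearFamily l c a (C.toFun x)) Q w) ?_ ?_ ?_ ?_
    · exact ⟨∅, measure_empty, Eventually.of_forall fun a _ w hw => absurd hw (notMem_empty w)⟩
    · rintro s t hst ⟨Z, hZ, h⟩
      exact ⟨Z, hZ, h.mono fun a ha haZ w hw => ha haZ w (hst hw)⟩
    · rintro s t ⟨Z, hZ, h⟩ ⟨Z', hZ', h'⟩
      refine ⟨Z ∪ Z', measure_union_null hZ hZ', ?_⟩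
      filter_upwards [h, h'] with a ha ha' haZ w hw
      rcases hw with hw | hw
      · exact ha (fun h => haZ (Or.inl h)) w hw
      · exact ha' (fun h => haZ (Or.inr h)) w hw
    · intro w hw
      obtain ⟨Z, hZ, h⟩ := hc.exists_null_local hU hC hQU hφ hB hBs (hKU hw)
      rw [nhds_prod_eq] at h
      obtain ⟨P, hP, P', hP', hPP⟩ := Filter.eventually_prod_iff.1 h
      refine ⟨{w | P' w}, mem_nhdsWithin_of_mem_nhds hP', Z, hZ, ?_⟩
      filter_upwards [hP] with a ha haZ w hw
      exact hPP ha hw haZ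
  obtain ⟨Z, hZ, h⟩ := key
  -- A null set has dense complement, so good parameters exist arbitrarily close to `0`.
  have hdense : Dense {a : Fin r → ℝ | a ∉ Z} :=
    Measure.dense_of_ae (μ := volume) (measure_eq_zero_iff_ae_notMem.1 hZ)
  refine mem_closure_of_frequently_of_tendsto ?_ (tendsto_post_shearFamily (l := l) hU c C)
  have hfreq : ∃ᶠ a in 𝓝 (0 : Fin r → ℝ), a ∉ Z := mem_closure_iff_frequently.1 (hdense 0)
  refine (hfreq.and_eventually h).mono ?_
  rintro a ⟨haZ, ha⟩ w hw hjw
  have heq := C.post_eventuallyEq hU (isStrictDiffeo_shearFamily (l := l) c a) (hKU hw)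
  refine (ha haZ w hw ?_).congr heq.symm
  rwa [(eventuallyEq_jet (l := l) heq).eq_of_nhds] at hjw

theorem jetTransversal_mem_residual (hU : IsOpen U) (hQ : IsSmoothSubmanifold Q)
    (hQU : Q ⊆ thetaPContactJets l U) :
    {C : ThetaPContactEmbedding U | JetTransversal l U C.toFun Q} ∈
      residual (ThetaPContactEmbedding U) := by
  obtain ⟨r, c, hc⟩ := exists_isGenerating n l
  -- The radius is chosen for every jet so that it can be a function; its value `0` away from `Q`
  -- plays no role. The same device is used for the balls in `U`.
  have hballs : ∀ j : JetSpace n l, ∃ ρ : ℝ, j ∈ Q → 0 < ρ ∧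
      ∃ (φ : OpenPartialHomeomorph (JetSpace n l) (JetSpace n l))
        (L : Submodule ℝ (JetSpace n l)), IsStraightening Q φ L ∧
          Metric.closedBall j ρ ⊆ φ.source := by
    intro j
    by_cases hj : j ∈ Q
    · obtain ⟨φ, L, hjφ, h1, h2, h3⟩ := hQ j hj
      obtain ⟨ρ, hρ, hρφ⟩ := Metric.nhds_basis_closedBall.mem_iff.1
        (φ.open_source.mem_nhds hjφ)
      exact ⟨ρ, fun _ => ⟨hρ, φ, L, ⟨h1, h2, h3⟩, hρφ⟩⟩
    · exact ⟨0, fun h => absurd h hj⟩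
  choose ρ hρ using hballs
  have hballs' : ∀ w : BigJet n, ∃ δ : ℝ, w ∈ U → 0 < δ ∧ Metric.closedBall w δ ⊆ U := by
    intro w
    by_cases hw : w ∈ U
    · obtain ⟨δ, hδ, hδU⟩ := Metric.nhds_basis_closedBall.mem_iff.1 (hU.mem_nhds hw)
      exact ⟨δ, fun _ => ⟨hδ, hδU⟩⟩
    · exact ⟨0, fun h => absurd h hw⟩
  choose δ hδ using hballs'
  obtain ⟨t, htQ, htc, ht⟩ := TopologicalSpace.countable_cover_nhdsWithin
    (f := fun j => Metric.closedBall j (ρ j)) (s := Q) fun j hj =>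
      mem_nhdsWithin_of_mem_nhds (Metric.closedBall_mem_nhds j (hρ j hj).1)
  obtain ⟨t', htU, htc', ht'⟩ := TopologicalSpace.countable_cover_nhdsWithin
    (f := fun w => Metric.closedBall w (δ w)) (s := U) fun w hw =>
      mem_nhdsWithin_of_mem_nhds (Metric.closedBall_mem_nhds w (hδ w hw).1)
  have hres : ⋂ j ∈ t, ⋂ w ∈ t', transversalOn l U Q (Metric.closedBall j (ρ j))
      (Metric.closedBall w (δ w)) ∈ residual (ThetaPContactEmbedding U) := by
    refine (countable_bInter_mem htc).2 fun j hj => (countable_bInter_mem htc').2 fun w hw => ?_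
    obtain ⟨-, φ, L, hφ, hs⟩ := hρ j (htQ hj)
    have hK := isCompact_closedBall w (δ w)
    have hKU := (hδ w (htU hw)).2
    exact residual_of_dense_open
      (hc.isOpen_transversalOn hU hQU hφ Metric.isClosed_closedBall hs hK hKU)
      (hc.dense_transversalOn hU hQU hφ Metric.isClosed_closedBall hs hK hKU)
  refine mem_of_superset hres fun C hC w hw hjw => ?_
  obtain ⟨j, hj, hjB⟩ := mem_iUnion₂.1 (ht hjw)
  obtain ⟨w', hw', hwB⟩ := mem_iUnion₂.1 (ht' hw)
  exact mem_iInter₂.1 (mem_iInter₂.1 hC j hj) w' hw' w hwB ⟨hjw, hjB⟩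

end Residual

theorem mainTheorem5 (n l : ℕ) (U : Set (BigJet n)) (hU : IsOpen U)
    (Q : ℕ → Set (JetSpace n l))
    (hQ : ∀ i, IsSmoothSubmanifold (Q i))
    (hQU : ∀ i, Q i ⊆ thetaPContactJets l U) :
    {C : ThetaPContactEmbedding U | ∀ i, JetTransversal l U C.toFun (Q i)} ∈
      residual (ThetaPContactEmbedding U) := by
  rw [show {C : ThetaPContactEmbedding U | ∀ i, JetTransversal l U C.toFun (Q i)} =
    ⋂ i, {C | JetTransversal l U C.toFun (Q i)} from Set.ofPred_forall _]
  exact countable_iInter_mem.2 fun i => jetTransversal_mem_residual hU (hQ i) (hQU i)
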